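/- Let $k$ be an algebraically closed field of characteristic $p>0$ and let $R=k[t^{\pm1}]$ or $R=k((t))$. For $n\ge 0$ let $\delta_t^{(n)}$ be the $k$-linear operator on $R$ given by $\delta_t^{(n)}(t^r)=\binom rn t^r$ (applied termwise to series). A stratified bundle on $R$ is a finitely generated $R$-module $E$ with an action of the operators $\delta_t^{(n)}$ satisfying the Leibniz rule $\delta_t^{(n)}(fx)=\sum_{a+b=n}\delta_t^{(a)}(f)\,\delta_t^{(b)}(x)$ and the $k$-linear and composition relations which the $\delta_t^{(n)}$ satisfy on $R$. (For $R=k[t^{\pm1}]$ these are the $\mathcal O$-coherent $\mathcal D$-modules on $\mathbb G_m$; for $R=k((t))$ they are the iterated differential modules.) Morphisms are the $R$-linear maps commuting with all $\delta_t^{(n)}$; write $\mathrm{Strat}(R)$ for the category, which has tensor products (with $\delta_t^{(n)}(x\otimes y)=\sum_{a+b=n}\delta_t^{(a)}x\otimes\delta_t^{(b)}y$) and the trivial object $R$. For $\alpha\in\mathbb Z_p$ let $\mathcal O_R(\alpha)$ be the free $R$-module of rank $1$ with basis element $1$ such that $\delta_t^{(n)}(1)=\binom{\alpha}{n}$. A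 stratified bundle $E$ on $k((t))$ is regular singular if it contains a free $k[[t]]$-submodule of rank $\dim E$ stable under all $\delta_t^{(n)}$; one on $k[t^{\pm1}]$ is regular singular at $0$ (resp. at $\infty$) if it contains a free $k[t]$-submodule (resp. $k[t^{-1}]$-submodule) of the same rank stable under all $\delta_t^{(n)}$ (resp. all $\delta_{t^{-1}}^{(n)}$). Let $R^{p^n}$ be the subring of $p^n$-th powers, and let $R^1\varprojlim_n\mathbb G_m(R^{p^n})$ be the quotient of $\prod_{n\ge0}(R^{p^n})^\times$ by the subgroup of all $(g_ng_{n+1}^{-1})_n$. To a rank $1$ stratified bundle $E$ attach a class in this group as follows: choose bases $e_n$ of the $R^{p^n}$-modules $E^{(n)}=\{x\in E:\delta_t^{(p^m)}x=0 \text{ for } m<n\}$ and take the class of $(u_n)_n$, where $e_n=u_ne_{n+1}$. Then: 1. $\mathcal O_R(\alpha)$ is isomorphic to the trivial stratified bundle if and only if $\alpha\in\mathbb Z$. 2. For $\alpha,\beta\in\mathbb Z_p$, every nonzero morphism $\mathcal O_R(\alpha)\to\mathcal O_R(\beta)$ is an isomorphism, and $\mathrm{Hom}(\mathcal O_R(\alpha),\mathcal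 O_R(\beta))$ is isomorphic to $k$ as a $k$-vector space if $\alpha-\beta\in\mathbb Z$, and is $0$ otherwise. 3. $\mathcal O_{k((t))}(\alpha)$ is regular singular, and $\mathcal O_{k[t^{\pm1}]}(\alpha)$ is regular singular at $0$ and at $\infty$. 4. The set of isomorphism classes of rank $1$ stratified bundles on $R$ is an abelian group under the tensor product, with unit the trivial bundle. The class construction above is well defined and gives an isomorphism from this group onto $R^1\varprojlim_n\mathbb G_m(R^{p^n})$, and there is an isomorphism $R^1\varprojlim_n\mathbb G_m(R^{p^n})\cong\mathbb Z_p/\mathbb Z$ under which the class of $\mathcal O_R(\alpha)$ corresponds to $\alpha$ mod $\mathbb Z$. If $\alpha=\sum_{n\ge0}\alpha_np^n$ with integers $0\le\alpha_n<p$, the class of $\mathcal O_R(\alpha)$ is represented by $(t^{\alpha_np^n})_n$. Every rank $1$ stratified bundle on $R$ is isomorphic to $\mathcal O_R(\alpha)$ for some $\alpha\in\mathbb Z_p$. 5. Under the identifications of 4 (for $k((t^{-1}))$ use those of $k((s))$ with $s=t^{-1}$), the map $R^1\varprojlim_n\mathbb G_m(k[t^{\pm1}]^{p^n})\to R^1\varprojlim_n\mathbb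 G_m(k((t))^{p^n})$ induced by the inclusion $k[t^{\pm1}]\subset k((t))$ is the identity of $\mathbb Z_p/\mathbb Z$, and the one induced by $k[t^{\pm1}]\subset k((t^{-1}))$ is $-\mathrm{id}$. The same holds for the maps on isomorphism classes of rank $1$ stratified bundles given by restriction (base change) to $k((t))$ and to $k((t^{-1}))$, where on $k((t^{-1}))$ the operators $\delta_{t^{-1}}^{(n)}=(-1)^n\sum_{j\le n}\binom{n-1}{n-j}\delta_t^{(j)}$ are used (with $\delta_{t^{-1}}^{(0)}=\mathrm{id}$). 6. Restriction $E\mapsto E\otimes_{k[t^{\pm1}]}k((t))$ is an equivalence from the full subcategory of rank $1$ objects of $\mathrm{Strat}(k[t^{\pm1}])$ to that of $\mathrm{Strat}(k((t)))$. -/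

import Mathlib

namespace Stratified

open Finset

/-- The structure constants of the algebra spanned by the operators `δ⁽ⁿ⁾ : t ^ r ↦ (r choose n) t ^ r`:
`(x choose m) (x choose n) = ∑ j ≤ m + n, structConst m n j * (x choose j)`. -/
def structConst (m n j : ℕ) : ℕ :=
  if j ≤ m + n then j.choose n * n.choose (m + n - j) else 0

open Polynomial in
theorem structConst_eq_coeff (m n j : ℕ) :
    structConst m n j =
      (((C (X : ℕ[X]) + X * C (1 + X)) ^ j : (ℕ[X])[X]).coeff n).coeff m := by
  have e : (C (X : ℕ[X]) + X * C (1 + X)) ^ j = ∑ i ∈ range (j + 1),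
      C (X : ℕ[X]) ^ i * (X * C (1 + X)) ^ (j - i) * ((j.choose i : ℕ) : (ℕ[X])[X]) :=
    add_pow (C (X : ℕ[X])) (X * C (1 + X) : (ℕ[X])[X]) j
  rw [e, finsetSum_coeff]
  have h : ∀ i ∈ range (j + 1),
      ((C (X : ℕ[X]) ^ i * (X * C (1 + X)) ^ (j - i) * ((j.choose i : ℕ) : (ℕ[X])[X])).coeff n)
        = if j - i = n then (X : ℕ[X]) ^ i * (1 + X) ^ n * ((j.choose i : ℕ) : ℕ[X]) else 0 := by
    intro i hi
    have : (C (X : ℕ[X]) ^ i * (X * C (1 + X)) ^ (j - i) * ((j.choose i : ℕ) : (ℕ[X])[X]))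
        = C (X ^ i * (1 + X) ^ (j - i) * ((j.choose i : ℕ) : ℕ[X])) * X ^ (j - i) := by
      simp only [map_mul, map_pow, map_natCast]; ring
    rw [this, coeff_C_mul_X_pow]
    split_ifs with h1 h2 h2
    · rw [← h1]
    · exact absurd h1.symm h2
    · exact absurd h2.symm h1
    · rfl
  rw [sum_congr rfl h]
  by_cases hn : n ≤ j
  · rw [sum_eq_single (j - n)]
    · rw [if_pos (by omega)]
      have : (X : ℕ[X]) ^ (j - n) * (1 + X) ^ n * ((j.choose (j - n) : ℕ) : ℕ[X])
        = C (j.choose n) * ((1 + X) ^ n * X ^ (j - n)) := by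
        rw [Nat.choose_symm hn]; simp; ring
      rw [this, coeff_C_mul, coeff_mul_X_pow', coeff_one_add_X_pow, structConst]
      by_cases h1 : j ≤ m + n
      · rw [if_pos h1, if_pos (by omega), show m - (j - n) = m + n - j by omega]; simp
      · rw [if_neg h1, if_neg (by omega)]; simp
    · intro i hi hne
      rw [if_neg]; simp at hi; omega
    · intro hne; simp at hne
  · rw [sum_eq_zero]
    · rw [structConst]; simp [Nat.choose_eq_zero_of_lt (by omega : j < n)]
    · intro i hi; rw [if_neg (by omega)]

theorem structConst_add (m n j l : ℕ) :
    structConst m n (j + l) = ∑ q ∈ antidiagonal n, ∑ p ∈ antidiagonal m,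
      structConst p.1 q.1 j * structConst p.2 q.2 l := by
  simp only [structConst_eq_coeff, pow_add, Polynomial.coeff_mul, Polynomial.finsetSum_coeff]

theorem structConst_eq_zero {m n j : ℕ} (h : m + n < j) : structConst m n j = 0 :=
  if_neg (by omega)

theorem sum_box {M : Type*} [AddCommMonoid M] (N : ℕ) (F : ℕ → ℕ → M)
    (h : ∀ j l, N ≤ j + l → F j l = 0) :
    ∑ j ∈ range N, ∑ l ∈ range N, F j l =
      ∑ i ∈ range N, ∑ p ∈ antidiagonal i, F p.1 p.2 := by
  rw [← sum_product', sum_sigma']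
  refine (sum_subset_zero_on_sdiff (s₁ := (range N ×ˢ range N).filter (fun p => p.1 + p.2 < N))
    (filter_subset _ _) ?_ (fun _ _ => rfl)).symm.trans ?_
  · intro x hx
    simp only [mem_sdiff, mem_product, mem_filter, not_and, not_lt] at hx
    exact h _ _ (hx.2 hx.1)
  · refine sum_nbij' (fun p => ⟨p.1 + p.2, p⟩) (fun s => s.2) ?_ ?_ ?_ ?_ ?_
    · intro a ha; simp at ha ⊢; omega
    · rintro ⟨i, a, b⟩ ha; simp at ha ⊢; omega
    · intro a ha; rfl
    · rintro ⟨i, a, b⟩ ha; simp at ha ⊢; omega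
    · intro a ha; rfl

theorem nat_choose_mul (x m n : ℕ) :
    x.choose m * x.choose n = ∑ j ∈ range (m + n + 1), structConst m n j * x.choose j := by
  open Polynomial in
  have key : ((1 + X : (ℕ[X])[X]) ^ x * C ((1 + X) ^ x)) =
      ∑ j ∈ range (x + 1), (C (X : ℕ[X]) + X * C (1 + X)) ^ j * C (C (x.choose j)) := by
    have := add_pow (C (X : ℕ[X]) + X * C (1 + X) : (ℕ[X])[X]) 1 x
    simp only [one_pow, mul_one] at this
    have e : (1 + X : (ℕ[X])[X]) ^ x * C ((1 + X) ^ x) = ((1 + X) * C (1 + X)) ^ x := by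
      rw [map_pow]; exact (mul_pow (1 + X : (ℕ[X])[X]) (C (1 + X)) x).symm
    rw [e]
    convert this using 2
    · simp; ring
    · simp
  have h2 := congrArg (fun f => (f.coeff n).coeff m) key
  simp only [Polynomial.coeff_mul_C, Polynomial.finsetSum_coeff, Polynomial.coeff_one_add_X_pow,
    ← structConst_eq_coeff] at h2
  have h3 : (((x.choose n : ℕ) : Polynomial ℕ) * (1 + Polynomial.X) ^ x).coeff m
      = x.choose n * x.choose m := by
    rw [← Polynomial.C_eq_natCast, Polynomial.coeff_C_mul, Polynomial.coeff_one_add_X_pow]; simp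
  rw [h3] at h2
  rw [mul_comm, h2]
  rcases le_total x (m + n) with hx | hx
  · refine sum_subset (by intro a; simp; omega) ?_
    intro a ha hb
    simp at ha hb
    rw [Nat.choose_eq_zero_of_lt (by omega), mul_zero]
  · refine (sum_subset (by intro a; simp; omega) ?_).symm
    intro a ha hb
    simp at ha hb
    rw [structConst_eq_zero (by omega), zero_mul]

theorem padic_choose_mul {p : ℕ} [Fact p.Prime] (x : ℤ_[p]) (m n : ℕ) :
    Ring.choose x m * Ring.choose x n =
      ∑ j ∈ range (m + n + 1), structConst m n j • Ring.choose x j := by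
  have hL : Continuous fun x : ℤ_[p] => Ring.choose x m * Ring.choose x n :=
    (PadicInt.continuous_choose m).mul (PadicInt.continuous_choose n)
  have hR : Continuous fun x : ℤ_[p] =>
      ∑ j ∈ range (m + n + 1), structConst m n j • Ring.choose x j :=
    continuous_finsetSum _ fun j _ => by
      simp only [nsmul_eq_mul]
      exact continuous_const.mul (PadicInt.continuous_choose j)
  refine congrFun ((PadicInt.denseRange_natCast (p := p)).equalizer hL hR ?_) x
  funext y
  simp only [Function.comp, Ring.choose_natCast, nsmul_eq_mul]
  exact_mod_cast nat_choose_mul y m n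

theorem int_choose_mul (x : ℤ) (m n : ℕ) :
    Ring.choose x m * Ring.choose x n =
      ∑ j ∈ range (m + n + 1), structConst m n j • Ring.choose x j := by
  have : Function.Injective (Int.castRingHom ℤ_[2]) := Int.cast_injective
  apply this
  simp only [map_mul, map_sum, map_nsmul, Ring.map_choose]
  exact padic_choose_mul _ m n

theorem eq_zero_of_sum_choose {N : ℕ} {a : ℕ → ℤ}
    (h : ∀ x : ℕ, ∑ j ∈ range N, a j * (x.choose j : ℤ) = 0) : ∀ j < N, a j = 0 := by
  intro j
  induction j using Nat.strong_induction_on with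
  | _ j ih =>
    intro hj
    have := h j
    rw [sum_eq_single j] at this
    · simpa using this
    · intro i hi hne
      rcases lt_or_gt_of_ne hne with h1 | h1
      · rw [ih i h1 (h1.trans hj), zero_mul]
      · rw [Nat.choose_eq_zero_of_lt h1]; simp
    · intro h1; simp at h1; omega

/-- `(-x choose n) = ∑ j ≤ n, invConst n j * (x choose j)`. -/
def invConst (n j : ℕ) : ℤ := if j ≤ n then (-1) ^ n * ((n - 1).choose (n - j) : ℤ) else 0

theorem invConst_eq_zero {n j : ℕ} (h : n < j) : invConst n j = 0 := if_neg (by omega)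

theorem sum_invConst (n N : ℕ) (hN : n < N) (x : ℕ) :
    ∑ j ∈ range N, invConst n j * (x.choose j : ℤ) = Ring.choose (-(x : ℤ)) n := by
  have h1 : ∑ j ∈ range N, invConst n j * (x.choose j : ℤ)
      = ∑ j ∈ range (n + 1), invConst n j * (x.choose j : ℤ) := by
    refine (sum_subset (by intro a; simp; omega) ?_).symm
    intro a ha hb
    simp at ha hb
    rw [invConst_eq_zero (by omega), zero_mul]
  rw [h1, Ring.choose_neg]
  rcases n with _ | n
  · simp [invConst]
  · have h2 : ((x : ℤ) + ((n + 1 : ℕ) : ℤ) - 1) = ((x + n : ℕ) : ℤ) := by push_cast; ring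
    rw [h2, Ring.choose_natCast, Nat.add_choose_eq, Finset.Nat.sum_antidiagonal_eq_sum_range_succ_mk]
    simp only [Int.cast_negOnePow_natCast, Units.smul_def, zsmul_eq_mul, Nat.cast_sum, mul_sum]
    refine sum_congr rfl fun j hj => ?_
    simp at hj
    rw [invConst, if_pos (by omega)]
    have : ((Int.negOnePow ((n + 1 : ℕ) : ℤ) : ℤˣ) : ℤ) = (-1) ^ (n + 1) := by
      rw [Int.coe_negOnePow_natCast]
    simp
    ring


theorem sum_assoc {M : Type*} [AddCommMonoid M] (n : ℕ) (F : ℕ → ℕ → ℕ → M) :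
    ∑ p ∈ antidiagonal n, ∑ q ∈ antidiagonal p.1, F q.1 q.2 p.2 =
      ∑ p ∈ antidiagonal n, ∑ q ∈ antidiagonal p.2, F p.1 q.1 q.2 := by
  rw [sum_sigma', sum_sigma']
  refine sum_nbij' (fun s => ⟨(s.2.1, s.2.2 + s.1.2), (s.2.2, s.1.2)⟩)
    (fun s => ⟨(s.1.1 + s.2.1, s.2.2), (s.1.1, s.2.1)⟩) ?_ ?_ ?_ ?_ ?_
  · rintro ⟨⟨a, b⟩, ⟨c, d⟩⟩ h; simp at h ⊢; omega
  · rintro ⟨⟨a, b⟩, ⟨c, d⟩⟩ h; simp at h ⊢; omega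
  · rintro ⟨⟨a, b⟩, ⟨c, d⟩⟩ h; simp at h ⊢; omega
  · rintro ⟨⟨a, b⟩, ⟨c, d⟩⟩ h; simp at h ⊢; omega
  · rintro ⟨⟨a, b⟩, ⟨c, d⟩⟩ h; rfl

theorem invConst_add (n j l : ℕ) :
    invConst n (j + l) = ∑ p ∈ antidiagonal n, invConst p.1 j * invConst p.2 l := by
  by_cases hjl : n < j + l
  · rw [invConst_eq_zero hjl, sum_eq_zero]
    rintro ⟨a, b⟩ h
    simp only [HasAntidiagonal.mem_antidiagonal] at h
    rcases lt_or_ge a j with h1 | h1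
    · rw [invConst_eq_zero h1, zero_mul]
    · rw [invConst_eq_zero (by omega : b < l), mul_zero]
  set d : ℕ → ℕ → ℤ := fun j l =>
    invConst n (j + l) - ∑ p ∈ antidiagonal n, invConst p.1 j * invConst p.2 l with hd
  have hdz : ∀ j l, n < j + l → d j l = 0 := by
    intro j l hjl
    rw [hd]; dsimp only
    rw [invConst_eq_zero hjl, sum_eq_zero, sub_zero]
    rintro ⟨a, b⟩ h
    simp only [HasAntidiagonal.mem_antidiagonal] at h
    rcases lt_or_ge a j with h1 | h1
    · rw [invConst_eq_zero h1, zero_mul]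
    · rw [invConst_eq_zero (by omega : b < l), mul_zero]
  have key : ∀ x y : ℕ, ∑ j ∈ range (n + 1), (∑ l ∈ range (n + 1), d j l * (y.choose l : ℤ)) *
      (x.choose j : ℤ) = 0 := by
    intro x y
    have e1 : ∑ j ∈ range (n + 1), ∑ l ∈ range (n + 1),
        invConst n (j + l) * ((x.choose j : ℤ) * (y.choose l : ℤ)) =
        Ring.choose (-((x + y : ℕ) : ℤ)) n := by
      rw [sum_box (n + 1) (fun j l => invConst n (j + l) * ((x.choose j : ℤ) * (y.choose l : ℤ)))
        (fun j l h => by rw [invConst_eq_zero (by omega), zero_mul]),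
        ← sum_invConst n (n + 1) (by omega)]
      refine sum_congr rfl fun i _ => ?_
      rw [Nat.add_choose_eq]
      push_cast
      rw [mul_sum]
      refine sum_congr rfl fun p hp => ?_
      rw [HasAntidiagonal.mem_antidiagonal.mp hp]
    have e2 : ∑ j ∈ range (n + 1), ∑ l ∈ range (n + 1),
        (∑ p ∈ antidiagonal n, invConst p.1 j * invConst p.2 l) *
          ((x.choose j : ℤ) * (y.choose l : ℤ)) = Ring.choose (-((x + y : ℕ) : ℤ)) n := by
      have : (-((x + y : ℕ) : ℤ)) = -(x : ℤ) + -(y : ℤ) := by push_cast; ring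
      rw [this, Ring.add_choose_eq n (Commute.all _ _)]
      simp only [sum_mul]
      rw [sum_congr rfl fun j _ => sum_comm, sum_comm]
      refine sum_congr rfl fun p hp => ?_
      have hp' := HasAntidiagonal.mem_antidiagonal.mp hp
      rw [← sum_invConst p.1 (n + 1) (by omega), ← sum_invConst p.2 (n + 1) (by omega),
        sum_mul_sum]
      refine sum_congr rfl fun j _ => sum_congr rfl fun l _ => by ring
    rw [← sub_eq_zero.mpr (e1.trans e2.symm), ← sum_sub_distrib]
    refine sum_congr rfl fun j _ => ?_
    rw [sum_mul, ← sum_sub_distrib]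
    refine sum_congr rfl fun l _ => ?_
    rw [hd]; ring
  have k2 : ∀ j < n + 1, ∀ l < n + 1, d j l = 0 := by
    intro j hj
    refine eq_zero_of_sum_choose fun y => ?_
    exact eq_zero_of_sum_choose (N := n + 1) (fun x => key x y) j hj
  have := k2 j (by omega) l (by omega)
  exact sub_eq_zero.mp this

theorem invConst_structConst (m n N i : ℕ) (hN : m + n < N) :
    ∑ j ∈ range N, ∑ l ∈ range N, invConst m j * invConst n l * (structConst j l i : ℤ) =
      ∑ r ∈ range N, (structConst m n r : ℤ) * invConst r i := by
  have key : ∀ x : ℕ, ∑ i ∈ range (i + 2 * N + 1),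
      (∑ j ∈ range N, ∑ l ∈ range N, invConst m j * invConst n l * (structConst j l i : ℤ) -
      ∑ r ∈ range N, (structConst m n r : ℤ) * invConst r i) * (x.choose i : ℤ) = 0 := by
    intro x
    simp only [sub_mul, sum_sub_distrib]
    rw [sub_eq_zero]
    have e1 : ∑ i ∈ range (i + 2 * N + 1), (∑ j ∈ range N, ∑ l ∈ range N,
        invConst m j * invConst n l * (structConst j l i : ℤ)) * (x.choose i : ℤ) =
        Ring.choose (-(x : ℤ)) m * Ring.choose (-(x : ℤ)) n := by
      rw [← sum_invConst m N (by omega), ← sum_invConst n N (by omega), sum_mul_sum]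
      simp only [sum_mul]
      rw [sum_comm]
      refine sum_congr rfl fun j hj => ?_
      rw [sum_comm]
      refine sum_congr rfl fun l hl => ?_
      simp only [mem_range] at hj hl
      have := nat_choose_mul x j l
      have h2 : ((x.choose j : ℤ) * (x.choose l : ℤ)) =
          ∑ i ∈ range (i + 2 * N + 1), (structConst j l i : ℤ) * (x.choose i : ℤ) := by
        rw [← sum_subset (s₁ := range (j + l + 1)) (by intro a; simp; omega)]
        · exact_mod_cast this
        · intro a ha hb
          simp at ha hb
          rw [structConst_eq_zero (by omega)]; simp
      rw [mul_mul_mul_comm, h2, mul_sum]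
      exact sum_congr rfl fun _ _ => by ring
    have e2 : ∑ i ∈ range (i + 2 * N + 1), (∑ r ∈ range N,
        (structConst m n r : ℤ) * invConst r i) * (x.choose i : ℤ) =
        Ring.choose (-(x : ℤ)) m * Ring.choose (-(x : ℤ)) n := by
      rw [int_choose_mul]
      simp only [sum_mul]
      rw [sum_comm]
      rw [sum_subset (s₁ := range (m + n + 1)) (s₂ := range N) (by intro a; simp; omega)]
      · refine sum_congr rfl fun r hr => ?_
        simp only [mem_range] at hr
        rw [nsmul_eq_mul, ← sum_invConst r (i + 2 * N + 1) (by omega), mul_sum]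
        exact sum_congr rfl fun _ _ => by ring
      · intro a ha hb
        simp at ha hb
        rw [structConst_eq_zero (by omega)]; simp
    rw [e1, e2]
  exact sub_eq_zero.mp (eq_zero_of_sum_choose key i (by omega))

/-! ### Stratified modules -/

universe u v w

/-- A family of `k`-linear operators `δ⁽ⁿ⁾` on a `k`-algebra `R` which obey the Leibniz rule and the
composition law of the operators `t ^ r ↦ (r choose n) t ^ r`. The operators meant are those of
`gmSystem` and `seriesSystem` below. -/
structure HasseSystem (k : Type u) (R : Type v) [CommRing k] [CommRing R] [Algebra k R] where
  δ : ℕ → R →+ R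
  δ_const : ∀ n (c : k) f, δ n (algebraMap k R c * f) = algebraMap k R c * δ n f
  δ_zero : ∀ f, δ 0 f = f
  δ_mul : ∀ n f g, δ n (f * g) = ∑ p ∈ antidiagonal n, δ p.1 f * δ p.2 g
  δ_comp : ∀ m n f, δ m (δ n f) = ∑ j ∈ range (m + n + 1), structConst m n j • δ j f

/-- An action of the operators `δ⁽ⁿ⁾` on an `R`-module `M`: they obey the Leibniz rule over `R` and
the same linear and composition relations as on `R` (in particular they commute and are `k`-linear,
see `δ_algebraMap_smul`). For `k((t))` this is the action in an iterated differential module. For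
`k[t, t⁻¹]` it is the same as a module structure over the ring of differential operators, see
`gm_toAction_bijective`. -/
structure HasseAction {k : Type u} {R : Type v} [CommRing k] [CommRing R] [Algebra k R]
    (D : HasseSystem k R) (M : Type w) [AddCommGroup M] [Module R M] where
  δ : ℕ → M →+ M
  δ_zero : ∀ x, δ 0 x = x
  δ_smul : ∀ n (f : R) x, δ n (f • x) = ∑ p ∈ antidiagonal n, D.δ p.1 f • δ p.2 x
  δ_comp : ∀ m n x, δ m (δ n x) = ∑ j ∈ range (m + n + 1), structConst m n j • δ j x

section
variable {k : Type u} {R : Type v} [CommRing k] [CommRing R] [Algebra k R]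
  {D : HasseSystem k R} {M : Type*} [AddCommGroup M] [Module R M]
  {N : Type*} [AddCommGroup N] [Module R N]

theorem HasseSystem.δ_one (D : HasseSystem k R) (n : ℕ) (hn : n ≠ 0) : D.δ n 1 = 0 := by
  induction n using Nat.strong_induction_on with
  | _ n ih =>
    obtain ⟨m, rfl⟩ := Nat.exists_eq_succ_of_ne_zero hn
    have h := D.δ_mul (m + 1) 1 1
    rw [Finset.Nat.antidiagonal_succ, sum_cons, sum_map, Finset.Nat.sum_antidiagonal_eq_sum_range_succ_mk,
      sum_range_succ, sum_eq_zero] at h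
    · simpa [D.δ_zero] using h
    · intro x hx
      simp only [mem_range] at hx
      have : D.δ (x + 1) 1 = 0 := ih (x + 1) (by omega) (by omega)
      simp [this]

theorem HasseSystem.δ_algebraMap (D : HasseSystem k R) (n : ℕ) (hn : n ≠ 0) (c : k) :
    D.δ n (algebraMap k R c) = 0 := by
  rw [← mul_one (algebraMap k R c), D.δ_const, D.δ_one n hn, mul_zero]

theorem HasseAction.δ_algebraMap_smul (a : HasseAction D M) (n : ℕ) (c : k) (x : M) :
    a.δ n (algebraMap k R c • x) = algebraMap k R c • a.δ n x := by
  rw [a.δ_smul, sum_eq_single (0, n)]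
  · rw [D.δ_zero]
  · rintro ⟨i, j⟩ h1 h2
    simp only [HasAntidiagonal.mem_antidiagonal] at h1
    rw [D.δ_algebraMap i (by rintro rfl; simp at h1; simp [h1] at h2), zero_smul]
  · intro h; simp at h

theorem HasseAction.δ_comp_range (a : HasseAction D M) {m n N : ℕ} (h : m + n < N) (x : M) :
    a.δ m (a.δ n x) = ∑ j ∈ range N, structConst m n j • a.δ j x := by
  rw [a.δ_comp]
  refine sum_subset (by intro a; simp; omega) fun i _ hi => ?_
  simp at hi
  rw [structConst_eq_zero (by omega), zero_smul]

/-- The tautological action on `R`. -/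
def HasseSystem.self (D : HasseSystem k R) : HasseAction D R where
  δ := D.δ
  δ_zero := D.δ_zero
  δ_smul := D.δ_mul
  δ_comp := D.δ_comp

open TensorProduct

/-- On `M ⊗ N`: `δ⁽ⁿ⁾ (x ⊗ y) = ∑_{a + b = n} δ⁽ᵃ⁾ x ⊗ δ⁽ᵇ⁾ y`. -/
def HasseAction.tensorδ (a : HasseAction D M) (b : HasseAction D N) (n : ℕ) : M ⊗[R] N →+ M ⊗[R] N :=
  TensorProduct.liftAddHom
    (AddMonoidHom.mk' (fun x => AddMonoidHom.mk'
      (fun y => ∑ p ∈ antidiagonal n, a.δ p.1 x ⊗ₜ[R] b.δ p.2 y)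
      (fun y z => by simp only [map_add, tmul_add, sum_add_distrib]))
      (fun x y => by ext z; simp [map_add, add_tmul, sum_add_distrib]))
    (fun r x y => by
      simp only [AddMonoidHom.mk'_apply, a.δ_smul, b.δ_smul, sum_tmul, tmul_sum]
      rw [← sum_assoc n fun i j l => a.δ i x ⊗ₜ[R] (D.δ j r • b.δ l y)]
      refine sum_congr rfl fun p _ => ?_
      rw [← Finset.Nat.sum_antidiagonal_swap]
      refine sum_congr rfl fun q _ => ?_
      simp [smul_tmul])

theorem HasseAction.tensorδ_tmul (a : HasseAction D M) (b : HasseAction D N) (n : ℕ) (x : M) (y : N) :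
    a.tensorδ b n (x ⊗ₜ[R] y) = ∑ p ∈ antidiagonal n, a.δ p.1 x ⊗ₜ[R] b.δ p.2 y := rfl

theorem HasseAction.tensorδ_comp (a : HasseAction D M) (b : HasseAction D N) (m n : ℕ) (z : M ⊗[R] N) :
    a.tensorδ b m (a.tensorδ b n z) =
      ∑ j ∈ range (m + n + 1), structConst m n j • a.tensorδ b j z := by
  induction z using TensorProduct.induction_on with
  | zero => simp
  | add z w hz hw => simp only [map_add, hz, hw, smul_add, sum_add_distrib]
  | tmul x y =>
    simp only [tensorδ_tmul, map_sum]
    have h : ∀ q ∈ antidiagonal n, ∀ p ∈ antidiagonal m,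
        a.δ p.1 (a.δ q.1 x) ⊗ₜ[R] b.δ p.2 (b.δ q.2 y) =
        ∑ j ∈ range (m + n + 1), ∑ l ∈ range (m + n + 1),
          (structConst p.1 q.1 j * structConst p.2 q.2 l) • (a.δ j x ⊗ₜ[R] b.δ l y) := by
      intro q hq p hp
      simp only [HasAntidiagonal.mem_antidiagonal] at hp hq
      rw [a.δ_comp_range (N := m + n + 1) (by omega), b.δ_comp_range (N := m + n + 1) (by omega),
        sum_tmul]
      refine sum_congr rfl fun j _ => ?_
      rw [tmul_sum]
      refine sum_congr rfl fun l _ => ?_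
      rw [mul_smul, tmul_smul, ← smul_tmul', smul_comm]
    rw [sum_congr rfl fun q hq => sum_congr rfl (h q hq)]
    have h2 : ∀ j l, ∑ q ∈ antidiagonal n, ∑ p ∈ antidiagonal m,
        (structConst p.1 q.1 j * structConst p.2 q.2 l) • (a.δ j x ⊗ₜ[R] b.δ l y) =
        structConst m n (j + l) • (a.δ j x ⊗ₜ[R] b.δ l y) := by
      intro j l
      simp only [← sum_smul]
      rw [structConst_add]
    calc _ = ∑ j ∈ range (m + n + 1), ∑ l ∈ range (m + n + 1),
          ∑ q ∈ antidiagonal n, ∑ p ∈ antidiagonal m,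
        (structConst p.1 q.1 j * structConst p.2 q.2 l) • (a.δ j x ⊗ₜ[R] b.δ l y) := by
          rw [sum_congr rfl fun q _ => sum_comm, sum_comm]
          refine sum_congr rfl fun j _ => ?_
          rw [sum_congr rfl fun q _ => sum_comm, sum_comm]
      _ = _ := by
          simp only [h2]
          rw [sum_box (m + n + 1)
            (fun j l => structConst m n (j + l) • (a.δ j x ⊗ₜ[R] b.δ l y))
            (fun j l h => by rw [structConst_eq_zero (by omega), zero_smul])]
          refine sum_congr rfl fun i _ => ?_
          rw [smul_sum]
          refine sum_congr rfl fun p hp => ?_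
          rw [HasAntidiagonal.mem_antidiagonal.mp hp]

/-- The tensor product of two modules with operators. -/
def HasseAction.tensor (a : HasseAction D M) (b : HasseAction D N) : HasseAction D (M ⊗[R] N) where
  δ := a.tensorδ b
  δ_zero z := by
    induction z using TensorProduct.induction_on with
    | zero => simp
    | add z w hz hw => simp only [map_add, hz, hw]
    | tmul x y => simp [tensorδ_tmul, a.δ_zero, b.δ_zero]
  δ_smul n r z := by
    induction z using TensorProduct.induction_on with
    | zero => simp
    | add z w hz hw => simp only [smul_add, map_add, hz, hw, sum_add_distrib]
    | tmul x y =>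
      simp only [smul_tmul', tensorδ_tmul, a.δ_smul, sum_tmul, smul_sum]
      rw [← sum_assoc n fun i j l => (D.δ i r • a.δ j x) ⊗ₜ[R] b.δ l y]
  δ_comp := a.tensorδ_comp b

/-- The operators of the inverse coordinate:
`δ_{1/t}⁽ⁿ⁾ = (-1)ⁿ ∑_{j ≤ n} (n - 1 choose n - j) δ_t⁽ʲ⁾`. -/
def invOp {A : Type*} [AddCommGroup A] (δ : ℕ → A) (n : ℕ) : A :=
  ∑ j ∈ range (n + 1), invConst n j • δ j

theorem invOp_eq {A : Type*} [AddCommGroup A] (δ : ℕ → A) {n N : ℕ} (h : n < N) :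
    invOp δ n = ∑ j ∈ range N, invConst n j • δ j := by
  refine sum_subset (by intro a; simp; omega) fun i _ hi => ?_
  simp at hi
  rw [invConst_eq_zero (by omega), zero_smul]

theorem invOp_mul {A B E : Type*} [AddCommGroup A] [AddCommGroup B] [AddCommGroup E]
    (μ : A →+ B →+ E) (f : ℕ → A) (g : ℕ → B) (n : ℕ) :
    invOp (fun i => ∑ p ∈ antidiagonal i, μ (f p.1) (g p.2)) n =
      ∑ p ∈ antidiagonal n, μ (invOp f p.1) (invOp g p.2) := by
  have h : ∀ p ∈ antidiagonal n, μ (invOp f p.1) (invOp g p.2) =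
      ∑ j ∈ range (n + 1), ∑ l ∈ range (n + 1),
        (invConst p.1 j * invConst p.2 l) • μ (f j) (g l) := by
    intro p hp
    have := HasAntidiagonal.mem_antidiagonal.mp hp
    rw [invOp_eq f (N := n + 1) (by omega), invOp_eq g (N := n + 1) (by omega)]
    simp only [map_sum, AddMonoidHom.finsetSum_apply, map_zsmul, AddMonoidHom.zsmul_apply,
      smul_sum, mul_smul]
    rw [sum_comm]
    exact sum_congr rfl fun _ _ => sum_congr rfl fun _ _ => smul_comm _ _ _
  rw [sum_congr rfl h, sum_comm, sum_congr rfl fun j _ => sum_comm]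
  simp only [← sum_smul, ← invConst_add]
  rw [sum_box (n + 1) (fun j l => invConst n (j + l) • μ (f j) (g l))
    (fun j l h => by rw [invConst_eq_zero (by omega), zero_smul]), invOp]
  refine sum_congr rfl fun i _ => ?_
  rw [smul_sum]
  refine sum_congr rfl fun p hp => ?_
  rw [HasAntidiagonal.mem_antidiagonal.mp hp]

theorem invOp_comp {A : Type*} [AddCommGroup A] (δ : ℕ → A →+ A)
    (h : ∀ m n x, δ m (δ n x) = ∑ j ∈ range (m + n + 1), structConst m n j • δ j x)
    (m n : ℕ) (x : A) :
    invOp δ m (invOp δ n x) = ∑ j ∈ range (m + n + 1), structConst m n j • invOp δ j x := by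
  set N := m + n + 1
  have hc : ∀ j < N, ∀ l < N, δ j (δ l x) =
      ∑ i ∈ range (2 * N), structConst j l i • δ i x := by
    intro j hj l hl
    rw [h]
    refine sum_subset (by intro a; simp; omega) fun i _ hi => ?_
    simp at hi
    rw [structConst_eq_zero (by omega), zero_smul]
  rw [invOp_eq δ (by omega : m < N), invOp_eq δ (by omega : n < N)]
  simp only [AddMonoidHom.finsetSum_apply, map_sum, AddMonoidHom.zsmul_apply, map_zsmul, smul_sum]
  calc _ = ∑ j ∈ range N, ∑ l ∈ range N, ∑ i ∈ range (2 * N),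
        (invConst m j * invConst n l * (structConst j l i : ℤ)) • δ i x := by
        rw [sum_comm]
        refine sum_congr rfl fun j hj => sum_congr rfl fun l hl => ?_
        rw [hc j (mem_range.mp hj) l (mem_range.mp hl), smul_sum, smul_sum]
        refine sum_congr rfl fun i _ => ?_
        rw [smul_comm, mul_smul, mul_smul, natCast_zsmul]
    _ = ∑ i ∈ range (2 * N), (∑ j ∈ range N, ∑ l ∈ range N,
        invConst m j * invConst n l * (structConst j l i : ℤ)) • δ i x := by
        simp only [sum_smul]
        rw [sum_congr rfl fun j _ => sum_comm, sum_comm]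
    _ = ∑ i ∈ range (2 * N), (∑ r ∈ range N, (structConst m n r : ℤ) * invConst r i) • δ i x := by
        refine sum_congr rfl fun i _ => ?_
        rw [invConst_structConst m n N i (by omega)]
    _ = _ := by
        simp only [sum_smul]
        rw [sum_comm]
        refine sum_congr rfl fun r hr => ?_
        rw [invOp_eq δ (N := 2 * N) (by have := mem_range.mp hr; omega)]
        simp only [AddMonoidHom.finsetSum_apply, AddMonoidHom.zsmul_apply, smul_sum, mul_smul,
          natCast_zsmul]

theorem invOp_apply {A B : Type*} [AddCommGroup A] [AddCommGroup B] (δ : ℕ → A →+ B) (n : ℕ)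
    (x : A) : invOp δ n x = invOp (fun j => δ j x) n := by
  simp [invOp, AddMonoidHom.finsetSum_apply]

/-- The operators on `R` attached to the inverse coordinate. -/
def HasseSystem.inv (D : HasseSystem k R) : HasseSystem k R where
  δ := invOp D.δ
  δ_const n c f := by simp [invOp, D.δ_const, mul_sum, AddMonoidHom.finsetSum_apply, mul_left_comm]
  δ_zero f := by simp [invOp, invConst, D.δ_zero]
  δ_mul n f g := by
    simp only [invOp_apply, D.δ_mul]
    exact invOp_mul (AddMonoidHom.mul) (fun j => D.δ j f) (fun j => D.δ j g) n
  δ_comp := invOp_comp D.δ D.δ_comp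

/-- The operators of the inverse coordinate on a module. -/
def HasseAction.inv (a : HasseAction D M) : HasseAction D.inv M where
  δ := invOp a.δ
  δ_zero f := by simp [invOp, invConst, a.δ_zero]
  δ_smul n f x := by
    simp only [invOp_apply, a.δ_smul]
    have := invOp_mul (smulAddHom R M) (fun j => D.δ j f) (fun j => a.δ j x) n
    simp only [smulAddHom_apply] at this
    rw [this]
    refine sum_congr rfl fun p _ => ?_
    rw [← invOp_apply]; rfl
  δ_comp := invOp_comp a.δ a.δ_comp

end


theorem int_sum_invConst (n : ℕ) (x : ℤ) :
    ∑ j ∈ range (n + 1), invConst n j * Ring.choose x j = Ring.choose (-x) n := by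
  have hc : ∀ x : ℤ_[2], ∑ j ∈ range (n + 1), (invConst n j : ℤ_[2]) * Ring.choose x j =
      Ring.choose (-x) n := by
    intro x
    have hL : Continuous fun x : ℤ_[2] =>
        ∑ j ∈ range (n + 1), (invConst n j : ℤ_[2]) * Ring.choose x j :=
      continuous_finsetSum _ fun j _ => continuous_const.mul (PadicInt.continuous_choose j)
    have hR : Continuous fun x : ℤ_[2] => Ring.choose (-x) n :=
      (PadicInt.continuous_choose n).comp continuous_neg
    refine congrFun ((PadicInt.denseRange_natCast (p := 2)).equalizer hL hR ?_) x
    funext y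
    simp only [Function.comp, Ring.choose_natCast]
    have h := congrArg (Int.castRingHom ℤ_[2]) (sum_invConst n (n + 1) (by omega) y)
    rw [Ring.map_choose] at h
    simpa using h
  have : Function.Injective (Int.castRingHom ℤ_[2]) := Int.cast_injective
  apply this
  rw [Ring.map_choose, map_sum]
  simp only [map_mul, Ring.map_choose]
  simpa using hc x

section
variable (k : Type u) [Field k]
open LaurentPolynomial

/-- The operators `t ^ r ↦ (r choose n) t ^ r` on `k[t, t⁻¹]`. -/
noncomputable def laurentδ (n : ℕ) : k[T;T⁻¹] →+ k[T;T⁻¹] where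
  toFun f := .ofCoeff (Finsupp.onFinset f.coeff.support (fun r => Ring.choose r n • f.coeff r)
    (fun r h => by
      rw [Finsupp.mem_support_iff]; rintro h0; simp [h0] at h))
  map_zero' := by ext r; simp
  map_add' f g := by ext r; simp

theorem laurentδ_coeff (n : ℕ) (f : k[T;T⁻¹]) (r : ℤ) :
    (laurentδ k n f).coeff r = Ring.choose r n • f.coeff r := rfl

theorem laurentδ_C_mul_T (n : ℕ) (a : k) (r : ℤ) :
    laurentδ k n (C a * T r) = Ring.choose r n • (C a * T r) := by
  ext s
  rw [laurentδ_coeff, ← single_eq_C_mul_T]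
  simp only [AddMonoidAlgebra.coeff_single, Finsupp.single_apply, AddMonoidAlgebra.coeff_smul,
    Finsupp.smul_apply]
  split_ifs with h
  · rw [h]
  · simp

/-- `k[t, t⁻¹]` with the operators `δ_t⁽ⁿ⁾`. -/
noncomputable def gmSystem : HasseSystem k k[T;T⁻¹] where
  δ := laurentδ k
  δ_const n c f := by
    ext r
    rw [← Algebra.smul_def, ← Algebra.smul_def, laurentδ_coeff, AddMonoidAlgebra.coeff_smul,
      AddMonoidAlgebra.coeff_smul, Finsupp.smul_apply, Finsupp.smul_apply, laurentδ_coeff,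
      smul_comm]
  δ_zero f := by ext r; simp [laurentδ_coeff]
  δ_mul n f g := by
    induction f using LaurentPolynomial.induction_on' with
    | add f f' hf hf' => simp only [add_mul, map_add, hf, hf', sum_add_distrib]
    | C_mul_T r a =>
      induction g using LaurentPolynomial.induction_on' with
      | add f f' hf hf' => simp only [mul_add, map_add, hf, hf', sum_add_distrib]
      | C_mul_T s b =>
        have : C a * T r * (C b * T s) = C (a * b) * (T (r + s) : k[T;T⁻¹]) := by
          rw [map_mul, T_add]; ring
        simp only [laurentδ_C_mul_T, this, smul_mul_smul_comm]
        rw [Ring.add_choose_eq n (Commute.all _ _), sum_smul]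
  δ_comp m n f := by
    ext r
    simp only [laurentδ_coeff, smul_smul, int_choose_mul, sum_smul, AddMonoidAlgebra.coeff_sum,
      AddMonoidAlgebra.coeff_smul, Finsupp.finsetSum_apply, Finsupp.smul_apply, smul_assoc]

/-- The operators `t ^ r ↦ (r choose n) t ^ r` on `k((t))`. -/
noncomputable def seriesδ (n : ℕ) : LaurentSeries k →+ LaurentSeries k where
  toFun f :=
    { coeff := fun r => Ring.choose r n • f.coeff r
      isPWO_support' := f.isPWO_support.mono fun r h => by
        simp only [Function.mem_support] at h
        rw [HahnSeries.mem_support]; rintro h0; simp [h0] at h }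
  map_zero' := by ext r; simp
  map_add' f g := by ext r; simp

theorem seriesδ_coeff (n : ℕ) (f : LaurentSeries k) (r : ℤ) :
    (seriesδ k n f).coeff r = Ring.choose r n • f.coeff r := rfl

/-- `k((t))` with the operators `δ_t⁽ⁿ⁾`. -/
noncomputable def seriesSystem : HasseSystem k (LaurentSeries k) where
  δ := seriesδ k
  δ_const n c f := by
    ext r
    rw [LaurentSeries.algebraMap_apply, seriesδ_coeff, HahnSeries.C_mul_eq_smul,
      HahnSeries.C_mul_eq_smul, HahnSeries.coeff_smul, HahnSeries.coeff_smul, seriesδ_coeff,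
      smul_comm]
  δ_zero f := by
    change seriesδ k 0 f = f
    ext r; simp [seriesδ_coeff]
  δ_mul n f g := by
    change seriesδ k n (f * g) = ∑ p ∈ Finset.HasAntidiagonal.antidiagonal n,
      seriesδ k p.1 f * seriesδ k p.2 g
    ext r
    have h : ∀ a b : ℕ, (seriesδ k a f * seriesδ k b g).coeff r =
        ∑ ij ∈ Finset.antidiagonal f.isPWO_support g.isPWO_support r,
          (Ring.choose ij.1 a • f.coeff ij.1) * (Ring.choose ij.2 b • g.coeff ij.2) := by
      intro a b
      rw [HahnSeries.coeff_mul]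
      refine sum_subset ?_ ?_
      · rintro ⟨i, j⟩ hij
        simp only [Finset.mem_antidiagonal, HahnSeries.mem_support, seriesδ_coeff] at hij ⊢
        refine ⟨fun h0 => hij.1 (by simp [h0]), fun h0 => hij.2.1 (by simp [h0]), hij.2.2⟩
      · rintro ⟨i, j⟩ hij h
        simp only [Finset.mem_antidiagonal, HahnSeries.mem_support, seriesδ_coeff] at hij h ⊢
        by_contra hne
        exact h ⟨left_ne_zero_of_mul hne, right_ne_zero_of_mul hne, hij.2.2⟩
    rw [seriesδ_coeff, HahnSeries.coeff_mul]
    rw [show (∑ p ∈ Finset.HasAntidiagonal.antidiagonal n, seriesδ k p.1 f * seriesδ k p.2 g).coeff r =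
      ∑ p ∈ Finset.HasAntidiagonal.antidiagonal n, (seriesδ k p.1 f * seriesδ k p.2 g).coeff r by simp]
    simp only [h]
    rw [smul_sum, sum_comm]
    refine sum_congr rfl fun ij hij => ?_
    rw [← (Finset.mem_antidiagonal.mp hij).2.2, Ring.add_choose_eq n (Commute.all _ _), sum_smul]
    exact sum_congr rfl fun p _ => (smul_mul_smul_comm _ _ _ _).symm
  δ_comp m n f := by
    change seriesδ k m (seriesδ k n f) = ∑ j ∈ range (m + n + 1), structConst m n j • seriesδ k j f
    ext r
    simp only [seriesδ_coeff, smul_smul, int_choose_mul, sum_smul, HahnSeries.coeff_sum,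
      HahnSeries.coeff_smul, smul_assoc]

/-- The coordinate of `k((t))`. -/
noncomputable def seriesT : (LaurentSeries k)ˣ where
  val := HahnSeries.single 1 1
  inv := HahnSeries.single (-1) 1
  val_inv := by simp
  inv_val := by simp

/-- The coordinate of `𝔾_m`. -/
noncomputable def gmT : (k[T;T⁻¹])ˣ where
  val := T 1
  inv := T (-1)
  val_inv := by rw [← T_add]; simp
  inv_val := by rw [← T_add]; simp

theorem seriesT_zpow (n : ℤ) :
    ((seriesT k ^ n : (LaurentSeries k)ˣ) : LaurentSeries k) = HahnSeries.single n 1 := by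
  induction n using Int.induction_on with
  | zero => rfl
  | succ n ih => rw [zpow_add, Units.val_mul, ih, zpow_one]; simp [seriesT]
  | pred n ih => rw [zpow_sub, Units.val_mul, ih, zpow_one]; simp [seriesT, sub_eq_add_neg]

/-- The inclusion `k[t, t⁻¹] → k((t))`, `t ↦ t`. -/
noncomputable def inclZero : k[T;T⁻¹] →ₐ[k] LaurentSeries k :=
  { LaurentPolynomial.eval₂ (algebraMap k (LaurentSeries k)) (seriesT k) with
    commutes' := fun c => by
      simp [LaurentPolynomial.algebraMap_apply] }

theorem inclZero_C_mul_T (a : k) (n : ℤ) :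
    inclZero k (C a * T n) = HahnSeries.single n a := by
  change LaurentPolynomial.eval₂ _ _ _ = _
  rw [eval₂_C_mul_T, seriesT_zpow, LaurentSeries.algebraMap_apply]
  simp

theorem inclZero_δ (n : ℕ) (f : k[T;T⁻¹]) :
    (seriesSystem k).δ n (inclZero k f) = inclZero k ((gmSystem k).δ n f) := by
  induction f using LaurentPolynomial.induction_on' with
  | add f f' hf hf' => simp only [map_add, hf, hf']
  | C_mul_T r a =>
    change seriesδ k n _ = inclZero k (laurentδ k n _)
    rw [laurentδ_C_mul_T, map_zsmul, inclZero_C_mul_T]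
    ext s
    rw [seriesδ_coeff, HahnSeries.coeff_smul]
    by_cases h : s = r
    · simp [h]
    · simp [HahnSeries.coeff_single_of_ne h]

/-- The inclusion `k[t, t⁻¹] → k((s))`, `t ↦ s⁻¹`, that is `k[t, t⁻¹] ⊆ k((t⁻¹))`. -/
noncomputable def inclInfty : k[T;T⁻¹] →ₐ[k] LaurentSeries k :=
  (inclZero k).comp (LaurentPolynomial.invert (R := k)).toAlgHom

theorem gmSystem_inv_δ (n : ℕ) (f : k[T;T⁻¹]) :
    (gmSystem k).inv.δ n (LaurentPolynomial.invert f) =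
      LaurentPolynomial.invert ((gmSystem k).δ n f) := by
  induction f using LaurentPolynomial.induction_on' with
  | add f f' hf hf' => simp only [map_add, hf, hf']
  | C_mul_T r a =>
    change invOp (laurentδ k) n _ = invert (laurentδ k n _)
    rw [invOp_apply, laurentδ_C_mul_T, map_zsmul, map_mul, invert_C, invert_T, invOp]
    simp only [laurentδ_C_mul_T, smul_smul]
    rw [← sum_smul, int_sum_invConst, neg_neg]

theorem inclInfty_δ (n : ℕ) (f : k[T;T⁻¹]) :
    (seriesSystem k).δ n (inclInfty k f) = inclInfty k ((gmSystem k).inv.δ n f) := by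
  have h := gmSystem_inv_δ k n (invert f)
  rw [show invert (invert f) = f from involutive_invert f] at h
  change (seriesSystem k).δ n (inclZero k (invert f)) = inclZero k (invert _)
  rw [inclZero_δ, h]
  congr 1
  exact (involutive_invert _).symm

end


/-! ### Comparison with modules over the ring of differential operators -/

section
variable (k : Type u) (R : Type v) [CommRing k] [CommRing R] [Algebra k R]

/-- Multiplication by `f`. -/
def mulOp : R →ₐ[k] Module.End k R := Algebra.lmul k R

/-- Differential operators of order `≤ n` on `R` relative to `k`. -/
def IsDiffOp : ℕ → Module.End k R → Prop
  | 0, P => ∀ f : R, P * mulOp k R f - mulOp k R f * P = 0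
  | n + 1, P => ∀ f : R, IsDiffOp n (P * mulOp k R f - mulOp k R f * P)

variable {k R}

theorem IsDiffOp.zero (n : ℕ) : IsDiffOp k R n 0 := by
  induction n with
  | zero => intro f; simp
  | succ n ih => intro f; simpa using ih

theorem IsDiffOp.add {n : ℕ} {P Q : Module.End k R} (hP : IsDiffOp k R n P)
    (hQ : IsDiffOp k R n Q) : IsDiffOp k R n (P + Q) := by
  induction n generalizing P Q with
  | zero =>
    intro f
    rw [add_mul, mul_add, add_sub_add_comm, hP f, hQ f, add_zero]
  | succ n ih =>
    intro f
    rw [add_mul, mul_add, add_sub_add_comm]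
    exact ih (hP f) (hQ f)

theorem IsDiffOp.succ {n : ℕ} {P : Module.End k R} (hP : IsDiffOp k R n P) :
    IsDiffOp k R (n + 1) P := by
  induction n generalizing P with
  | zero => intro f; rw [hP f]; exact IsDiffOp.zero 0
  | succ n ih => intro f; exact ih (hP f)

theorem IsDiffOp.mono {n m : ℕ} (h : n ≤ m) {P : Module.End k R} (hP : IsDiffOp k R n P) :
    IsDiffOp k R m P := by
  induction m, h using Nat.le_induction with
  | base => exact hP
  | succ m _ ih => exact ih.succ

theorem IsDiffOp.mulOp (f : R) : IsDiffOp k R 0 (mulOp k R f) := by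
  intro g
  rw [← map_mul, ← map_mul, mul_comm, sub_self]

theorem IsDiffOp.mul {n m : ℕ} {P Q : Module.End k R} (hP : IsDiffOp k R n P)
    (hQ : IsDiffOp k R m Q) : IsDiffOp k R (n + m) (P * Q) := by
  have e : ∀ (P Q : Module.End k R) f, P * Q * Stratified.mulOp k R f - Stratified.mulOp k R f * (P * Q) =
      P * (Q * Stratified.mulOp k R f - Stratified.mulOp k R f * Q) +
      (P * Stratified.mulOp k R f - Stratified.mulOp k R f * P) * Q := by
    intro P Q f; rw [mul_sub, sub_mul]; simp only [mul_assoc]; abel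
  induction h : n + m generalizing n m P Q with
  | zero =>
    obtain ⟨rfl, rfl⟩ : n = 0 ∧ m = 0 := by omega
    intro f
    rw [e, hP f, hQ f]; simp
  | succ N ih =>
    intro f
    rw [e]
    refine IsDiffOp.add ?_ ?_
    · rcases m with _ | m
      · rw [hQ f, mul_zero]; exact IsDiffOp.zero _
      · exact ih hP (hQ f) (by omega)
    · rcases n with _ | n
      · rw [hP f, zero_mul]; exact IsDiffOp.zero _
      · exact ih (hP f) hQ (by omega)

theorem IsDiffOp.sum {ι : Type*} (s : Finset ι) {n : ℕ} {P : ι → Module.End k R}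
    (h : ∀ i ∈ s, IsDiffOp k R n (P i)) : IsDiffOp k R n (∑ i ∈ s, P i) := by
  classical
  induction s using Finset.induction_on with
  | empty => exact IsDiffOp.zero n
  | insert a s ha ih =>
    rw [sum_insert ha]
    exact (h a (mem_insert_self _ _)).add (ih fun i hi => h i (mem_insert_of_mem hi))

variable (k R)

/-- The ring of differential operators on `R` relative to `k`. -/
def diffOps : Subring (Module.End k R) where
  carrier := {P | ∃ n, IsDiffOp k R n P}
  zero_mem' := ⟨0, IsDiffOp.zero 0⟩
  one_mem' := ⟨0, by simpa using IsDiffOp.mulOp (k := k) (1 : R)⟩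
  add_mem' := by
    rintro P Q ⟨n, hn⟩ ⟨m, hm⟩
    exact ⟨max n m, (hn.mono (le_max_left _ _)).add (hm.mono (le_max_right _ _))⟩
  mul_mem' := by
    rintro P Q ⟨n, hn⟩ ⟨m, hm⟩
    exact ⟨n + m, hn.mul hm⟩
  neg_mem' := by
    rintro P ⟨n, hn⟩
    refine ⟨n, ?_⟩
    have h := (IsDiffOp.mulOp (k := k) (-1 : R)).mul hn
    have e : mulOp k R (-1) * P = -P := LinearMap.ext fun x => neg_one_mul (P x)
    rw [zero_add, e] at h
    exact h

variable {R}

def diffOps.mul (f : R) : diffOps k R := ⟨mulOp k R f, 0, IsDiffOp.mulOp f⟩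

variable {k}

def HasseSystem.δlin (D : HasseSystem k R) (n : ℕ) : Module.End k R :=
  { D.δ n with
    map_smul' := fun c f => by
      simp only [Algebra.smul_def]
      exact D.δ_const n c f }

theorem HasseSystem.δlin_isDiffOp (D : HasseSystem k R) (n : ℕ) : IsDiffOp k R n (D.δlin n) := by
  induction n using Nat.strong_induction_on with
  | _ n ih =>
  have e : ∀ f, D.δlin n * mulOp k R f - mulOp k R f * D.δlin n =
      ∑ p ∈ (antidiagonal n).erase (0, n), mulOp k R (D.δ p.1 f) * D.δlin p.2 := by
    intro f
    have h0 : mulOp k R f * D.δlin n =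
        (fun p : ℕ × ℕ => mulOp k R (D.δ p.1 f) * D.δlin p.2) (0, n) := by
      dsimp only; rw [D.δ_zero]
    rw [sub_eq_iff_eq_add', h0,
      add_sum_erase (HasAntidiagonal.antidiagonal n)
        (fun p : ℕ × ℕ => mulOp k R (D.δ p.1 f) * D.δlin p.2)
        (HasAntidiagonal.mem_antidiagonal.mpr (zero_add n))]
    ext x
    simp only [LinearMap.sum_apply]
    exact D.δ_mul n f x
  rcases n with _ | n
  · intro f
    rw [e]
    simp
  · intro f
    rw [e]
    refine IsDiffOp.sum _ ?_
    rintro ⟨i, j⟩ h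
    have h1 := (mem_erase.mp h).2
    have h2 := (mem_erase.mp h).1
    simp only [HasAntidiagonal.mem_antidiagonal] at h1
    have hj : j < n + 1 := by
      rcases Nat.lt_or_ge j (n + 1) with h3 | h3
      · exact h3
      · exact absurd (by ext <;> simp <;> omega) h2
    have := (IsDiffOp.mulOp (k := k) (D.δ i f)).mul (ih j hj)
    exact this.mono (by omega)

/-- `δ⁽ⁿ⁾` as a differential operator. -/
def HasseSystem.op (D : HasseSystem k R) (n : ℕ) : diffOps k R := ⟨D.δlin n, n, D.δlin_isDiffOp n⟩

/-- A module over the ring of differential operators, extending a given `R`-module. -/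
structure DModule (k : Type u) (R : Type v) [CommRing k] [CommRing R] [Algebra k R]
    (M : Type w) [AddCommGroup M] [Module R M] where
  ρ : diffOps k R →+* AddMonoid.End M
  ρ_mul : ∀ (f : R) (x : M), ρ (diffOps.mul k f) x = f • x

/-- The action of the operators `δ⁽ⁿ⁾` on a module over the ring of differential operators. -/
def DModule.toAction (D : HasseSystem k R) {M : Type w} [AddCommGroup M] [Module R M]
    (X : DModule k R M) : HasseAction D M where
  δ n := X.ρ (D.op n)
  δ_zero x := by
    have : D.op 0 = 1 := Subtype.ext (LinearMap.ext fun f => D.δ_zero f)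
    rw [this, map_one]; rfl
  δ_smul n f x := by
    have : D.op n * diffOps.mul k f =
        ∑ p ∈ antidiagonal n, diffOps.mul k (D.δ p.1 f) * D.op p.2 := by
      apply Subtype.ext
      ext g
      simp only [AddSubmonoidClass.coe_finsetSum, LinearMap.sum_apply]
      exact D.δ_mul n f g
    have h := congrArg (fun P => X.ρ P x) this
    simp only [map_mul, map_sum] at h
    rw [← X.ρ_mul]
    refine h.trans ?_
    rw [show (∑ p ∈ antidiagonal n, X.ρ (diffOps.mul k (D.δ p.1 f)) * X.ρ (D.op p.2)) x =
      ∑ p ∈ antidiagonal n, (X.ρ (diffOps.mul k (D.δ p.1 f)) * X.ρ (D.op p.2)) x from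
      AddMonoidHom.finsetSum_apply _ _ _]
    exact sum_congr rfl fun p _ => X.ρ_mul _ _
  δ_comp m n x := by
    have : D.op m * D.op n = ∑ j ∈ range (m + n + 1), structConst m n j • D.op j := by
      apply Subtype.ext
      ext g
      simp only [AddSubmonoidClass.coe_finsetSum, LinearMap.sum_apply]
      exact D.δ_comp m n g
    have h := congrArg (fun P => X.ρ P x) this
    simp only [map_mul, map_sum, map_nsmul] at h
    refine h.trans ?_
    exact AddMonoidHom.finsetSum_apply _ _ _

section
variable {D : HasseSystem k R} {M : Type*} [AddCommGroup M] [Module R M]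

/-- `∑ c_n δ⁽ⁿ⁾`. -/
noncomputable def HasseAction.opSum (a : HasseAction D M) : (ℕ →₀ R) →+ (M →+ M) :=
  Finsupp.liftAddHom fun n =>
    AddMonoidHom.mk' (fun f => (smulAddHom R M f).comp (a.δ n))
      (fun f g => by ext x; exact add_smul f g (a.δ n x))

theorem HasseAction.opSum_single (a : HasseAction D M) (n : ℕ) (f : R) (x : M) :
    a.opSum (Finsupp.single n f) x = f • a.δ n x := by
  rw [HasseAction.opSum, Finsupp.liftAddHom_apply_single]; rfl

noncomputable def opStar (D : HasseSystem k R) : (ℕ →₀ R) →+ (ℕ →₀ R) →+ (ℕ →₀ R) :=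
  Finsupp.liftAddHom fun m => AddMonoidHom.mk' (fun f =>
    Finsupp.liftAddHom fun n => AddMonoidHom.mk' (fun g =>
      ∑ p ∈ antidiagonal m, ∑ j ∈ range (p.2 + n + 1),
        Finsupp.single j (structConst p.2 n j • (f * D.δ p.1 g)))
      (fun g g' => by simp [mul_add, sum_add_distrib]))
    (fun f f' => by
      ext n g : 2
      simp [add_mul, sum_add_distrib])

theorem star_single (m n : ℕ) (f g : R) : opStar D (Finsupp.single m f) (Finsupp.single n g) =
    ∑ p ∈ antidiagonal m, ∑ j ∈ range (p.2 + n + 1),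
        Finsupp.single j (structConst p.2 n j • (f * D.δ p.1 g)) := by
  simp [opStar]

theorem HasseAction.opSum_star (a : HasseAction D M) (c d : ℕ →₀ R) (x : M) :
    a.opSum (opStar D c d) x = a.opSum c (a.opSum d x) := by
  induction c using Finsupp.induction_linear with
  | zero => simp
  | add c c' hc hc' => simp only [map_add, AddMonoidHom.add_apply, hc, hc']
  | single m f =>
    induction d using Finsupp.induction_linear with
    | zero => simp
    | add c c' hc hc' => simp only [map_add, AddMonoidHom.add_apply, hc, hc']
    | single n g =>
      rw [star_single, a.opSum_single, a.opSum_single, a.δ_smul, smul_sum,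
        map_sum, AddMonoidHom.finsetSum_apply]
      refine sum_congr rfl fun p _ => ?_
      rw [map_sum, a.δ_comp, smul_sum, smul_sum, AddMonoidHom.finsetSum_apply]
      refine sum_congr rfl fun j _ => ?_
      rw [a.opSum_single, smul_assoc, mul_smul, smul_comm (D.δ p.1 g) (structConst p.2 n j),
        smul_comm f (structConst p.2 n j)]

end
end

section
variable (k : Type u) [Field k]
open LaurentPolynomial

theorem gm_opSum_T (c : ℕ →₀ k[T;T⁻¹]) (r : ℤ) :
    (gmSystem k).self.opSum c (T r) = (c.sum fun n f => Ring.choose r n • f) * T r := by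
  induction c using Finsupp.induction_linear with
  | zero => simp
  | add c d hc hd =>
    rw [map_add, AddMonoidHom.add_apply, hc, hd, Finsupp.sum_add_index' (by simp) (by simp), add_mul]
  | single n f =>
    rw [HasseAction.opSum_single, Finsupp.sum_single_index (by simp)]
    have := laurentδ_C_mul_T k n 1 r
    rw [map_one, one_mul] at this
    change f • laurentδ k n (T r) = _
    rw [this, smul_eq_mul, mul_smul_comm, smul_mul_assoc]

theorem gm_opSum_injective : Function.Injective (gmSystem k).self.opSum := by
  rw [injective_iff_map_eq_zero]
  intro c hc
  have h : ∀ r : ℕ, (c.sum fun n f => Ring.choose (r : ℤ) n • f) = 0 := by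
    intro r
    have := gm_opSum_T k c r
    rw [hc, AddMonoidHom.zero_apply] at this
    have h2 := congrArg (· * T (-(r : ℤ))) this
    rw [zero_mul, mul_assoc, ← T_add, add_neg_cancel, T_zero, mul_one] at h2
    exact h2.symm
  ext1 n
  induction n using Nat.strong_induction_on with
  | _ n ih =>
    have := h n
    rw [Finsupp.sum, sum_eq_single n] at this
    · rw [Ring.choose_natCast, Nat.choose_self, Nat.cast_one, one_smul] at this
      simpa using this
    · intro m _ hm
      rcases lt_or_gt_of_ne hm with h1 | h1
      · rw [ih m h1]; simp
      · rw [Ring.choose_natCast, Nat.choose_eq_zero_of_lt h1]; simp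
    · intro h0; simp [Finsupp.notMem_support_iff.mp h0]

theorem gm_diffOp_eq_zero (N : ℕ) (P : Module.End k k[T;T⁻¹]) (hP : IsDiffOp k _ N P)
    (h : ∀ r : ℕ, r ≤ N → P (T r) = 0) : P = 0 := by
  have lin : (∀ f x, P (f * x) = f * P x) → P = 0 := by
    intro hl
    refine LinearMap.ext fun x => ?_
    have h0 := h 0 (Nat.zero_le _)
    rw [← mul_one x, hl]
    simp only [Nat.cast_zero, T_zero] at h0
    rw [h0]; simp
  induction N generalizing P with
  | zero =>
    refine lin fun f x => ?_
    exact sub_eq_zero.mp (LinearMap.congr_fun (hP f) x)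
  | succ N ih =>
    have hQ : P * mulOp k k[T;T⁻¹] (T 1) - mulOp k k[T;T⁻¹] (T 1) * P = 0 := by
      have hz : ∀ r : ℕ, r ≤ N →
          (P * mulOp k k[T;T⁻¹] (T 1) - mulOp k k[T;T⁻¹] (T 1) * P) (T r) = 0 := by
        intro r hr
        change P (T 1 * T r) - T 1 * P (T r) = 0
        rw [← T_add, h r (by omega)]
        have := h (r + 1) (by omega)
        push_cast at this
        rw [add_comm, this]; simp
      refine ih _ (hP (T 1)) hz fun hl => ?_
      refine LinearMap.ext fun x => ?_
      have h0 := hz 0 (Nat.zero_le _)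
      rw [← mul_one x, hl]
      simp only [Nat.cast_zero, T_zero] at h0
      rw [h0]; simp
    have c1 : ∀ x, P (T 1 * x) = T 1 * P x := fun x =>
      sub_eq_zero.mp (LinearMap.congr_fun hQ x)
    have c2 : ∀ x, P (T (-1) * x) = T (-1) * P x := by
      intro x
      have := c1 (T (-1) * x)
      rw [← mul_assoc, ← T_add] at this
      simp only [add_neg_cancel, T_zero, one_mul] at this
      rw [this, ← mul_assoc, ← T_add]
      simp
    have c3 : ∀ (r : ℤ) x, P (T r * x) = T r * P x := by
      intro r
      induction r using Int.induction_on with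
      | zero => intro x; simp
      | succ n ih => intro x; rw [T_add, mul_assoc, ih, c1, mul_assoc]
      | pred n ih => intro x; rw [sub_eq_add_neg, T_add, mul_assoc, ih, c2, mul_assoc]
    refine lin fun f x => ?_
    induction f using LaurentPolynomial.induction_on' with
    | add f g hf hg => rw [add_mul, map_add, hf, hg, add_mul]
    | C_mul_T n a =>
      rw [mul_assoc, mul_assoc, ← smul_eq_C_mul, ← smul_eq_C_mul, map_smul, c3]

theorem gm_interpolate (N : ℕ) (s : ℕ → k[T;T⁻¹]) : ∃ c : ℕ →₀ k[T;T⁻¹],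
    (∀ n, N < n → c n = 0) ∧
      ∀ r : ℕ, r ≤ N → (c.sum fun n f => Ring.choose (r : ℤ) n • f) = s r := by
  induction N with
  | zero =>
    refine ⟨Finsupp.single 0 (s 0), fun n hn => ?_, fun r hr => ?_⟩
    · rw [Finsupp.single_eq_of_ne (by omega)]
    · obtain rfl : r = 0 := by omega
      rw [Finsupp.sum_single_index (by simp)]; simp
  | succ N ih =>
    obtain ⟨c, hc, h⟩ := ih
    refine ⟨c + Finsupp.single (N + 1)
      (s (N + 1) - (c.sum fun n f => Ring.choose ((N + 1 : ℕ) : ℤ) n • f)), fun n hn => ?_,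
      fun r hr => ?_⟩
    · rw [Finsupp.add_apply, Finsupp.single_eq_of_ne (by omega), hc n (by omega), add_zero]
    · rw [Finsupp.sum_add_index' (by simp) (by simp), Finsupp.sum_single_index (by simp)]
      rcases Nat.lt_or_ge r (N + 1) with h1 | h1
      · rw [h r (by omega), Ring.choose_natCast, Nat.choose_eq_zero_of_lt h1]; simp
      · obtain rfl : r = N + 1 := by omega
        rw [Ring.choose_natCast, Nat.choose_self]; simp

theorem gm_exists_opSum (P : Module.End k k[T;T⁻¹]) (hP : P ∈ diffOps k k[T;T⁻¹]) :
    ∃ c : ℕ →₀ k[T;T⁻¹], ∀ x, P x = (gmSystem k).self.opSum c x := by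
  obtain ⟨N, hN⟩ := hP
  obtain ⟨c, hc, h⟩ := gm_interpolate k N fun r => P (T r) * T (-(r : ℤ))
  refine ⟨c, ?_⟩
  set Q : Module.End k k[T;T⁻¹] := ∑ n ∈ range (N + 1), mulOp k _ (c n) * (gmSystem k).δlin n with hQ
  have e : ∀ x, Q x = (gmSystem k).self.opSum c x := by
    intro x
    rw [hQ, LinearMap.sum_apply]
    have : c = ∑ n ∈ range (N + 1), Finsupp.single n (c n) := by
      ext1 m
      rw [Finsupp.finsetSum_apply]
      rcases Nat.lt_or_ge N m with h1 | h1
      · rw [hc m h1, sum_eq_zero]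
        intro i hi
        have := mem_range.mp hi
        rw [Finsupp.single_eq_of_ne (by omega)]
      · rw [sum_eq_single m (fun i _ hi => Finsupp.single_eq_of_ne hi.symm)
          (fun h => absurd (mem_range.mpr (by omega)) h)]
        simp
    conv_rhs => rw [this, map_sum]
    rw [AddMonoidHom.finsetSum_apply]
    refine sum_congr rfl fun n _ => ?_
    rw [HasseAction.opSum_single]; rfl
  have hz : P - Q = 0 := by
    refine gm_diffOp_eq_zero k N _ ?_ ?_
    · rw [sub_eq_add_neg]
      refine hN.add ?_
      rw [hQ, ← sum_neg_distrib]
      refine IsDiffOp.sum _ fun n hn => ?_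
      have hneg : -(mulOp k k[T;T⁻¹] (c n) * (gmSystem k).δlin n) =
          mulOp k k[T;T⁻¹] (-c n) * (gmSystem k).δlin n :=
        LinearMap.ext fun x => (neg_mul (c n) _).symm
      rw [hneg]
      exact ((IsDiffOp.mulOp (k := k) (-c n)).mul ((gmSystem k).δlin_isDiffOp n)).mono
        (by have := mem_range.mp hn; omega)
    · intro r hr
      rw [LinearMap.sub_apply, e, gm_opSum_T, h r hr, mul_assoc, ← T_add]
      simp
  intro x
  rw [← e, ← sub_eq_zero, ← LinearMap.sub_apply, hz]; rfl

/-- On `𝔾_m`, an action of the operators `δ⁽ⁿ⁾` is the same as a module structure over the ring of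
differential operators. -/
theorem gm_toAction_bijective (M : Type w) [AddCommGroup M] [Module k[T;T⁻¹] M] :
    Function.Bijective (DModule.toAction (M := M) (gmSystem k)) := by
  have hself : ∀ (c : ℕ →₀ k[T;T⁻¹]) (P : diffOps k k[T;T⁻¹]),
      (∀ x, P.1 x = (gmSystem k).self.opSum c x) →
      P = c.sum fun n f => diffOps.mul k f * (gmSystem k).op n := by
    intro c P h
    apply Subtype.ext
    refine LinearMap.ext fun x => ?_
    rw [h]
    clear h P
    induction c using Finsupp.induction_linear with
    | zero => simp
    | add c d hc hd =>
      rw [map_add, AddMonoidHom.add_apply, hc, hd, Finsupp.sum_add_index']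
      · rfl
      · intro a; apply Subtype.ext; simp [diffOps.mul]
      · intro a b b'; apply Subtype.ext; simp [diffOps.mul, add_mul]
    | single n f =>
      rw [Finsupp.sum_single_index, HasseAction.opSum_single]
      · rfl
      · apply Subtype.ext; simp [diffOps.mul]
  constructor
  · intro X Y h
    have hρ : X.ρ = Y.ρ := by
      ext P : 1
      obtain ⟨c, hc⟩ := gm_exists_opSum k P.1 P.2
      rw [hself c P hc, Finsupp.sum, map_sum, map_sum]
      refine sum_congr rfl fun n _ => ?_
      rw [map_mul, map_mul]
      have h1 : X.ρ ((gmSystem k).op n) = Y.ρ ((gmSystem k).op n) :=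
        congrFun (congrArg HasseAction.δ h) n
      rw [h1]
      congr 1
      ext x
      rw [X.ρ_mul, Y.ρ_mul]
    cases X; cases Y; cases hρ; rfl
  · intro a
    choose c hc using fun P : diffOps k k[T;T⁻¹] => gm_exists_opSum k P.1 P.2
    have uniq : ∀ (P : diffOps k k[T;T⁻¹]) (d : ℕ →₀ k[T;T⁻¹]),
        (∀ x, P.1 x = (gmSystem k).self.opSum d x) → c P = d := by
      intro P d hd
      apply gm_opSum_injective k
      refine AddMonoidHom.ext fun x => ?_
      rw [← hc, hd]
    refine ⟨⟨{ toFun := fun P => (a.opSum (c P) : M →+ M), map_one' := ?_, map_mul' := ?_, map_zero' := ?_,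
               map_add' := ?_ }, ?_⟩, ?_⟩
    · rw [uniq 1 (Finsupp.single 0 1)]
      · refine AddMonoidHom.ext fun x => ?_
        rw [HasseAction.opSum_single, a.δ_zero, one_smul]; rfl
      · intro x; rw [HasseAction.opSum_single, HasseAction.δ_zero, one_smul]; rfl
    · intro P Q
      rw [uniq (P * Q) (opStar (gmSystem k) (c P) (c Q))]
      · refine AddMonoidHom.ext fun x => ?_
        rw [HasseAction.opSum_star]; rfl
      · intro x
        rw [HasseAction.opSum_star, ← hc, ← hc]; rfl
    · rw [uniq 0 0 (by intro x; simp), map_zero]; rfl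
    · intro P Q
      rw [uniq (P + Q) (c P + c Q), map_add]
      · rfl
      intro x
      rw [map_add, AddMonoidHom.add_apply, ← hc, ← hc]; rfl
    · intro f x
      change a.opSum (c _) x = _
      rw [uniq (diffOps.mul k f) (Finsupp.single 0 f), HasseAction.opSum_single, a.δ_zero]
      intro x
      rw [HasseAction.opSum_single, HasseAction.δ_zero]; rfl
    · have : ∀ b b' : HasseAction (gmSystem k) M, b.δ = b'.δ → b = b' := by
        intro b b' h; cases b; cases b'; cases h; rfl
      apply this
      funext n
      ext x
      change a.opSum (c _) x = _
      rw [uniq ((gmSystem k).op n) (Finsupp.single n 1), HasseAction.opSum_single, one_smul]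
      intro x
      rw [HasseAction.opSum_single, one_smul]; rfl

end

/-! ### The category of stratified bundles -/

section
open CategoryTheory TensorProduct
variable {k R : Type u} [CommRing k] [CommRing R] [Algebra k R]

/-- Stratified bundles: finitely generated `R`-modules with an action of the operators `δ⁽ⁿ⁾`. For
`k[t, t⁻¹]` these are the `𝒪`-coherent `𝒟`-modules on `𝔾_m`, for `k((t))` the iterated differential
modules. -/
structure StratBundle (D : HasseSystem k R) where
  carrier : Type u
  [addCommGroup : AddCommGroup carrier]
  [module : Module R carrier]
  [finite : Module.Finite R carrier]
  act : HasseAction D carrier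

namespace StratBundle
variable {D : HasseSystem k R}

instance : CoeSort (StratBundle D) (Type u) := ⟨StratBundle.carrier⟩
instance (E : StratBundle D) : AddCommGroup E := E.addCommGroup
instance (E : StratBundle D) : Module R E := E.module
instance (E : StratBundle D) : Module.Finite R E := E.finite

/-- Morphisms: `R`-linear maps commuting with all `δ⁽ⁿ⁾`. -/
@[ext] structure Hom (E F : StratBundle D) where
  lin : E →ₗ[R] F
  comm : ∀ n x, lin (E.act.δ n x) = F.act.δ n (lin x)

instance : Category (StratBundle D) where
  Hom := Hom
  id E := ⟨LinearMap.id, fun _ _ => rfl⟩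
  comp f g := ⟨g.lin ∘ₗ f.lin, fun n x => by simp [f.comm, g.comm]⟩

@[ext] theorem hom_ext {E F : StratBundle D} {f g : E ⟶ F} (h : f.lin = g.lin) : f = g :=
  Hom.ext h

theorem id_lin (E : StratBundle D) : Hom.lin (𝟙 E) = LinearMap.id := rfl
theorem comp_lin {E F G : StratBundle D} (f : E ⟶ F) (g : F ⟶ G) :
    (f ≫ g).lin = g.lin ∘ₗ f.lin := rfl

instance (E F : StratBundle D) : Zero (E ⟶ F) := ⟨⟨0, fun n x => by simp⟩⟩
instance (E F : StratBundle D) : Add (E ⟶ F) :=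
  ⟨fun f g => ⟨f.lin + g.lin, fun n x => by simp [f.comm, g.comm]⟩⟩
instance (E F : StratBundle D) : Neg (E ⟶ F) :=
  ⟨fun f => ⟨-f.lin, fun n x => by simp [f.comm]⟩⟩
instance (E F : StratBundle D) : SMul k (E ⟶ F) :=
  ⟨fun c f => ⟨algebraMap k R c • f.lin, fun n x => by
    simp [f.comm, F.act.δ_algebraMap_smul]⟩⟩

theorem zero_lin (E F : StratBundle D) : (0 : E ⟶ F).lin = 0 := rfl
theorem add_lin {E F : StratBundle D} (f g : E ⟶ F) : (f + g).lin = f.lin + g.lin := rfl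
theorem neg_lin {E F : StratBundle D} (f : E ⟶ F) : (-f).lin = -f.lin := rfl
theorem smul_lin {E F : StratBundle D} (c : k) (f : E ⟶ F) :
    (c • f).lin = algebraMap k R c • f.lin := rfl

instance (E F : StratBundle D) : AddCommGroup (E ⟶ F) where
  add_assoc f g h := hom_ext (add_assoc _ _ _)
  zero_add f := hom_ext (zero_add _)
  add_zero f := hom_ext (add_zero _)
  add_comm f g := hom_ext (add_comm _ _)
  neg_add_cancel f := hom_ext (neg_add_cancel _)
  nsmul := nsmulRec
  zsmul := zsmulRec

instance : Preadditive (StratBundle D) where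
  homGroup := inferInstance
  add_comp _ _ _ _ _ _ := hom_ext (LinearMap.comp_add _ _ _)
  comp_add _ _ _ _ _ _ := hom_ext (LinearMap.add_comp _ _ _)

instance (E F : StratBundle D) : Module k (E ⟶ F) where
  one_smul f := hom_ext (by simp [smul_lin])
  mul_smul a b f := hom_ext (by simp [smul_lin, mul_smul])
  smul_zero a := hom_ext (by simp [smul_lin, zero_lin])
  smul_add a f g := hom_ext (by simp [smul_lin, add_lin])
  add_smul a b f := hom_ext (by simp [smul_lin, add_lin, add_smul])
  zero_smul f := hom_ext (by simp [smul_lin, zero_lin])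

instance : Linear k (StratBundle D) where
  homModule := inferInstance
  smul_comp _ _ _ _ _ _ := hom_ext (by simp [smul_lin, comp_lin, LinearMap.comp_smul])
  comp_smul _ _ _ _ _ _ := hom_ext (by simp [smul_lin, comp_lin, LinearMap.smul_comp])

/-- The trivial stratified bundle. -/
def trivial (D : HasseSystem k R) : StratBundle D where
  carrier := R
  act := D.self

/-- The tensor product of stratified bundles. -/
def tensor (E F : StratBundle D) : StratBundle D where
  carrier := E ⊗[R] F
  act := E.act.tensor F.act

/-- The full subcategory of stratified bundles of rank `1`. -/
def rankOne (D : HasseSystem k R) : ObjectProperty (StratBundle D) :=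
  fun E => Module.finrank R E = 1

abbrev RankOne (D : HasseSystem k R) := (rankOne D).FullSubcategory

/-- The same module with the operators of the inverse coordinate. -/
def invCoord : StratBundle D ⥤ StratBundle D.inv where
  obj E := { carrier := E, act := E.act.inv }
  map {E F} f := ⟨f.lin, fun n x => by
    have h : ∀ E : StratBundle D, E.act.inv.δ n = invOp E.act.δ n := fun _ => rfl
    erw [h, h]
    simp only [invOp_apply]
    simp [invOp, f.comm]⟩

end StratBundle

section BaseChange
variable {R' : Type u} [CommRing R'] [Algebra k R'] {D : HasseSystem k R} {D' : HasseSystem k R'}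

section
variable [Algebra R R'] (h : ∀ n f, D'.δ n (algebraMap R R' f) = algebraMap R R' (D.δ n f))

/-- `R'` as a module over `R`, with the operators of `D'`. -/
def restrictSelf : HasseAction D R' where
  δ := D'.δ
  δ_zero := D'.δ_zero
  δ_smul n f x := by simp only [Algebra.smul_def, D'.δ_mul, h]
  δ_comp := D'.δ_comp

/-- On `R' ⊗ E`: `δ⁽ⁿ⁾ (g ⊗ x) = ∑_{a + b = n} δ⁽ᵃ⁾ g ⊗ δ⁽ᵇ⁾ x`. -/
def HasseAction.baseChange {M : Type*} [AddCommGroup M] [Module R M] (a : HasseAction D M) :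
    HasseAction D' (R' ⊗[R] M) where
  δ := (restrictSelf h).tensorδ a
  δ_zero := ((restrictSelf h).tensor a).δ_zero
  δ_smul n g z := by
    induction z using TensorProduct.induction_on with
    | zero => simp
    | add z w hz hw => simp only [smul_add, map_add, hz, hw, sum_add_distrib]
    | tmul x y =>
      simp only [smul_tmul', HasseAction.tensorδ_tmul, smul_sum, smul_eq_mul]
      have : ∀ i, (restrictSelf h).δ i (g * x) =
        ∑ p ∈ antidiagonal i, D'.δ p.1 g * D'.δ p.2 x := fun i => D'.δ_mul i g x
      simp only [this, sum_tmul]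
      rw [← sum_assoc n fun i j l => (D'.δ i g * (restrictSelf h).δ j x) ⊗ₜ[R] a.δ l y]
      rfl
  δ_comp := (restrictSelf h).tensorδ_comp a

end

variable (φ : R →ₐ[k] R') (h : ∀ n f, D'.δ n (φ f) = φ (D.δ n f))

/-- Base change `E ↦ R' ⊗ E` along an algebra homomorphism `φ : R → R'` compatible with the
operators. -/
def StratBundle.baseChange : StratBundle D ⥤ StratBundle D' :=
  letI := φ.toRingHom.toAlgebra
  { obj := fun E => { carrier := R' ⊗[R] E, act := E.act.baseChange h }
    map := fun {E F} f => ⟨f.lin.baseChange R', fun n z => by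
      induction z using TensorProduct.induction_on with
      | zero => simp
      | add z w hz hw => simp only [map_add, hz, hw]
      | tmul x y =>
        change f.lin.baseChange R' (HasseAction.tensorδ _ _ n _) = HasseAction.tensorδ _ _ n _
        simp [HasseAction.tensorδ_tmul, f.comm]⟩
    map_id := fun E => StratBundle.hom_ext (LinearMap.baseChange_id)
    map_comp := fun f g => StratBundle.hom_ext (LinearMap.baseChange_comp f.lin g.lin) }

end BaseChange
end


/-! ### The stratified bundles `O(α)` -/

section
variable {p : ℕ} [Fact p.Prime] (k : Type u) [Field k] [CharP k p]

/-- The image of `(α choose n) ∈ ℤ_p` in `k`. -/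
noncomputable def binom (α : ℤ_[p]) (n : ℕ) : k :=
  ZMod.castHom dvd_rfl k (PadicInt.toZMod (Ring.choose α n))

theorem binom_zero (α : ℤ_[p]) : binom k α 0 = 1 := by
  simp [binom]

theorem binom_mul (α : ℤ_[p]) (m n : ℕ) :
    binom k α m * binom k α n = ∑ j ∈ range (m + n + 1), structConst m n j • binom k α j := by
  simp only [binom]
  rw [← map_mul, ← map_mul, padic_choose_mul]
  simp only [map_sum, map_nsmul]

end

section
variable {p : ℕ} [Fact p.Prime] {k : Type u} {R : Type v} [Field k] [CharP k p] [CommRing R]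
  [Algebra k R]

/-- The action on the free module `R` of rank one with `δ⁽ⁿ⁾ 1 = (α choose n)`. -/
noncomputable def lineAction (D : HasseSystem k R) (α : ℤ_[p]) : HasseAction D R where
  δ n := ∑ q ∈ antidiagonal n,
    (AddMonoidHom.mulLeft (algebraMap k R (binom k α q.2))).comp (D.δ q.1)
  δ_zero x := by simp [binom_zero, D.δ_zero]
  δ_smul n f x := by
    simp only [AddMonoidHom.finsetSum_apply, AddMonoidHom.comp_apply, AddMonoidHom.coe_mulLeft,
      smul_eq_mul, D.δ_mul, mul_sum]
    rw [← sum_assoc n fun i j l => D.δ i f * (algebraMap k R (binom k α l) * D.δ j x)]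
    exact sum_congr rfl fun _ _ => sum_congr rfl fun _ _ => mul_left_comm _ _ _
  δ_comp m n x := by
    have hr : ∀ {m n N : ℕ}, m + n < N → D.δ m (D.δ n x) =
        ∑ j ∈ range N, structConst m n j • D.δ j x := fun h => D.self.δ_comp_range h x
    have hb : ∀ {m n N : ℕ}, m + n < N → binom k α m * binom k α n =
        ∑ j ∈ range N, structConst m n j • binom k α j := by
      intro m n N h
      rw [binom_mul]
      refine sum_subset (by intro a; simp; omega) fun i _ hi => ?_
      simp at hi
      rw [structConst_eq_zero (by omega), zero_smul]
    simp only [AddMonoidHom.finsetSum_apply, AddMonoidHom.comp_apply, AddMonoidHom.coe_mulLeft,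
      map_sum, D.δ_const]
    have h : ∀ q ∈ antidiagonal n, ∀ r ∈ antidiagonal m,
        algebraMap k R (binom k α r.2) * (algebraMap k R (binom k α q.2) * D.δ r.1 (D.δ q.1 x)) =
        ∑ j ∈ range (m + n + 1), ∑ l ∈ range (m + n + 1),
          (structConst r.1 q.1 j * structConst r.2 q.2 l) •
            (algebraMap k R (binom k α l) * D.δ j x) := by
      intro q hq r hr'
      simp only [HasAntidiagonal.mem_antidiagonal] at hq hr'
      rw [← mul_assoc, ← map_mul, hb (N := m + n + 1) (by omega), hr (N := m + n + 1) (by omega),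
        map_sum, sum_mul_sum, sum_comm]
      refine sum_congr rfl fun j _ => sum_congr rfl fun l _ => ?_
      rw [map_nsmul, smul_mul_smul_comm, mul_comm (structConst r.2 q.2 l)]
    have h2 : ∀ j l, ∑ q ∈ antidiagonal n, ∑ r ∈ antidiagonal m,
        (structConst r.1 q.1 j * structConst r.2 q.2 l) •
          (algebraMap k R (binom k α l) * D.δ j x) =
        structConst m n (j + l) • (algebraMap k R (binom k α l) * D.δ j x) := by
      intro j l
      simp only [← sum_smul]
      rw [structConst_add]
    calc _ = ∑ q ∈ antidiagonal n, ∑ r ∈ antidiagonal m, algebraMap k R (binom k α r.2) *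
          (algebraMap k R (binom k α q.2) * D.δ r.1 (D.δ q.1 x)) := by
          refine sum_congr rfl fun q _ => ?_
          rfl
      _ = ∑ j ∈ range (m + n + 1), ∑ l ∈ range (m + n + 1),
          ∑ q ∈ antidiagonal n, ∑ r ∈ antidiagonal m,
        (structConst r.1 q.1 j * structConst r.2 q.2 l) •
          (algebraMap k R (binom k α l) * D.δ j x) := by
          rw [sum_congr rfl fun q hq => sum_congr rfl (h q hq)]
          rw [sum_congr rfl fun q _ => sum_comm, sum_comm]
          refine sum_congr rfl fun j _ => ?_
          rw [sum_congr rfl fun q _ => sum_comm, sum_comm]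
      _ = _ := by
          simp only [h2]
          rw [sum_box (m + n + 1)
            (fun j l => structConst m n (j + l) • (algebraMap k R (binom k α l) * D.δ j x))
            (fun j l h => by rw [structConst_eq_zero (by omega), zero_smul])]
          refine sum_congr rfl fun i _ => ?_
          rw [smul_sum]
          refine sum_congr rfl fun q hq => ?_
          rw [HasAntidiagonal.mem_antidiagonal.mp hq]

/-- The basis element `1` of `O_R(α)` satisfies `δ⁽ⁿ⁾ 1 = (α choose n)`. -/
theorem lineAction_one (D : HasseSystem k R) (α : ℤ_[p]) (n : ℕ) :
    (lineAction D α).δ n 1 = algebraMap k R (binom k α n) := by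
  simp only [lineAction, AddMonoidHom.finsetSum_apply, AddMonoidHom.comp_apply,
    AddMonoidHom.coe_mulLeft]
  rw [sum_eq_single (0, n)]
  · simp [D.δ_zero]
  · rintro ⟨i, j⟩ h1 h2
    simp only [HasAntidiagonal.mem_antidiagonal] at h1
    rw [D.δ_one i (by rintro rfl; simp at h1; simp [h1] at h2), mul_zero]
  · intro h; simp at h

end

section
open CategoryTheory
variable {p : ℕ} [Fact p.Prime] {k R : Type u} [Field k] [CharP k p] [CommRing R] [Algebra k R]

/-- `O_R(α)`. -/
noncomputable def StratBundle.line (D : HasseSystem k R) (α : ℤ_[p]) : StratBundle D where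
  carrier := R
  act := lineAction D α

theorem StratBundle.trivial_rankOne [Nontrivial R] (D : HasseSystem k R) :
    rankOne D (trivial D) :=
  Module.finrank_self R

theorem StratBundle.line_rankOne [Nontrivial R] (D : HasseSystem k R) (α : ℤ_[p]) :
    rankOne D (line D α) :=
  Module.finrank_self R

/-- `O_R(α)` as an object of the category of rank one stratified bundles. -/
noncomputable def StratBundle.rankOneLine [Nontrivial R] (D : HasseSystem k R) (α : ℤ_[p]) :
    RankOne D :=
  ⟨line D α, line_rankOne D α⟩

end

section
open CategoryTheory
variable {k R : Type u} [CommRing k] [CommRing R] [Algebra k R]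

/-- For a subring `S ⊆ R`: `E` contains a free `S`-submodule of the same rank which is stable under
all `δ⁽ⁿ⁾`. -/
def StratBundle.HasStableLattice {D : HasseSystem k R} (E : StratBundle D) (S : Subring R) : Prop :=
  ∃ L : Submodule S E, Module.Free S L ∧ Module.finrank S L = Module.finrank R E ∧
    ∀ n, ∀ x ∈ L, E.act.δ n x ∈ L

/-- The set of isomorphism classes of stratified bundles of rank one. -/
def StratBundle.Pic (D : HasseSystem k R) : Type (u + 1) :=
  Quotient (isIsomorphicSetoid (RankOne D))

/-- The isomorphism class of a stratified bundle of rank one. -/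
def StratBundle.Pic.mk {D : HasseSystem k R} (E : RankOne D) : Pic D :=
  Quotient.mk (isIsomorphicSetoid (RankOne D)) E

end

/-! ### Derived inverse limits -/

section Rlim

/-- `(g_n) ↦ (g_n f_n(g_{n+1})⁻¹)`. -/
def rlimShift (G : ℕ → Type u) [∀ n, CommGroup (G n)] (f : ∀ n, G (n + 1) →* G n) :
    (∀ n, G n) →* (∀ n, G n) where
  toFun g n := g n * (f n (g (n + 1)))⁻¹
  map_one' := by funext n; simp
  map_mul' g h := by funext n; simp [mul_mul_mul_comm, mul_comm]

/-- `R¹lim` of a projective system of abelian groups: the orbits of the action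
`(g · x)_n = g_n x_n f_n(g_{n+1})⁻¹`. -/
abbrev Rlim (G : ℕ → Type u) [∀ n, CommGroup (G n)] (f : ∀ n, G (n + 1) →* G n) : Type u :=
  (∀ n, G n) ⧸ (rlimShift G f).range

variable (p : ℕ) [Fact p.Prime] (R : Type u) [CommRing R] [CharP R p]

/-- The subring `R^{p^n}` of `p^n`-th powers. -/
abbrev powSubring (n : ℕ) : Subring R := (iterateFrobenius R p n).range

theorem powSubring_succ_le (n : ℕ) : powSubring p R (n + 1) ≤ powSubring p R n := by
  rintro _ ⟨x, rfl⟩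
  exact ⟨x ^ p, by simp only [iterateFrobenius_def]; rw [← pow_mul, pow_succ']⟩

/-- `R¹lim_n 𝔾_m(R^{p^n})`. -/
abbrev RlimGm : Type u :=
  Rlim (fun n => (powSubring p R n)ˣ)
    (fun n => Units.map (Subring.inclusion (powSubring_succ_le p R n)).toMonoidHom)

variable {p R} {R' : Type u} [CommRing R'] [CharP R' p]

/-- The map `R^{p^n} → R'^{p^n}` induced by a ring homomorphism `R → R'`. -/
def powSubringMap (φ : R →+* R') (n : ℕ) : powSubring p R n →+* powSubring p R' n :=
  φ.restrict _ _ (by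
    rintro _ ⟨x, rfl⟩
    exact ⟨φ x, by simp [iterateFrobenius_def]⟩)

def unitsPiMap (φ : R →+* R') :
    (∀ n, (powSubring p R n)ˣ) →* (∀ n, (powSubring p R' n)ˣ) where
  toFun g n := Units.map (powSubringMap φ n).toMonoidHom (g n)
  map_one' := by funext n; simp
  map_mul' g h := by funext n; simp

/-- The map `R¹lim_n 𝔾_m(R^{p^n}) → R¹lim_n 𝔾_m(R'^{p^n})` induced by a ring homomorphism. -/
def rlimMap (φ : R →+* R') : RlimGm p R →* RlimGm p R' :=
  QuotientGroup.map _ _ (unitsPiMap φ) (by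
    rintro _ ⟨g, rfl⟩
    refine ⟨unitsPiMap φ g, ?_⟩
    funext n
    apply Units.ext
    simp only [rlimShift, unitsPiMap, MonoidHom.coe_mk, OneHom.coe_mk, map_mul, map_inv]
    rfl)

/-- The class in `R¹lim_n 𝔾_m(R^{p^n})` of a sequence of units `u_n ∈ (R^{p^n})ˣ`. -/
def rlimMk (u : ∀ n, (powSubring p R n)ˣ) : RlimGm p R := QuotientGroup.mk u

/-- The sequence `(t ^ (a_n p^n))_n`. -/
def powSeq (t : Rˣ) (a : ℕ → ℕ) (n : ℕ) : (powSubring p R n)ˣ :=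
  Units.map (iterateFrobenius R p n).rangeRestrict.toMonoidHom (t ^ a n)

theorem powSeq_coe (t : Rˣ) (a : ℕ → ℕ) (n : ℕ) :
    ((powSeq (p := p) t a n : powSubring p R n) : R) = (t : R) ^ (a n * p ^ n) := by
  simp [powSeq, iterateFrobenius_def, ← pow_mul, mul_comm]

end Rlim

section
variable {p : ℕ} [Fact p.Prime] {k R : Type u} [Field k] [CommRing R] [Algebra k R]
  [CharP R p]

/-- `E⁽ⁿ⁾ = {x | δ⁽ᵖ^ᵐ⁾ x = 0 for m < n}`. -/
def StratBundle.level (p : ℕ) {D : HasseSystem k R} (E : StratBundle D) (n : ℕ) : Set E :=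
  {x | ∀ m < n, E.act.δ (p ^ m) x = 0}

/-- The sequence `u_n ∈ (R^{p^n})ˣ` describes `E`: there are `R^{p^n}`-bases `e_n` of `E⁽ⁿ⁾` with
`e_n = u_n e_{n+1}`. -/
def StratBundle.IsDescribedBy {D : HasseSystem k R} (E : StratBundle D)
    (u : ∀ n, (powSubring p R n)ˣ) : Prop :=
  ∃ e : ℕ → E, (∀ n, e n ∈ E.level p n) ∧
    (∀ n, ∀ x ∈ E.level p n, ∃! c : powSubring p R n, x = (c : R) • e n) ∧
    ∀ n, e n = ((u n : powSubring p R n) : R) • e (n + 1)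

end

section
open CategoryTheory LaurentPolynomial
variable {p : ℕ} [Fact p.Prime] (k : Type u) [Field k] [CharP k p]

instance : CharP k[T;T⁻¹] p :=
  charP_of_injective_algebraMap (algebraMap k k[T;T⁻¹]).injective p

instance : CharP (LaurentSeries k) p :=
  charP_of_injective_algebraMap (algebraMap k (LaurentSeries k)).injective p

end

section
open CategoryTheory LaurentPolynomial
variable (k : Type u) [Field k]
/-- Restriction to `k((t))`. -/
noncomputable def resZero : StratBundle (gmSystem k) ⥤ StratBundle (seriesSystem k) :=
  StratBundle.baseChange (inclZero k) (inclZero_δ k)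

/-- Restriction to `k((t⁻¹)) = k((s))`, `s = t⁻¹`: the operators `δ_t⁽ⁿ⁾` are first rewritten in
terms of the coordinate `s`. -/
noncomputable def resInfty : StratBundle (gmSystem k) ⥤ StratBundle (seriesSystem k) :=
  StratBundle.invCoord ⋙ StratBundle.baseChange (inclInfty k) (inclInfty_δ k)

end

section
open LaurentPolynomial
variable {k : Type u} [Field k]

/-- A stratified bundle on `k((t))` is regular singular if it contains a `δ_t⁽ⁿ⁾`-stable free
`k⟦t⟧`-submodule of the same rank. -/
def IsRegularSingular (E : StratBundle (seriesSystem k)) : Prop :=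
  E.HasStableLattice (HahnSeries.ofPowerSeries ℤ k).range

/-- A stratified bundle on `𝔾_m` is regular singular at `0` if it contains a `δ_t⁽ⁿ⁾`-stable free
`k[t]`-submodule of the same rank. -/
def IsRegularSingularAtZero (E : StratBundle (gmSystem k)) : Prop :=
  E.HasStableLattice (Polynomial.toLaurent : Polynomial k →+* k[T;T⁻¹]).range

/-- A stratified bundle on `𝔾_m` is regular singular at `∞` if it contains a free
`k[t⁻¹]`-submodule of the same rank which is stable under the operators `δ_{1/t}⁽ⁿ⁾`. -/
def IsRegularSingularAtInfty (E : StratBundle (gmSystem k)) : Prop :=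
  (StratBundle.invCoord.obj E).HasStableLattice
    ((invert (R := k) : k[T;T⁻¹] →+* k[T;T⁻¹]).comp
      (Polynomial.toLaurent : Polynomial k →+* k[T;T⁻¹])).range

end

/-- The group `ℤ_p / ℤ`. -/
abbrev ZpModZ (p : ℕ) [Fact p.Prime] : Type := ℤ_[p] ⧸ (Int.castAddHom ℤ_[p]).range

end Stratified

open Stratified Stratified.StratBundle CategoryTheory LaurentPolynomial

/-!
A bundle `E` of rank one is governed by its flat elements. Let `R` be `k[t, t⁻¹]` or `k((t))`.
A differential operator on `R` which kills every `tˢ` is formally zero (`eq_zero_of_opSum_pow`), so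
the operators on `E` satisfy every relation which holds on powers of `t`. In particular
`∑_{j < pⁿ} (-1)ʲ δ⁽ʲ⁾` projects `E` onto the elements killed by `δ⁽ʲ⁾` for `0 < j < pⁿ`, and `E` is
the sum of the translates by `tʳ`, `0 ≤ r < pⁿ`, of this space (`eigen_decomposition`). As `E` is
torsion free (`R` has no stable ideals except `0` and `R`) and `R` is a principal ideal domain, these
elements form a free module of rank one over `R^{p^n}`: this is Cartier descent in rank one
(`Coordinate.exists_flat_gen`). A basis `e_n` for each `n` gives transition units `u_n`, well
defined up to coboundaries (`HasFrames.iff_rlimMk_eq`). They determine `E`, because `δ⁽ʲ⁾` with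
`j < pⁿ` is known from `e_n` (`HasFrames.nonempty_iso`), and they multiply under tensor products.

The order of vanishing at `t = 0` sends `(u_n)` to the convergent sum `∑ ord u_n` in `ℤ_p`, since
`pⁿ ∣ ord u_n`, and a coboundary to an integer. The resulting homomorphism `R¹lim → ℤ_p / ℤ` is onto
because of the sequences `(t^{α_n pⁿ})`, which are the transition units of `O_R(α)` for the bases
`t^{-∑_{i < n} α_i pⁱ}` (`Coordinate.hasFrames_line`). It is injective because, after a change of
`(u_n)` by powers of `t`, all `u_n` have order zero, and such a sequence is a coboundary: the units
of order zero are constants times principal units, constants have `p`-th roots, and for principal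
units `h_n` the products `h_n h_{n+1}^p h_{n+2}^{p²} ⋯` converge (`exists_powerSeries_chain`). Thus
bundles of rank one are classified by `ℤ_p / ℤ`, with `O_R(α)` corresponding to `α`. What is used
about `R` is collected in the structure `Coordinate`.

The inclusion of `k[t, t⁻¹]` in `k((t))` preserves the order of a unit `c tⁿ`, and that in
`k((t⁻¹))` negates it; this gives the two restriction maps. The image of a morphism of bundles of
rank one yields a stable ideal, so a nonzero morphism `O_R(α) → O_R(β)` is an isomorphism, unique up
to elements of `R` killed by all `δ⁽ʲ⁾` with `j > 0`, that is, up to constants. Since restriction to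
`k((t))` preserves classes, it is fully faithful and essentially surjective in rank one.
-/

namespace Stratified

open Finset

/-! ### Binomial coefficients modulo `p` -/

section Binomial
variable {p : ℕ} [Fact p.Prime]

theorem coeff_pow_char_pow {A : Type*} [CommRing A] [CharP A p] (f : PowerSeries A) {n j : ℕ}
    (h : ¬ p ^ n ∣ j) : PowerSeries.coeff j (f ^ p ^ n) = 0 := by
  have hp : p ≠ 0 := (Fact.out : p.Prime).ne_zero
  have e : f ^ p ^ n = PowerSeries.map (iterateFrobenius A p n)
      (PowerSeries.expand (p ^ n) (pow_ne_zero n hp) f) :=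
    (MvPowerSeries.map_iterateFrobenius_expand p hp f n).symm
  rw [e, PowerSeries.coeff_map, PowerSeries.coeff_expand_of_not_dvd _ _ _ h, map_zero]

theorem coeff_mul_pow_char_pow {A : Type*} [CommRing A] [CharP A p] (f : PowerSeries A) (n j : ℕ) :
    PowerSeries.coeff (p ^ n * j) (f ^ p ^ n) = PowerSeries.coeff j f ^ p ^ n := by
  have hp : p ≠ 0 := (Fact.out : p.Prime).ne_zero
  have e : f ^ p ^ n = PowerSeries.map (iterateFrobenius A p n)
      (PowerSeries.expand (p ^ n) (pow_ne_zero n hp) f) :=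
    (MvPowerSeries.map_iterateFrobenius_expand p hp f n).symm
  rw [e, PowerSeries.coeff_map, PowerSeries.coeff_expand_mul, iterateFrobenius_def]

/-- The generating series `(1 + X) ^ (p ^ n * r)` is a `p ^ n`-th power, hence a series in
`X ^ (p ^ n)` modulo `p`. -/
theorem algebraMap_choose_pow_mul {S A : Type*} [CommRing S] [BinomialRing S] [CommRing A]
    [CharP A p] [Algebra S A] (r : S) {n j : ℕ} (h : ¬ p ^ n ∣ j) :
    algebraMap S A (Ring.choose ((p : S) ^ n * r) j) = 0 := by
  have hs : ∀ m : ℕ, PowerSeries.binomialSeries A ((m : S) * r) =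
      PowerSeries.binomialSeries A r ^ m := by
    intro m
    induction m with
    | zero => simp
    | succ m ih => rw [Nat.cast_succ, add_mul, one_mul, PowerSeries.binomialSeries_add, ih, pow_succ]
  have := coeff_pow_char_pow (PowerSeries.binomialSeries A r) h
  rw [← hs, PowerSeries.binomialSeries_coeff, ← Algebra.algebraMap_eq_smul_one] at this
  exact_mod_cast this

theorem not_dvd_of_pos_lt {q j : ℕ} (h0 : 0 < j) (h : j < q) : ¬ q ∣ j :=
  fun hd => absurd (Nat.le_of_dvd h0 hd) (by omega)

theorem cast_choose_pow_mul {A : Type*} [CommRing A] [CharP A p] (r : ℤ) {n j : ℕ}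
    (h : ¬ p ^ n ∣ j) : ((Ring.choose ((p : ℤ) ^ n * r) j : ℤ) : A) = 0 :=
  algebraMap_choose_pow_mul (A := A) r h

theorem binom_pow_mul (k : Type*) [Field k] [CharP k p] (α : ℤ_[p]) {n j : ℕ} (h : ¬ p ^ n ∣ j) :
    binom k ((p : ℤ_[p]) ^ n * α) j = 0 := by
  let _ : Algebra ℤ_[p] (ZMod p) := (PadicInt.toZMod (p := p)).toAlgebra
  have : PadicInt.toZMod (Ring.choose ((p : ℤ_[p]) ^ n * α) j) = 0 :=
    algebraMap_choose_pow_mul (A := ZMod p) α h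
  rw [binom, this, map_zero]

theorem binom_intCast (k : Type*) [Field k] [CharP k p] (m : ℤ) (n : ℕ) :
    binom k (m : ℤ_[p]) n = (Ring.choose m n : ℤ) := by
  have : Ring.choose (m : ℤ_[p]) n = ((Ring.choose m n : ℤ) : ℤ_[p]) :=
    (Ring.map_choose (Int.castRingHom ℤ_[p]) m n).symm
  rw [binom, this]; simp

theorem binom_add (k : Type*) [Field k] [CharP k p] (α β : ℤ_[p]) (n : ℕ) :
    binom k (α + β) n = ∑ q ∈ antidiagonal n, binom k α q.1 * binom k β q.2 := by
  simp only [binom, Ring.add_choose_eq n (Commute.all α β), map_sum, map_mul]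

theorem cast_choose_add_pow_mul {A : Type*} [CommRing A] [CharP A p] (s r : ℤ) {n j : ℕ}
    (h : j < p ^ n) :
    ((Ring.choose (s + (p : ℤ) ^ n * r) j : ℤ) : A) = (Ring.choose s j : ℤ) := by
  rw [Ring.add_choose_eq j (Commute.all _ _)]
  push_cast
  rw [sum_eq_single (j, 0)]
  · simp
  · rintro ⟨a, b⟩ hab hne
    simp only [HasAntidiagonal.mem_antidiagonal] at hab
    have hb : 0 < b := by
      rcases Nat.eq_zero_or_pos b with rfl | hb
      · exact absurd (by simpa using hab) (by simpa using hne)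
      · exact hb
    rw [cast_choose_pow_mul r (not_dvd_of_pos_lt hb (by omega)), mul_zero]
  · intro h; simp at h

/-- The locally constant function `∑_{j < p^n} (-1) ^ j (s choose j)` is the indicator function of
`p ^ n ℤ` modulo `p`. -/
theorem sum_neg_one_pow_choose {A : Type*} [CommRing A] [CharP A p] (n : ℕ) (s : ℤ) :
    ∑ j ∈ range (p ^ n), (-1 : A) ^ j * (Ring.choose s j : ℤ) =
      if (p : ℤ) ^ n ∣ s then 1 else 0 := by
  have hq : (0 : ℤ) < (p : ℤ) ^ n := by
    have := (Fact.out : p.Prime).pos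
    positivity
  obtain ⟨s₀, hs₀⟩ := Int.eq_ofNat_of_zero_le (Int.emod_nonneg s hq.ne')
  have hlt : s₀ < p ^ n := by
    have := Int.emod_lt_of_pos s hq
    rw [hs₀] at this
    exact_mod_cast this
  have hs : s = (s₀ : ℤ) + (p : ℤ) ^ n * (s / (p : ℤ) ^ n) := by
    rw [← hs₀]; exact (Int.emod_add_mul_ediv s _).symm
  have h1 : ∑ j ∈ range (p ^ n), (-1 : A) ^ j * (Ring.choose s j : ℤ) =
      ((∑ j ∈ range (s₀ + 1), (-1 : ℤ) ^ j * (s₀.choose j : ℤ) : ℤ) : A) := by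
    rw [sum_subset (s₁ := range (s₀ + 1)) (s₂ := range (p ^ n)) (by intro a; simp; omega)]
    · push_cast
      refine sum_congr rfl fun j hj => ?_
      rw [hs, cast_choose_add_pow_mul _ _ (mem_range.mp hj), Ring.choose_natCast]
      simp
    · intro j _ hj
      simp only [mem_range, not_lt] at hj
      rw [Nat.choose_eq_zero_of_lt (by omega)]; simp
  have h2 : (p : ℤ) ^ n ∣ s ↔ s₀ = 0 := by rw [Int.dvd_iff_emod_eq_zero, hs₀]; simp
  rw [h1, Int.alternating_sum_range_choose]
  simp only [h2]
  split_ifs <;> simp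

theorem not_dvd_choose_pow_log (m j : ℕ) (h1 : p ^ m ≤ j) (h2 : j < p ^ (m + 1)) :
    ¬ p ∣ j.choose (p ^ m) := by
  have hp := (Fact.out : p.Prime)
  induction m generalizing j with
  | zero =>
    simp only [pow_zero, Nat.choose_one_right] at h1 ⊢
    exact not_dvd_of_pos_lt h1 (by simpa using h2)
  | succ m ih =>
    have h := Choose.choose_modEq_choose_mod_mul_choose_div_nat (n := j) (k := p ^ (m + 1)) (p := p)
    have e1 : p ^ (m + 1) % p = 0 := Nat.mod_eq_zero_of_dvd (dvd_pow_self p (by omega))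
    have e2 : p ^ (m + 1) / p = p ^ m := by rw [pow_succ, Nat.mul_div_cancel _ hp.pos]
    rw [e1, e2, Nat.choose_zero_right, one_mul] at h
    rw [h.dvd_iff dvd_rfl]
    refine ih (j / p) ?_ ?_
    · rw [Nat.le_div_iff_mul_le hp.pos, ← pow_succ]; exact h1
    · rw [Nat.div_lt_iff_lt_mul hp.pos, ← pow_succ]; exact h2

end Binomial

/-! ### Flat elements and Cartier descent -/

section Flat
variable {k R : Type*} [CommRing k] [CommRing R] [Algebra k R] {D : HasseSystem k R}
  {M N : Type*} [AddCommGroup M] [Module R M] [AddCommGroup N] [Module R N]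

/-- The elements killed by `δ⁽ʲ⁾` for `0 < j < q`. -/
def HasseAction.flat (a : HasseAction D M) (q : ℕ) : AddSubgroup M where
  carrier := {x | ∀ j, 0 < j → j < q → a.δ j x = 0}
  zero_mem' j _ _ := map_zero _
  add_mem' hx hy j h1 h2 := by rw [map_add, hx j h1 h2, hy j h1 h2, add_zero]
  neg_mem' hx j h1 h2 := by rw [map_neg, hx j h1 h2, neg_zero]

theorem HasseAction.flat_anti (a : HasseAction D M) {q q' : ℕ} (h : q ≤ q') :
    a.flat q' ≤ a.flat q := fun _ hx j h1 h2 => hx j h1 (h2.trans_le h)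

/-- The Leibniz rule for a flat element. -/
theorem HasseAction.δ_smul_flat (a : HasseAction D M) {q : ℕ} {x : M} (hx : x ∈ a.flat q) (f : R)
    {j : ℕ} (hj : j < q) : a.δ j (f • x) = D.δ j f • x := by
  rw [a.δ_smul, sum_eq_single (j, 0)]
  · rw [a.δ_zero]
  · rintro ⟨i, l⟩ h hne
    simp only [HasAntidiagonal.mem_antidiagonal] at h
    have hl : 0 < l := by
      rcases Nat.eq_zero_or_pos l with rfl | hb
      · exact absurd (by simpa using h) (by simpa using hne)
      · exact hb
    rw [hx l hl (by omega), smul_zero]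
  · intro h; simp at h

/-- Flat functions commute with the operators. -/
theorem HasseAction.δ_flat_smul (a : HasseAction D M) {q : ℕ} {f : R} (hf : f ∈ D.self.flat q)
    (x : M) {j : ℕ} (hj : j < q) : a.δ j (f • x) = f • a.δ j x := by
  rw [a.δ_smul, sum_eq_single (0, j)]
  · rw [D.δ_zero]
  · rintro ⟨i, l⟩ h hne
    simp only [HasAntidiagonal.mem_antidiagonal] at h
    have hl : 0 < i := by
      rcases Nat.eq_zero_or_pos i with rfl | hb
      · exact absurd (by simpa using h) (by simpa using hne)
      · exact hb
    have : D.δ i f = 0 := hf i hl (by omega)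
    rw [this, zero_smul]
  · intro h; simp at h

theorem HasseAction.smul_mem_flat (a : HasseAction D M) {q : ℕ} {f : R} {x : M}
    (hf : f ∈ D.self.flat q) (hx : x ∈ a.flat q) : f • x ∈ a.flat q := by
  intro j h1 h2
  rw [a.δ_flat_smul hf x h2, hx j h1 h2, smul_zero]

theorem HasseAction.tmul_mem_flat (a : HasseAction D M) (b : HasseAction D N) {q : ℕ} {x : M} {y : N}
    (hx : x ∈ a.flat q) (hy : y ∈ b.flat q) : x ⊗ₜ[R] y ∈ (a.tensor b).flat q := by
  intro j h1 h2
  change a.tensorδ b j _ = 0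
  rw [a.tensorδ_tmul]
  refine sum_eq_zero ?_
  rintro ⟨i, l⟩ h
  simp only [HasAntidiagonal.mem_antidiagonal] at h
  rcases Nat.eq_zero_or_pos i with rfl | hi
  · rw [hy l (by omega) (by omega), TensorProduct.tmul_zero]
  · rw [hx i hi (by omega), TensorProduct.zero_tmul]

theorem HasseAction.flat_le_flat_inv (a : HasseAction D M) (q : ℕ) : a.flat q ≤ a.inv.flat q := by
  intro x hx j h1 h2
  change invOp a.δ j x = 0
  rw [invOp_apply, invOp, sum_eq_zero]
  intro i hi
  have := mem_range.mp hi
  rcases Nat.eq_zero_or_pos i with rfl | h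
  · have : invConst j 0 = 0 := by
      rw [invConst, if_pos (by omega), Nat.choose_eq_zero_of_lt (by omega)]; simp
    rw [this, zero_smul]
  · rw [hx i h (by omega), smul_zero]

/-- The Taylor expansion `f ↦ ∑ δ⁽ⁿ⁾(f) Xⁿ`, a ring homomorphism by the Leibniz rule. -/
noncomputable def HasseSystem.taylor (D : HasseSystem k R) : R →+* PowerSeries R where
  toFun f := PowerSeries.mk fun n => D.δ n f
  map_zero' := by ext n; simp
  map_one' := by
    ext n
    rw [PowerSeries.coeff_mk, PowerSeries.coeff_one]
    split_ifs with h
    · rw [h, D.δ_zero]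
    · exact D.δ_one n h
  map_add' f g := by ext n; simp
  map_mul' f g := by ext n; simp [PowerSeries.coeff_mul, D.δ_mul]

variable {p : ℕ} [Fact p.Prime] [CharP R p]

theorem HasseSystem.pow_mem_flat (D : HasseSystem k R) (f : R) (n : ℕ) :
    f ^ p ^ n ∈ D.self.flat (p ^ n) := by
  intro j h1 h2
  have := coeff_pow_char_pow (D.taylor f) (not_dvd_of_pos_lt h1 h2)
  rw [← map_pow] at this
  rw [HasseSystem.taylor, RingHom.coe_mk, MonoidHom.coe_mk, OneHom.coe_mk,
    PowerSeries.coeff_mk] at this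
  exact this

theorem HasseSystem.powSubring_mem_flat (D : HasseSystem k R) {n : ℕ} {f : R}
    (hf : f ∈ powSubring p R n) : f ∈ D.self.flat (p ^ n) := by
  obtain ⟨g, rfl⟩ := hf
  exact D.pow_mem_flat g n

/-- The operators `δ⁽ʲ⁾` for `0 < j < pⁿ` lie in the left ideal generated by the `δ⁽ᵖ^ᵐ⁾`
with `m < n`, since `δ⁽ʲ⁻ᵖ^ᵐ⁾ δ⁽ᵖ^ᵐ⁾` is `(j choose pᵐ) δ⁽ʲ⁾` up to lower order, and the coefficient is
a unit for `pᵐ ≤ j < pᵐ⁺¹`. -/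
theorem HasseAction.mem_flat_iff_level (a : HasseAction D M) (n : ℕ) (x : M) :
    x ∈ a.flat (p ^ n) ↔ ∀ m < n, a.δ (p ^ m) x = 0 := by
  have hp := (Fact.out : p.Prime)
  constructor
  · intro h m hm
    exact h _ (pow_pos hp.pos m) (Nat.pow_lt_pow_right hp.one_lt hm)
  · intro h j
    induction j using Nat.strong_induction_on with
    | _ j ih =>
      intro h1 h2
      set m := Nat.log p j with hm
      have hm1 : p ^ m ≤ j := Nat.pow_log_le_self p h1.ne'
      have hm2 : j < p ^ (m + 1) := Nat.lt_pow_succ_log_self hp.one_lt j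
      have hmn : m < n := by
        by_contra hc
        have := Nat.pow_le_pow_right hp.pos (not_lt.mp hc)
        omega
      have hpm : 0 < p ^ m := pow_pos hp.pos m
      have hc := a.δ_comp (j - p ^ m) (p ^ m) x
      rw [h m hmn, map_zero, show j - p ^ m + p ^ m = j by omega, sum_range_succ, sum_eq_zero,
        zero_add] at hc
      · rw [structConst, if_pos (by omega), show j - p ^ m + p ^ m - j = 0 by omega,
          Nat.choose_zero_right, mul_one, ← Nat.cast_smul_eq_nsmul R] at hc
        -- the leading coefficient is prime to `p`, hence a unit of `R`
        have hu : IsUnit ((j.choose (p ^ m) : ℕ) : R) := by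
          rw [CharP.isUnit_natCast_iff hp]
          exact not_dvd_choose_pow_log m j hm1 hm2
        exact (hu.smul_eq_zero).mp hc.symm
      · intro i hi
        have hi := mem_range.mp hi
        rcases Nat.eq_zero_or_pos i with rfl | hi0
        · rw [structConst, if_pos (by omega), Nat.choose_eq_zero_of_lt hpm, zero_mul, zero_smul]
        · rw [ih i hi hi0 (by omega), smul_zero]

variable (D) in
/-- `t` is a coordinate: `δ⁽ⁿ⁾ (t ^ r) = (r choose n) t ^ r` for all integers `r`. -/
def IsEigen (t : Rˣ) : Prop :=
  ∀ (n : ℕ) (r : ℤ), D.δ n ((t ^ r : Rˣ) : R) = ((Ring.choose r n : ℤ) : R) * ((t ^ r : Rˣ) : R)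

theorem opSum_eq_sum (a : HasseAction D M) (c : ℕ →₀ R) (x : M) :
    a.opSum c x = c.sum fun n f => f • a.δ n x := by
  induction c using Finsupp.induction_linear with
  | zero => simp
  | add c d hc hd =>
    rw [map_add, AddMonoidHom.add_apply, hc, hd,
      Finsupp.sum_add_index' (by simp) (by simp [add_smul])]
  | single n f => rw [HasseAction.opSum_single, Finsupp.sum_single_index (by simp)]

/-- A differential operator on `R` which kills all `t ^ s`, `s ∈ ℕ`, is formally zero. Hence every
relation between operators on `R` holds on each stratified module. -/
theorem eq_zero_of_opSum_pow {t : Rˣ} (ht : IsEigen D t) (c : ℕ →₀ R)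
    (h : ∀ s : ℕ, D.self.opSum c ((t ^ (s : ℤ) : Rˣ) : R) = 0) : c = 0 := by
  have h' : ∀ s : ℕ, (c.sum fun n f => (s.choose n : R) * f) = 0 := by
    intro s
    have h1 := h s
    rw [opSum_eq_sum] at h1
    have h2 : (c.sum fun n f => (s.choose n : R) * f) * ((t ^ (s : ℤ) : Rˣ) : R) = 0 := by
      rw [← h1, Finsupp.sum, sum_mul, Finsupp.sum]
      refine sum_congr rfl fun n _ => ?_
      rw [smul_eq_mul, show D.self.δ n = D.δ n from rfl, ht, Ring.choose_natCast]
      push_cast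
      ring
    exact (Units.mul_left_eq_zero _).mp h2
  ext1 n
  induction n using Nat.strong_induction_on with
  | _ n ih =>
    have := h' n
    rw [Finsupp.sum, sum_eq_single n] at this
    · simpa using this
    · intro m _ hm
      rcases lt_or_gt_of_ne hm with h1 | h1
      · rw [ih m h1]; simp
      · rw [Nat.choose_eq_zero_of_lt h1]; simp
    · intro h0; simp [Finsupp.notMem_support_iff.mp h0]

variable (R) in
/-- The coefficients of `∑_{j < q} (-1) ^ j δ⁽ʲ⁾`, which for `q = pⁿ` is the projector onto the
eigenspaces of exponent divisible by `q`. -/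
noncomputable def projCoeff (q : ℕ) : ℕ →₀ R :=
  ∑ j ∈ range q, Finsupp.single j ((-1 : R) ^ j)

theorem opSum_projCoeff (a : HasseAction D M) (q : ℕ) (x : M) :
    a.opSum (projCoeff R q) x = ∑ j ∈ range q, (-1 : R) ^ j • a.δ j x := by
  rw [projCoeff, map_sum, AddMonoidHom.finsetSum_apply]
  exact sum_congr rfl fun j _ => a.opSum_single _ _ _

theorem opSum_projCoeff_zpow {t : Rˣ} (ht : IsEigen D t) (n : ℕ) (s : ℤ) :
    D.self.opSum (projCoeff R (p ^ n)) ((t ^ s : Rˣ) : R) =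
      if (p : ℤ) ^ n ∣ s then ((t ^ s : Rˣ) : R) else 0 := by
  rw [opSum_projCoeff]
  have : ∀ j, (-1 : R) ^ j • D.self.δ j ((t ^ s : Rˣ) : R) =
      ((-1 : R) ^ j * (Ring.choose s j : ℤ)) * ((t ^ s : Rˣ) : R) := by
    intro j
    rw [smul_eq_mul, show D.self.δ j = D.δ j from rfl, ht, mul_assoc]
  simp only [this, ← sum_mul, sum_neg_one_pow_choose]
  split_ifs <;> simp

theorem opSum_projCoeff_mem_flat {t : Rˣ} (ht : IsEigen D t) (a : HasseAction D M) (n : ℕ) (x : M) :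
    a.opSum (projCoeff R (p ^ n)) x ∈ a.flat (p ^ n) := by
  intro j h1 h2
  have hz : opStar D (Finsupp.single j 1) (projCoeff R (p ^ n)) = 0 := by
    refine eq_zero_of_opSum_pow ht _ fun s => ?_
    rw [HasseAction.opSum_star, HasseAction.opSum_single, one_smul, opSum_projCoeff_zpow ht]
    split_ifs with h
    · obtain ⟨r, hr⟩ := h
      rw [show D.self.δ j = D.δ j from rfl, ht, hr,
        cast_choose_pow_mul r (not_dvd_of_pos_lt h1 h2), zero_mul]
    · exact map_zero _
  have := a.opSum_star (Finsupp.single j 1) (projCoeff R (p ^ n)) x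
  rw [hz, map_zero, AddMonoidHom.zero_apply, HasseAction.opSum_single, one_smul] at this
  exact this.symm

theorem opSum_decomposition (a : HasseAction D M) (t : Rˣ) (q : ℕ) (x : M) :
    a.opSum (∑ r ∈ range q, opStar D (Finsupp.single 0 ((t ^ (r : ℤ) : Rˣ) : R))
      (opStar D (projCoeff R q) (Finsupp.single 0 ((t ^ (-(r : ℤ)) : Rˣ) : R)))) x =
    ∑ r ∈ range q, ((t ^ (r : ℤ) : Rˣ) : R) •
      a.opSum (projCoeff R q) (((t ^ (-(r : ℤ)) : Rˣ) : R) • x) := by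
  rw [map_sum, AddMonoidHom.finsetSum_apply]
  refine sum_congr rfl fun r _ => ?_
  rw [a.opSum_star, a.opSum_star, a.opSum_single, a.opSum_single, a.δ_zero, a.δ_zero]

/-- The eigenspace decomposition of a stratified module under the operators `δ⁽ʲ⁾`, `j < pⁿ`. -/
theorem eigen_decomposition {t : Rˣ} (ht : IsEigen D t) (a : HasseAction D M) (n : ℕ) (x : M) :
    x = ∑ r ∈ range (p ^ n), ((t ^ (r : ℤ) : Rˣ) : R) •
      a.opSum (projCoeff R (p ^ n)) (((t ^ (-(r : ℤ)) : Rˣ) : R) • x) := by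
  have hq : 0 < p ^ n := pow_pos (Fact.out : p.Prime).pos n
  have hz : (∑ r ∈ range (p ^ n), opStar D (Finsupp.single 0 ((t ^ (r : ℤ) : Rˣ) : R))
      (opStar D (projCoeff R (p ^ n)) (Finsupp.single 0 ((t ^ (-(r : ℤ)) : Rˣ) : R)))) -
      Finsupp.single 0 1 = 0 := by
    refine eq_zero_of_opSum_pow ht _ fun s => ?_
    rw [map_sub, AddMonoidHom.sub_apply, HasseAction.opSum_single, one_smul,
      D.self.δ_zero, opSum_decomposition, sub_eq_zero, sum_eq_single (s % p ^ n)]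
    · have e : (((t ^ (-((s % p ^ n : ℕ) : ℤ)) : Rˣ) : R) • ((t ^ (s : ℤ) : Rˣ) : R)) =
          ((t ^ ((s : ℤ) - ((s % p ^ n : ℕ) : ℤ)) : Rˣ) : R) := by
        rw [smul_eq_mul, ← Units.val_mul, ← zpow_add]; congr 2; ring
      have hd : (p : ℤ) ^ n ∣ (s : ℤ) - ((s % p ^ n : ℕ) : ℤ) := by
        push_cast; exact Int.dvd_self_sub_emod
      rw [e, opSum_projCoeff_zpow ht, if_pos hd, smul_eq_mul, ← Units.val_mul, ← zpow_add]
      congr 2; ring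
    · intro r hr hne
      have e : (((t ^ (-(r : ℤ)) : Rˣ) : R) • ((t ^ (s : ℤ) : Rˣ) : R)) =
          ((t ^ ((s : ℤ) - (r : ℤ)) : Rˣ) : R) := by
        rw [smul_eq_mul, ← Units.val_mul, ← zpow_add]; congr 2; ring
      rw [e, opSum_projCoeff_zpow ht, if_neg, smul_zero]
      intro hd
      apply hne
      have h1 : r ≡ s [MOD p ^ n] := by
        rw [Nat.modEq_iff_dvd]; exact_mod_cast hd
      rw [← Nat.mod_eq_of_lt (mem_range.mp hr)]
      exact h1
    · intro h
      exact absurd (mem_range.mpr (Nat.mod_lt s hq)) h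
  have := opSum_decomposition a t (p ^ n) x
  rw [sub_eq_zero.mp hz, a.opSum_single, one_smul, a.δ_zero] at this
  exact this

end Flat

/-! ### Generators of free modules of rank one -/

section Gen
variable {R : Type*} [CommRing R] {M : Type*} [AddCommGroup M] [Module R M]
  {N : Type*} [AddCommGroup N] [Module R N]

variable (R) in
/-- `e` is a basis of the module `M`, which then is free of rank one. -/
def IsGen (e : M) : Prop := ∀ x : M, ∃! c : R, x = c • e

theorem IsGen.bijective {e : M} (h : IsGen R e) :
    Function.Bijective (LinearMap.toSpanSingleton R M e) := by
  constructor
  · intro c d hcd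
    exact (h (c • e)).unique rfl hcd
  · intro x
    obtain ⟨c, hc, -⟩ := h x
    exact ⟨c, hc.symm⟩

/-- The isomorphism `M ≃ R` given by a basis element. -/
noncomputable def IsGen.equiv {e : M} (h : IsGen R e) : M ≃ₗ[R] R :=
  (LinearEquiv.ofBijective (LinearMap.toSpanSingleton R M e) h.bijective).symm

@[simp] theorem IsGen.equiv_symm_apply {e : M} (h : IsGen R e) (c : R) :
    h.equiv.symm c = c • e := rfl

@[simp] theorem IsGen.equiv_self {e : M} (h : IsGen R e) : h.equiv e = 1 := by
  rw [← LinearEquiv.eq_symm_apply]; simp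

theorem IsGen.of_equiv (f : M ≃ₗ[R] R) {e : M} (h : f e = 1) : IsGen R e := by
  intro x
  refine ⟨f x, f.injective (by simp [h]), ?_⟩
  rintro c rfl
  simp [h]

theorem IsGen.map {e : M} (h : IsGen R e) (f : M ≃ₗ[R] N) : IsGen R (f e) :=
  IsGen.of_equiv (f.symm.trans h.equiv) (by simp)

theorem IsGen.smul_cancel {e : M} (h : IsGen R e) {c d : R} (hcd : c • e = d • e) : c = d :=
  h.bijective.1 hcd

theorem IsGen.smul_eq_zero_iff {e : M} (h : IsGen R e) {c : R} : c • e = 0 ↔ c = 0 :=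
  ⟨fun hc => h.smul_cancel (hc.trans (zero_smul R e).symm), fun hc => by rw [hc, zero_smul]⟩

theorem IsGen.ne_zero [Nontrivial R] {e : M} (h : IsGen R e) : e ≠ 0 := by
  rintro rfl
  exact one_ne_zero (h.smul_cancel (c := (1 : R)) (d := 0) (by simp))

theorem IsGen.units_smul {e : M} (h : IsGen R e) (c : Rˣ) : IsGen R ((c : R) • e) :=
  h.map (LinearEquiv.smulOfUnit c)

theorem IsGen.finrank_eq_one [Nontrivial R] {e : M} (h : IsGen R e) : Module.finrank R M = 1 := by
  rw [h.equiv.finrank_eq, Module.finrank_self]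

theorem IsGen.tmul {e : M} {f : N} (he : IsGen R e) (hf : IsGen R f) :
    IsGen R (e ⊗ₜ[R] f : TensorProduct R M N) :=
  .of_equiv ((TensorProduct.congr he.equiv hf.equiv).trans (TensorProduct.lid R R)) (by simp)

theorem IsGen.baseChange {R' : Type*} [CommRing R'] [Algebra R R'] {e : M} (he : IsGen R e) :
    IsGen R' ((1 : R') ⊗ₜ[R] e : TensorProduct R R' M) :=
  .of_equiv ((he.equiv.baseChange R R' M R).trans (TensorProduct.AlgebraTensorModule.rid R R' R'))
    (by simp)

theorem IsGen.of_span [IsDomain R] [Module.IsTorsionFree R M] {e : M} (h0 : e ≠ 0)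
    (h : ∀ x : M, ∃ c : R, x = c • e) : IsGen R e := by
  intro x
  obtain ⟨c, hc⟩ := h x
  refine ⟨c, hc, fun d hd => ?_⟩
  have : (d - c) • e = 0 := by rw [sub_smul, ← hd, ← hc, sub_self]
  exact sub_eq_zero.mp ((smul_eq_zero.mp this).resolve_right h0)

end Gen

/-! ### Coordinates and frames -/

section Frames
variable {p : ℕ} [Fact p.Prime] {k R : Type u} [Field k] [CommRing R] [Algebra k R] [CharP R p]
  {D : HasseSystem k R}

/-- A coordinate `t` on a ring with operators, with the properties shared by `k[t, t⁻¹]` and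
`k((t))` for perfect `k`. The homomorphism `ord` is the order of vanishing at `t = 0`. -/
structure Coordinate (p : ℕ) [Fact p.Prime] {k R : Type u} [Field k] [CommRing R] [Algebra k R]
    [CharP R p] (D : HasseSystem k R) where
  t : Rˣ
  ord : Rˣ →* Multiplicative ℤ
  ord_t : ord t = .ofAdd 1
  eigen : IsEigen D t
  /-- Functions killed by `δ⁽ʲ⁾` for `0 < j < pⁿ` are `pⁿ`-th powers. -/
  root : ∀ (n : ℕ) (f : R), f ∈ D.self.flat (p ^ n) → f ∈ powSubring p R n
  /-- `R` is a simple module under the differential operators. -/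
  simple : ∀ I : Ideal R, (∀ n, ∀ x ∈ I, D.δ n x ∈ I) → I = ⊥ ∨ I = ⊤
  const : ∀ f : R, (∀ j, 0 < j → D.δ j f = 0) → ∃ c : k, f = algebraMap k R c
  /-- Units of order zero do not contribute to `R¹lim`. -/
  kill : ∀ w : ∀ n, (powSubring p R n)ˣ,
    (∀ n, ord (Units.map (powSubring p R n).subtype.toMonoidHom (w n)) = 1) → rlimMk w = 1

theorem HasseAction.δ_mem_torsion (p : ℕ) [Fact p.Prime] [CharP R p] [IsDomain R] {M : Type*}
    [AddCommGroup M] [Module R M] (a : HasseAction D M) (n : ℕ) {x : M}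
    (hx : x ∈ Submodule.torsion R M) : a.δ n x ∈ Submodule.torsion R M := by
  rw [Submodule.mem_torsion_iff] at hx ⊢
  obtain ⟨f, hf⟩ := hx
  refine ⟨f ^ p ^ n, ?_⟩
  -- `pⁿ`-th powers commute with `δ⁽ⁿ⁾`
  have h1 := a.δ_flat_smul (D.pow_mem_flat (p := p) (f : R) n) x
    (Nat.lt_pow_self (Fact.out : p.Prime).one_lt)
  have h2 : (f : R) ^ p ^ n • x = 0 := by
    rw [← Nat.sub_add_cancel (pow_pos (Fact.out : p.Prime).pos n : 1 ≤ p ^ n), pow_succ, mul_smul]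
    change _ • (f • x) = 0
    rw [hf, smul_zero]
  rw [h2, map_zero] at h1
  exact h1.symm

/-- A stratified bundle has no torsion: the annihilator of the torsion is stable under the
operators. -/
theorem Coordinate.isTorsionFree [IsDomain R] [IsNoetherianRing R] (C : Coordinate p D)
    (E : StratBundle D) : Module.IsTorsionFree R E := by
  rw [Submodule.isTorsionFree_iff_torsion_eq_bot]
  set T := Submodule.torsion R E with hT
  have hst : ∀ n, ∀ f ∈ T.annihilator, D.δ n f ∈ T.annihilator := by
    intro n
    induction n using Nat.strong_induction_on with
    | _ n ih =>
      intro f hf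
      rw [Submodule.mem_annihilator]
      intro x hx
      have h := E.act.δ_smul n f x
      rw [Submodule.mem_annihilator.mp hf x hx, map_zero, sum_eq_single (n, 0)] at h
      · rw [E.act.δ_zero] at h; exact h.symm
      · rintro ⟨i, j⟩ hij hne
        simp only [HasAntidiagonal.mem_antidiagonal] at hij
        have hi : i < n := by
          rcases Nat.eq_zero_or_pos j with rfl | hj
          · exact absurd (by simpa using hij) (by simpa using hne)
          · omega
        exact Submodule.mem_annihilator.mp (ih i hi f hf) _ (E.act.δ_mem_torsion p j hx)
      · intro h; simp at h
  have hfin : Module.Finite R T := inferInstance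
  have htor : Module.IsTorsion R T := Submodule.torsion_isTorsion
  obtain ⟨f, hf, hf0⟩ := Submodule.annihilator_top_inter_nonZeroDivisors htor
  have hfT : f ∈ T.annihilator := by
    rw [Submodule.mem_annihilator]
    intro x hx
    exact congrArg Subtype.val (Submodule.mem_annihilator.mp hf ⟨x, hx⟩ Submodule.mem_top)
  rcases C.simple _ hst with h | h
  · rw [h] at hfT
    exact absurd ((Submodule.mem_bot R).mp hfT) (nonZeroDivisors.ne_zero hf0)
  · rw [eq_bot_iff]
    intro x hx
    have := Submodule.mem_annihilator.mp (h ▸ Submodule.mem_top : (1 : R) ∈ T.annihilator) x hx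
    simpa using this

theorem Coordinate.exists_gen [IsDomain R] [IsPrincipalIdealRing R] (C : Coordinate p D)
    {E : StratBundle D} (hE : rankOne D E) : ∃ e : E, IsGen R e := by
  have := C.isTorsionFree E
  have hfree : Module.Free R E := Module.free_of_finite_type_torsion_free'
  obtain ⟨v, h0, hv⟩ := finrank_eq_one_iff'.mp hE
  exact ⟨v, .of_span h0 fun x => (hv x).imp fun _ h => h.symm⟩

/-- `E` is spanned by its flat elements, so an element which generates these generates `E`. -/
theorem Coordinate.span_flat (C : Coordinate p D) (E : StratBundle D) (n : ℕ) {e : E}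
    (h : ∀ y ∈ E.act.flat (p ^ n), ∃ c : R, y = c • e) (x : E) : ∃ c : R, x = c • e := by
  choose! c hc using fun r : ℕ =>
    h _ (opSum_projCoeff_mem_flat C.eigen E.act n (((C.t ^ (-(r : ℤ)) : Rˣ) : R) • x))
  refine ⟨∑ r ∈ range (p ^ n), ((C.t ^ (r : ℤ) : Rˣ) : R) * c r, ?_⟩
  rw [sum_smul]
  refine (eigen_decomposition C.eigen E.act n x).trans (sum_congr rfl fun r _ => ?_)
  rw [hc, mul_smul]

theorem Coordinate.exists_flat_ne_zero (C : Coordinate p D) (E : StratBundle D) (n : ℕ)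
    (h : ∃ x : E, x ≠ 0) : ∃ y ∈ E.act.flat (p ^ n), y ≠ 0 := by
  by_contra! hc
  obtain ⟨x, hx⟩ := h
  obtain ⟨c, hc⟩ := C.span_flat E n (e := 0) (fun y hy => ⟨0, by rw [hc y hy, zero_smul]⟩) x
  exact hx (by rw [hc, smul_zero])

/-- Cartier descent in rank one: `E` has a basis element killed by `δ⁽ʲ⁾` for `0 < j < pⁿ`. The flat
elements are compared with one of them, `x₀`, in the fraction field; the resulting `pⁿ`-th roots
form an ideal, and a generator of it gives a basis. -/
theorem Coordinate.exists_flat_gen [IsDomain R] [IsPrincipalIdealRing R] (C : Coordinate p D)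
    {E : StratBundle D} (hE : rankOne D E) (n : ℕ) :
    ∃ e ∈ E.act.flat (p ^ n), IsGen R e := by
  have hq : 0 < p ^ n := pow_pos (Fact.out : p.Prime).pos n
  have := C.isTorsionFree E
  obtain ⟨b, hb⟩ := C.exists_gen hE
  obtain ⟨x₀, hx₀, hne⟩ := C.exists_flat_ne_zero E n ⟨b, hb.ne_zero⟩
  obtain ⟨f₀, hf₀, -⟩ := hb x₀
  have hf₀0 : f₀ ≠ 0 := by rintro rfl; exact hne (by rw [hf₀, zero_smul])
  have hroot : ∀ y ∈ E.act.flat (p ^ n), ∃ h : R, h ^ p ^ n • x₀ = f₀ ^ p ^ n • y := by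
    intro y hy
    obtain ⟨g, hg, -⟩ := hb y
    have e : (g * f₀ ^ (p ^ n - 1)) • x₀ = f₀ ^ p ^ n • y := by
      rw [hf₀, hg, smul_smul, smul_smul, mul_assoc, ← pow_succ, Nat.sub_add_cancel hq, mul_comm]
    have hflat : g * f₀ ^ (p ^ n - 1) ∈ D.self.flat (p ^ n) := by
      intro j h1 h2
      have h3 := E.act.smul_mem_flat (D.pow_mem_flat f₀ n) hy j h1 h2
      rw [← e, E.act.δ_smul_flat hx₀ _ h2] at h3
      exact (smul_eq_zero.mp h3).resolve_right hne
    obtain ⟨h, hh⟩ := C.root n _ hflat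
    rw [iterateFrobenius_def] at hh
    exact ⟨h, by rw [hh, e]⟩
  let I : Ideal R :=
    { carrier := {h | ∃ y ∈ E.act.flat (p ^ n), h ^ p ^ n • x₀ = f₀ ^ p ^ n • y}
      zero_mem' := ⟨0, zero_mem _, by rw [zero_pow hq.ne', zero_smul, smul_zero]⟩
      add_mem' := by
        rintro h h' ⟨y, hy, e⟩ ⟨y', hy', e'⟩
        exact ⟨y + y', add_mem hy hy', by rw [add_pow_char_pow, add_smul, e, e', smul_add]⟩
      smul_mem' := by
        rintro r h ⟨y, hy, e⟩
        exact ⟨r ^ p ^ n • y, E.act.smul_mem_flat (D.pow_mem_flat r n) hy, by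
          rw [smul_eq_mul, mul_pow, mul_smul, e, smul_comm]⟩ }
  obtain ⟨h₀, hI⟩ := IsPrincipalIdealRing.principal I
  obtain ⟨e, he, heq⟩ : h₀ ∈ I := hI ▸ Submodule.mem_span_singleton_self h₀
  have hspan : ∀ y ∈ E.act.flat (p ^ n), ∃ c : R, y = c • e := by
    intro y hy
    obtain ⟨h, hh⟩ := hroot y hy
    have hmem : h ∈ I := ⟨y, hy, hh⟩
    rw [hI] at hmem
    obtain ⟨r, rfl⟩ := Submodule.mem_span_singleton.mp hmem
    refine ⟨r ^ p ^ n, ?_⟩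
    rw [smul_eq_mul, mul_pow, mul_smul, heq, smul_comm] at hh
    exact (smul_right_injective E (pow_ne_zero (p ^ n) hf₀0) hh).symm
  refine ⟨e, he, .of_span ?_ (C.span_flat E n hspan)⟩
  rintro rfl
  obtain ⟨c, hc⟩ := hspan x₀ hx₀
  exact hne (by rw [hc, smul_zero])

/-- Two flat basis elements differ by a unit of `R^{p^n}`. -/
theorem Coordinate.flat_gen_ratio (C : Coordinate p D) {M : Type*} [AddCommGroup M] [Module R M]
    (a : HasseAction D M) {n : ℕ} {e e' : M} (h : e ∈ a.flat (p ^ n)) (hg : IsGen R e)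
    (h' : e' ∈ a.flat (p ^ n)) (hg' : IsGen R e') :
    ∃ g : (powSubring p R n)ˣ, e' = ((g : powSubring p R n) : R) • e := by
  have key : ∀ {e e' : M}, e ∈ a.flat (p ^ n) → IsGen R e → e' ∈ a.flat (p ^ n) →
      ∃ c : powSubring p R n, e' = (c : R) • e := by
    intro e e' h hg h'
    obtain ⟨c, hc, -⟩ := hg e'
    refine ⟨⟨c, C.root n c fun j h1 h2 => ?_⟩, hc⟩
    have := h' j h1 h2
    rw [hc, a.δ_smul_flat h _ h2] at this
    exact hg.smul_eq_zero_iff.mp this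
  obtain ⟨c, hc⟩ := key h hg h'
  obtain ⟨d, hd⟩ := key h' hg' h
  have h1 : (c : R) * d = 1 := hg'.smul_cancel (by rw [mul_smul, ← hd, ← hc, one_smul])
  exact ⟨⟨c, d, Subtype.ext h1, Subtype.ext (by rw [mul_comm] at h1; exact h1)⟩, hc⟩

/-- `e` is a sequence of bases of `E`, with `e_n` killed by `δ⁽ʲ⁾` for `0 < j < pⁿ` and with
transition units `u`. -/
structure IsFrameSeq (E : StratBundle D) (u : ∀ n, (powSubring p R n)ˣ) (e : ℕ → E) : Prop where
  flat : ∀ n, e n ∈ E.act.flat (p ^ n)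
  gen : ∀ n, IsGen R (e n)
  step : ∀ n, e n = ((u n : powSubring p R n) : R) • e (n + 1)

/-- The sequence of units `u` is the sequence of transition units of a sequence of bases of `E`. -/
def HasFrames (E : StratBundle D) (u : ∀ n, (powSubring p R n)ˣ) : Prop :=
  ∃ e : ℕ → E, IsFrameSeq E u e

theorem HasFrames.rankOne [Nontrivial R] {E : StratBundle D} {u : ∀ n, (powSubring p R n)ˣ}
    (h : HasFrames E u) : rankOne D E := by
  obtain ⟨e, he⟩ := h
  exact (he.gen 0).finrank_eq_one

theorem Coordinate.exists_hasFrames [IsDomain R] [IsPrincipalIdealRing R] (C : Coordinate p D)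
    {E : StratBundle D} (hE : StratBundle.rankOne D E) :
    ∃ u : ∀ n, (powSubring p R n)ˣ, HasFrames E u := by
  choose e he hg using C.exists_flat_gen hE
  have hmono : ∀ n, p ^ n ≤ p ^ (n + 1) := fun n =>
    Nat.pow_le_pow_right (Fact.out : p.Prime).pos (Nat.le_succ n)
  choose u hu using fun n => C.flat_gen_ratio E.act (E.act.flat_anti (hmono n) (he (n + 1)))
    (hg (n + 1)) (he n) (hg n)
  exact ⟨u, e, he, hg, hu⟩

theorem Coordinate.isDescribedBy_iff [IsDomain R] [IsPrincipalIdealRing R] (C : Coordinate p D)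
    {E : StratBundle D} (hE : StratBundle.rankOne D E) (u : ∀ n, (powSubring p R n)ˣ) :
    E.IsDescribedBy u ↔ HasFrames E u := by
  have hlev : ∀ n x, x ∈ E.level p n ↔ x ∈ E.act.flat (p ^ n) := fun n x =>
    (E.act.mem_flat_iff_level n x).symm
  constructor
  · rintro ⟨e, h1, h2, h3⟩
    have := C.isTorsionFree E
    obtain ⟨b, hb⟩ := C.exists_gen hE
    refine ⟨e, fun n => (hlev n _).mp (h1 n), fun n => .of_span ?_ ?_, h3⟩
    · intro h0
      obtain ⟨y, hy, hy0⟩ := C.exists_flat_ne_zero E n ⟨b, hb.ne_zero⟩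
      obtain ⟨c, hc, -⟩ := h2 n y ((hlev n y).mpr hy)
      exact hy0 (by rw [hc, h0, smul_zero])
    · refine C.span_flat E n fun y hy => ?_
      obtain ⟨c, hc, -⟩ := h2 n y ((hlev n y).mpr hy)
      exact ⟨c, hc⟩
  · rintro ⟨e, h1, h2, h3⟩
    refine ⟨e, fun n => (hlev n _).mpr (h1 n), fun n x hx => ?_, h3⟩
    obtain ⟨c, hc, huniq⟩ := h2 n x
    have hx' := (hlev n x).mp hx
    refine ⟨⟨c, C.root n c fun j hj1 hj2 => ?_⟩, hc, fun d hd => Subtype.ext (huniq d hd)⟩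
    have := hx' j hj1 hj2
    rw [hc, E.act.δ_smul_flat (h1 n) _ hj2] at this
    exact (h2 n).smul_eq_zero_iff.mp this

theorem coe_rlimShift (g : ∀ n, (powSubring p R n)ˣ) (n : ℕ) :
    ((rlimShift (fun n => (powSubring p R n)ˣ)
      (fun n => Units.map (Subring.inclusion (powSubring_succ_le p R n)).toMonoidHom) g n :
        (powSubring p R n)ˣ) : R) * ((g (n + 1) : powSubring p R (n + 1)) : R) =
      ((g n : powSubring p R n) : R) := by
  have : ((g (n + 1) : powSubring p R (n + 1)) : R) =
      (((Units.map (Subring.inclusion (powSubring_succ_le p R n)).toMonoidHom (g (n + 1)) :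
        (powSubring p R n)ˣ) : powSubring p R n) : R) := rfl
  rw [this, ← Subring.coe_mul, ← Units.val_mul]
  simp only [rlimShift, MonoidHom.coe_mk, OneHom.coe_mk, inv_mul_cancel_right]

theorem rlimMk_eq_iff (u v : ∀ n, (powSubring p R n)ˣ) :
    rlimMk u = rlimMk v ↔ ∃ g : ∀ n, (powSubring p R n)ˣ, ∀ n,
      ((u n : powSubring p R n) : R) * ((g n : powSubring p R n) : R) =
        ((v n : powSubring p R n) : R) * ((g (n + 1) : powSubring p R (n + 1)) : R) := by
  rw [rlimMk, rlimMk, QuotientGroup.eq, MonoidHom.mem_range]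
  refine exists_congr fun g => ?_
  rw [funext_iff]
  refine forall_congr' fun n => ?_
  rw [Pi.mul_apply, Pi.inv_apply, eq_inv_mul_iff_mul_eq, Units.ext_iff, Subtype.ext_iff,
    ← (Units.map (powSubring p R n).subtype.toMonoidHom
      (Units.map (Subring.inclusion (powSubring_succ_le p R n)).toMonoidHom (g (n + 1)))).mul_left_inj]
  have := coe_rlimShift g n
  rw [← this, Units.val_mul, Subring.coe_mul, ← mul_assoc]
  rfl

theorem HasFrames.iff_rlimMk_eq (C : Coordinate p D) {E : StratBundle D}
    {u : ∀ n, (powSubring p R n)ˣ} (h : HasFrames E u) (v : ∀ n, (powSubring p R n)ˣ) :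
    HasFrames E v ↔ rlimMk u = rlimMk v := by
  obtain ⟨e, he⟩ := h
  rw [rlimMk_eq_iff]
  constructor
  · rintro ⟨e', he'⟩
    choose g hg using fun n =>
      C.flat_gen_ratio E.act (he.flat n) (he.gen n) (he'.flat n) (he'.gen n)
    refine ⟨g, fun n => (he.gen (n + 1)).smul_cancel ?_⟩
    rw [mul_comm, mul_smul, ← he.step, ← hg, mul_smul, ← hg, ← he'.step]
  · rintro ⟨g, hg⟩
    refine ⟨fun n => ((g n : powSubring p R n) : R) • e n, fun n =>
      E.act.smul_mem_flat (D.powSubring_mem_flat (g n : powSubring p R n).2) (he.flat n),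
      fun n => (he.gen n).units_smul (Units.map (powSubring p R n).subtype.toMonoidHom (g n)),
      fun n => ?_⟩
    rw [smul_smul, ← hg, mul_comm, mul_smul, ← he.step]

/-- An isomorphism of stratified bundles from a linear one. -/
def isoOfLinearEquiv {E F : StratBundle D} (φ : E ≃ₗ[R] F)
    (h : ∀ n x, φ (E.act.δ n x) = F.act.δ n (φ x)) : E ≅ F where
  hom := ⟨φ, h⟩
  inv := ⟨φ.symm, fun n x => by
    rw [LinearEquiv.coe_coe, LinearEquiv.symm_apply_eq, h, LinearEquiv.apply_symm_apply]⟩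
  hom_inv_id := StratBundle.hom_ext (LinearMap.ext fun x => φ.symm_apply_apply x)
  inv_hom_id := StratBundle.hom_ext (LinearMap.ext fun x => φ.apply_symm_apply x)

/-- The linear equivalence underlying an isomorphism. -/
def linearEquivOfIso {E F : StratBundle D} (i : E ≅ F) : E ≃ₗ[R] F :=
  LinearEquiv.ofLinearMap i.hom.lin i.inv.lin
    (by rw [← StratBundle.comp_lin, i.inv_hom_id, StratBundle.id_lin])
    (by rw [← StratBundle.comp_lin, i.hom_inv_id, StratBundle.id_lin])

/-- The linear map with `e_0 ↦ f_0` maps `e_n ↦ f_n` for all `n`, and commutes with `δ⁽ʲ⁾` for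
`j < pⁿ` since `e_n` and `f_n` are killed by `δ⁽ⁱ⁾` for `0 < i < pⁿ`. -/
theorem HasFrames.nonempty_iso {E F : StratBundle D} {u : ∀ n, (powSubring p R n)ˣ}
    (hE : HasFrames E u) (hF : HasFrames F u) : Nonempty (E ≅ F) := by
  obtain ⟨e, he⟩ := hE
  obtain ⟨f, hf⟩ := hF
  set φ : E ≃ₗ[R] F := (he.gen 0).equiv.trans (hf.gen 0).equiv.symm with hφ
  have hn : ∀ n, φ (e n) = f n := by
    intro n
    induction n with
    | zero => simp [hφ]
    | succ n ih =>
      rw [he.step, hf.step, map_smul] at ih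
      have hu : IsUnit ((u n : powSubring p R n) : R) :=
        (Units.map (powSubring p R n).subtype.toMonoidHom (u n)).isUnit
      exact hu.smul_left_cancel.mp ih
  refine ⟨isoOfLinearEquiv φ fun n x => ?_⟩
  have hlt : n < p ^ n := Nat.lt_pow_self (Fact.out : p.Prime).one_lt
  obtain ⟨c, rfl, -⟩ := he.gen n x
  rw [E.act.δ_smul_flat (he.flat n) _ hlt, map_smul, map_smul, hn,
    F.act.δ_smul_flat (hf.flat n) _ hlt]

theorem HasFrames.of_iso {E F : StratBundle D} (i : E ≅ F) {u : ∀ n, (powSubring p R n)ˣ}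
    (h : HasFrames E u) : HasFrames F u := by
  obtain ⟨e, he⟩ := h
  refine ⟨fun n => linearEquivOfIso i (e n), fun n j h1 h2 => ?_,
    fun n => (he.gen n).map (linearEquivOfIso i), fun n => ?_⟩
  · have := i.hom.comm j (e n)
    rw [he.flat n j h1 h2, map_zero] at this
    exact this.symm
  · rw [← map_smul, ← he.step]

theorem HasFrames.tensor {E F : StratBundle D} {u v : ∀ n, (powSubring p R n)ˣ}
    (hE : HasFrames E u) (hF : HasFrames F v) : HasFrames (tensor E F) (u * v) := by
  obtain ⟨e, he⟩ := hE
  obtain ⟨f, hf⟩ := hF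
  refine ⟨fun n => (e n ⊗ₜ[R] f n : TensorProduct R E F),
    fun n => E.act.tmul_mem_flat F.act (he.flat n) (hf.flat n),
    fun n => (he.gen n).tmul (hf.gen n), fun n => ?_⟩
  have : e n ⊗ₜ[R] f n = (((u n : powSubring p R n) : R) * ((v n : powSubring p R n) : R)) •
      (e (n + 1) ⊗ₜ[R] f (n + 1)) := by
    conv_lhs => rw [he.step, hf.step, TensorProduct.smul_tmul_smul]
  exact this

theorem HasFrames.invCoord {E : StratBundle D} {u : ∀ n, (powSubring p R n)ˣ}
    (h : HasFrames E u) : HasFrames (invCoord.obj E) u := by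
  obtain ⟨e, he⟩ := h
  exact ⟨e, fun n => E.act.flat_le_flat_inv _ (he.flat n), he.gen, he.step⟩

theorem HasFrames.baseChange {R' : Type u} [CommRing R'] [Algebra k R'] [CharP R' p]
    {D' : HasseSystem k R'} (φ : R →ₐ[k] R') (hφ : ∀ n f, D'.δ n (φ f) = φ (D.δ n f))
    {E : StratBundle D} {u : ∀ n, (powSubring p R n)ˣ} (h : HasFrames E u) :
    HasFrames ((StratBundle.baseChange φ hφ).obj E) (unitsPiMap (φ : R →+* R') u) := by
  obtain ⟨e, he⟩ := h
  let _ := φ.toRingHom.toAlgebra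
  refine ⟨fun n => ((1 : R') ⊗ₜ[R] e n : TensorProduct R R' E), fun n j h1 h2 => ?_,
    fun n => (he.gen n).baseChange, fun n => ?_⟩
  · change (restrictSelf hφ).tensorδ E.act j _ = 0
    rw [HasseAction.tensorδ_tmul]
    refine sum_eq_zero ?_
    rintro ⟨i, l⟩ h
    simp only [HasAntidiagonal.mem_antidiagonal] at h
    rcases Nat.eq_zero_or_pos l with rfl | hl
    · have : (restrictSelf hφ).δ i (1 : R') = 0 := D'.δ_one i (by omega)
      rw [this, TensorProduct.zero_tmul]
    · rw [he.flat n l hl (by omega), TensorProduct.tmul_zero]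
  · have : (1 : R') ⊗ₜ[R] e n =
        φ ((u n : powSubring p R n) : R) • ((1 : R') ⊗ₜ[R] e (n + 1)) := by
      conv_lhs => rw [he.step, ← TensorProduct.smul_tmul]
      rw [TensorProduct.smul_tmul', Algebra.smul_def, mul_one, smul_eq_mul, mul_one]
      rfl
    exact this

end Frames

/-! ### Convergent sums of integers in `ℤ_p` -/

section Padic
variable {p : ℕ} [Fact p.Prime]

theorem norm_intCast_le {b : ℕ → ℤ} (hb : ∀ n, (p : ℤ) ^ n ∣ b n) (n : ℕ) :
    ‖(b n : ℤ_[p])‖ ≤ ((p : ℝ)⁻¹) ^ n := by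
  rw [inv_pow, ← zpow_natCast, ← zpow_neg, PadicInt.norm_int_le_pow_iff_dvd]
  exact_mod_cast hb n

theorem summable_intCast {b : ℕ → ℤ} (hb : ∀ n, (p : ℤ) ^ n ∣ b n) :
    Summable fun n => (b n : ℤ_[p]) := by
  have hp := (Fact.out : p.Prime).one_lt
  refine .of_norm_bounded (g := fun n => ((p : ℝ)⁻¹) ^ n)
    (summable_geometric_of_lt_one (by positivity) ?_) (norm_intCast_le hb)
  exact inv_lt_one_of_one_lt₀ (by exact_mod_cast hp)

theorem tendsto_intCast_zero {b : ℕ → ℤ} (hb : ∀ n, (p : ℤ) ^ n ∣ b n) :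
    Filter.Tendsto (fun n => (b n : ℤ_[p])) Filter.atTop (nhds 0) :=
  (summable_intCast hb).tendsto_atTop_zero

theorem exists_eq_sum_add_pow_mul {b : ℕ → ℤ} (hb : ∀ n, (p : ℤ) ^ n ∣ b n) {α : ℤ_[p]}
    (h : HasSum (fun n => (b n : ℤ_[p])) α) (n : ℕ) :
    ∃ β : ℤ_[p], α = ((∑ i ∈ range n, b i : ℤ) : ℤ_[p]) + (p : ℤ_[p]) ^ n * β := by
  have hmem : ‖α - ((∑ i ∈ range n, b i : ℤ) : ℤ_[p])‖ ≤ (p : ℝ) ^ (-(n : ℤ)) := by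
    have ht : Filter.Tendsto (fun N => ‖∑ i ∈ range N, (b i : ℤ_[p]) -
        ((∑ i ∈ range n, b i : ℤ) : ℤ_[p])‖) Filter.atTop
        (nhds ‖α - ((∑ i ∈ range n, b i : ℤ) : ℤ_[p])‖) :=
      (h.tendsto_sum_nat.sub_const _).norm
    refine le_of_tendsto ht (Filter.eventually_atTop.mpr ⟨n, fun N hN => ?_⟩)
    rw [← Int.cast_sum, ← Int.cast_sub, PadicInt.norm_int_le_pow_iff_dvd,
      ← sum_range_add_sum_Ico _ hN, add_sub_cancel_left]
    refine dvd_sum fun i hi => (pow_dvd_pow _ (mem_Ico.mp hi).1).trans (hb i)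
  obtain ⟨β, hβ⟩ := Ideal.mem_span_singleton'.mp ((PadicInt.norm_le_pow_iff_mem_span_pow _ _).mp hmem)
  exact ⟨β, by rw [mul_comm, hβ]; ring⟩

theorem exists_digits (α : ℤ_[p]) : ∃ a : ℕ → ℕ,
    HasSum (fun n => (a n : ℤ_[p]) * (p : ℤ_[p]) ^ n) α := by
  have hd : ∀ n, p ^ n ∣ α.appr (n + 1) - α.appr n := fun n =>
    PadicInt.dvd_appr_sub_appr α n (n + 1) (Nat.le_succ n)
  choose a ha using hd
  refine ⟨a, ?_⟩
  have hs : Summable fun n => (a n : ℤ_[p]) * (p : ℤ_[p]) ^ n := by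
    have := summable_intCast (p := p) (b := fun n => (a n : ℤ) * (p : ℤ) ^ n)
      fun n => Dvd.intro_left _ rfl
    simpa using this
  have hsum : ∀ n, ∑ i ∈ range n, (a i : ℤ_[p]) * (p : ℤ_[p]) ^ i = (α.appr n : ℤ_[p]) := by
    intro n
    induction n with
    | zero => simp [PadicInt.appr]
    | succ n ih =>
      have hle : α.appr n ≤ α.appr (n + 1) := PadicInt.appr_mono α (Nat.le_succ n)
      rw [sum_range_succ, ih, ← Nat.sub_add_cancel hle, ha]
      push_cast
      ring
  have ht : Filter.Tendsto (fun n => (α.appr n : ℤ_[p])) Filter.atTop (nhds α) := by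
    have hp := (Fact.out : p.Prime).one_lt
    rw [tendsto_iff_norm_sub_tendsto_zero]
    refine squeeze_zero (g := fun n => ((p : ℝ)⁻¹) ^ n) (fun _ => norm_nonneg _) (fun n => ?_)
      (tendsto_pow_atTop_nhds_zero_of_lt_one (by positivity)
        (inv_lt_one_of_one_lt₀ (by exact_mod_cast hp)))
    rw [norm_sub_rev, inv_pow, ← zpow_natCast, ← zpow_neg, PadicInt.norm_le_pow_iff_mem_span_pow]
    exact PadicInt.appr_spec n α
  have := hs.hasSum.tendsto_sum_nat
  simp only [hsum] at this
  rw [← tendsto_nhds_unique this ht]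
  exact hs.hasSum

theorem coe_eq_coe_iff (α β : ℤ_[p]) :
    (α : ZpModZ p) = (β : ZpModZ p) ↔ ∃ m : ℤ, α - β = m := by
  rw [QuotientAddGroup.eq, AddMonoidHom.mem_range]
  constructor
  · rintro ⟨m, hm⟩
    have hm' : (m : ℤ_[p]) = -α + β := hm
    exact ⟨-m, by push_cast; rw [hm']; ring⟩
  · rintro ⟨m, hm⟩
    refine ⟨-m, ?_⟩
    change ((-m : ℤ) : ℤ_[p]) = -α + β
    push_cast
    rw [← hm]; ring

end Padic

/-! ### The isomorphism of `R¹lim` with `ℤ_p / ℤ` -/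

section Psi
variable {p : ℕ} [Fact p.Prime] {k R : Type u} [Field k] [CommRing R] [Algebra k R] [CharP R p]
  {D : HasseSystem k R}

/-- The order of a unit of `R^{p^n}`. -/
def Coordinate.ordAt (C : Coordinate p D) (n : ℕ) (u : (powSubring p R n)ˣ) : ℤ :=
  (C.ord (Units.map (powSubring p R n).subtype.toMonoidHom u)).toAdd

theorem Coordinate.ordAt_mul (C : Coordinate p D) (n : ℕ) (u v : (powSubring p R n)ˣ) :
    C.ordAt n (u * v) = C.ordAt n u + C.ordAt n v := by
  simp [ordAt]

theorem Coordinate.ordAt_one (C : Coordinate p D) (n : ℕ) :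
    C.ordAt n (1 : (powSubring p R n)ˣ) = 0 := by
  simp [ordAt]

theorem Coordinate.ordAt_inv (C : Coordinate p D) (n : ℕ) (u : (powSubring p R n)ˣ) :
    C.ordAt n u⁻¹ = -C.ordAt n u := by
  simp [ordAt]

theorem exists_root_unit (n : ℕ) (u : (powSubring p R n)ˣ) :
    ∃ g : Rˣ, Units.map (powSubring p R n).subtype.toMonoidHom u = g ^ p ^ n := by
  obtain ⟨x, hx⟩ := (u : powSubring p R n).2
  rw [iterateFrobenius_def] at hx
  have hq : p ^ n ≠ 0 := pow_ne_zero n (Fact.out : p.Prime).ne_zero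
  have hu : IsUnit (x ^ p ^ n) := by
    rw [hx]; exact (Units.map (powSubring p R n).subtype.toMonoidHom u).isUnit
  obtain ⟨g, rfl⟩ := (isUnit_pow_iff hq).mp hu
  exact ⟨g, Units.ext hx.symm⟩

theorem Coordinate.pow_dvd_ordAt (C : Coordinate p D) (n : ℕ) (u : (powSubring p R n)ˣ) :
    (p : ℤ) ^ n ∣ C.ordAt n u := by
  obtain ⟨g, hg⟩ := exists_root_unit n u
  refine ⟨(C.ord g).toAdd, ?_⟩
  rw [ordAt, hg, map_pow]; simp

/-- The coboundary map `(g_n) ↦ (g_n g_{n+1}⁻¹)` of the system `𝔾_m(R^{p^n})`. -/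
abbrev shiftHom (p : ℕ) [Fact p.Prime] (R : Type u) [CommRing R] [CharP R p] :
    (∀ n, (powSubring p R n)ˣ) →* (∀ n, (powSubring p R n)ˣ) :=
  rlimShift (fun n => (powSubring p R n)ˣ)
    (fun n => Units.map (Subring.inclusion (powSubring_succ_le p R n)).toMonoidHom)

theorem Coordinate.ordAt_shift (C : Coordinate p D) (g : ∀ n, (powSubring p R n)ˣ) (n : ℕ) :
    C.ordAt n (shiftHom p R g n) = C.ordAt n (g n) - C.ordAt (n + 1) (g (n + 1)) := by
  rw [sub_eq_add_neg]
  exact (C.ordAt_mul n _ _).trans (congrArg _ (C.ordAt_inv n _))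

theorem rlimMk_shift (g : ∀ n, (powSubring p R n)ˣ) : rlimMk (shiftHom p R g) = 1 :=
  (QuotientGroup.eq_one_iff _).mpr ⟨g, rfl⟩

theorem rlimMk_mul (u v : ∀ n, (powSubring p R n)ˣ) : rlimMk (u * v) = rlimMk u * rlimMk v := rfl

theorem rlimMk_one : rlimMk (1 : ∀ n, (powSubring p R n)ˣ) = 1 := rfl

theorem rlimMk_surjective (x : RlimGm p R) : ∃ u, rlimMk u = x := QuotientGroup.mk_surjective x

/-- `(u_n) ↦ ∑ ord u_n ∈ ℤ_p`. -/
noncomputable def Coordinate.ordSum (C : Coordinate p D) :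
    (∀ n, (powSubring p R n)ˣ) →* Multiplicative ℤ_[p] where
  toFun u := .ofAdd (∑' n, (C.ordAt n (u n) : ℤ_[p]))
  map_one' := by simp [C.ordAt_one]
  map_mul' u v := by
    rw [← ofAdd_add, ← Summable.tsum_add (summable_intCast fun n => C.pow_dvd_ordAt n (u n))
      (summable_intCast fun n => C.pow_dvd_ordAt n (v n))]
    simp [C.ordAt_mul]

theorem Coordinate.ordSum_shift (C : Coordinate p D) (g : ∀ n, (powSubring p R n)ˣ) :
    C.ordSum (shiftHom p R g) = .ofAdd (C.ordAt 0 (g 0) : ℤ_[p]) := by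
  refine congrArg Multiplicative.ofAdd ?_
  have h1 := (summable_intCast (p := p)
    fun n => C.pow_dvd_ordAt n (shiftHom p R g n)).hasSum.tendsto_sum_nat
  have h2 : ∀ N, ∑ n ∈ range N, (C.ordAt n (shiftHom p R g n) : ℤ_[p]) =
      (C.ordAt 0 (g 0) : ℤ_[p]) - (C.ordAt N (g N) : ℤ_[p]) := by
    intro N
    induction N with
    | zero => simp
    | succ N ih => rw [sum_range_succ, ih, C.ordAt_shift]; push_cast; ring
  simp only [h2] at h1
  have h3 := (tendsto_intCast_zero (p := p) fun n => C.pow_dvd_ordAt n (g n)).const_sub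
    (C.ordAt 0 (g 0) : ℤ_[p])
  rw [sub_zero] at h3
  exact tendsto_nhds_unique h1 h3

/-- The homomorphism `R¹lim → ℤ_p / ℤ` induced by `(u_n) ↦ ∑ ord u_n`. -/
noncomputable def Coordinate.psiHom (C : Coordinate p D) :
    RlimGm p R →* Multiplicative (ZpModZ p) :=
  QuotientGroup.lift _
    ((AddMonoidHom.toMultiplicative (QuotientAddGroup.mk' (Int.castAddHom ℤ_[p]).range)).comp
      C.ordSum) (by
    rintro _ ⟨g, rfl⟩
    refine MonoidHom.mem_ker.mpr ((congrArg _ (C.ordSum_shift g)).trans ?_)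
    refine congrArg Multiplicative.ofAdd ?_
    exact (QuotientAddGroup.eq_zero_iff _).mpr ⟨C.ordAt 0 (g 0), rfl⟩)

theorem Coordinate.psiHom_mk (C : Coordinate p D) (u : ∀ n, (powSubring p R n)ˣ) :
    C.psiHom (rlimMk u) = .ofAdd ((∑' n, (C.ordAt n (u n) : ℤ_[p]) : ℤ_[p]) : ZpModZ p) := rfl

theorem Coordinate.ordAt_powSeq (C : Coordinate p D) (a : ℕ → ℕ) (n : ℕ) :
    C.ordAt n (powSeq C.t a n) = a n * (p : ℤ) ^ n := by
  have : Units.map (powSubring p R n).subtype.toMonoidHom (powSeq C.t a n) = C.t ^ (a n * p ^ n) :=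
    Units.ext (powSeq_coe C.t a n)
  rw [ordAt, this, map_pow, C.ord_t]; simp

theorem Coordinate.psiHom_powSeq (C : Coordinate p D) {a : ℕ → ℕ} {α : ℤ_[p]}
    (h : HasSum (fun n => (a n : ℤ_[p]) * (p : ℤ_[p]) ^ n) α) :
    C.psiHom (rlimMk (powSeq C.t a)) = .ofAdd (α : ZpModZ p) := by
  rw [C.psiHom_mk, ← h.tsum_eq]
  simp [C.ordAt_powSeq]

/-- The unit `t ^ (c p^n)` of `R^{p^n}`. -/
def Coordinate.powUnit (C : Coordinate p D) (n : ℕ) (c : ℤ) : (powSubring p R n)ˣ :=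
  Units.map (iterateFrobenius R p n).rangeRestrict.toMonoidHom (C.t ^ c)

theorem Coordinate.ordAt_powUnit (C : Coordinate p D) (n : ℕ) (c : ℤ) :
    C.ordAt n (C.powUnit n c) = (p : ℤ) ^ n * c := by
  have : Units.map (powSubring p R n).subtype.toMonoidHom (C.powUnit n c) = (C.t ^ c) ^ p ^ n :=
    Units.ext (iterateFrobenius_def (R := R) p n _)
  rw [ordAt, this, map_pow, map_zpow, C.ord_t]; simp

/-- If `∑ ord u_n` is an integer `m`, then the exponents `m - ∑_{i < n} ord u_i` are divisible by
`p^n`, and `u` differs from the coboundary of the corresponding powers of `t` by units of order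
zero. -/
theorem Coordinate.psiHom_injective (C : Coordinate p D) : Function.Injective C.psiHom := by
  rw [injective_iff_map_eq_one]
  intro x hx
  obtain ⟨u, rfl⟩ := rlimMk_surjective x
  rw [C.psiHom_mk] at hx
  obtain ⟨m, hm'⟩ := (QuotientAddGroup.eq_zero_iff _).mp (Multiplicative.ofAdd.injective hx)
  have hm : (m : ℤ_[p]) = ∑' n, (C.ordAt n (u n) : ℤ_[p]) := hm'
  have hb : ∀ n, (p : ℤ) ^ n ∣ C.ordAt n (u n) := fun n => C.pow_dvd_ordAt n (u n)
  have hdvd : ∀ n, (p : ℤ) ^ n ∣ m - ∑ i ∈ range n, C.ordAt i (u i) := by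
    intro n
    obtain ⟨β, hβ⟩ := exists_eq_sum_add_pow_mul hb (hm ▸ (summable_intCast hb).hasSum) n
    rw [← PadicInt.pow_p_dvd_int_iff]
    exact ⟨β, by push_cast; rw [hβ]; push_cast; ring⟩
  choose c hc using hdvd
  set g : ∀ n, (powSubring p R n)ˣ := fun n => C.powUnit n (c n) with hg
  have hord : ∀ n, C.ordAt n (g n) = m - ∑ i ∈ range n, C.ordAt i (u i) := fun n => by
    rw [hg, C.ordAt_powUnit, hc]
  have hk : rlimMk (u * (shiftHom p R g)⁻¹) = 1 := by
    refine C.kill _ fun n => Multiplicative.toAdd.injective ?_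
    change C.ordAt n (u n * (shiftHom p R g n)⁻¹) = 0
    rw [C.ordAt_mul, C.ordAt_inv, C.ordAt_shift, hord, hord, sum_range_succ]
    ring
  have he : u = u * (shiftHom p R g)⁻¹ * shiftHom p R g := by group
  rw [he, rlimMk_mul, hk, rlimMk_shift]
  exact one_mul (1 : RlimGm p R)

theorem Coordinate.psiHom_surjective (C : Coordinate p D) : Function.Surjective C.psiHom := by
  intro x
  obtain ⟨α, hα⟩ := QuotientAddGroup.mk_surjective x.toAdd
  obtain ⟨a, ha⟩ := exists_digits α
  exact ⟨rlimMk (powSeq C.t a), by rw [C.psiHom_powSeq ha, hα]; rfl⟩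

/-- `R¹lim_n 𝔾_m(R^{p^n}) ≅ ℤ_p / ℤ`. -/
noncomputable def Coordinate.psi (C : Coordinate p D) : RlimGm p R ≃* Multiplicative (ZpModZ p) :=
  MulEquiv.ofBijective C.psiHom ⟨C.psiHom_injective, C.psiHom_surjective⟩

theorem Coordinate.psi_apply (C : Coordinate p D) (x : RlimGm p R) : C.psi x = C.psiHom x := rfl

/-- A ring homomorphism which multiplies orders by `ε` acts by `ε` on `ℤ_p / ℤ`. -/
theorem Coordinate.psi_rlimMap (C : Coordinate p D) {R' : Type u} [CommRing R'] [Algebra k R']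
    [CharP R' p] {D' : HasseSystem k R'} (C' : Coordinate p D') (φ : R →+* R') (ε : ℤ)
    (h : ∀ u : Rˣ, (C'.ord (Units.map φ.toMonoidHom u)).toAdd = ε * (C.ord u).toAdd)
    (x : RlimGm p R) : C'.psi (rlimMap φ x) = C.psi x ^ ε := by
  obtain ⟨u, rfl⟩ := rlimMk_surjective x
  have e : rlimMap φ (rlimMk u) = rlimMk (unitsPiMap φ u) := rfl
  have h' : ∀ n, C'.ordAt n (unitsPiMap φ u n) = ε * C.ordAt n (u n) := fun n =>
    h (Units.map (powSubring p R n).subtype.toMonoidHom (u n))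
  rw [e, C'.psi_apply, C.psi_apply, C'.psiHom_mk, C.psiHom_mk, ← ofAdd_zsmul]
  refine congrArg Multiplicative.ofAdd ?_
  rw [← QuotientAddGroup.mk_zsmul, zsmul_eq_mul,
    ← (summable_intCast fun n => C.pow_dvd_ordAt n (u n)).tsum_mul_left]
  simp [h']

end Psi

/-! ### The classification of bundles of rank one -/

section Pic
variable {p : ℕ} [Fact p.Prime] {k R : Type u} [Field k] [CommRing R] [Algebra k R] [CharP R p]
  {D : HasseSystem k R}

theorem isGen_one : IsGen R (1 : R) := .of_equiv (LinearEquiv.refl R R) rfl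

theorem hasFrames_trivial :
    HasFrames (StratBundle.trivial D) (1 : ∀ n, (powSubring p R n)ˣ) :=
  ⟨fun _ => (1 : R), fun _ j h1 _ => D.δ_one j h1.ne', fun _ => isGen_one,
    fun _ => (one_smul R (1 : R)).symm⟩

theorem Coordinate.lineAction_zpow [CharP k p] (C : Coordinate p D) (α : ℤ_[p]) (n : ℕ) (r : ℤ) :
    (lineAction D α).δ n ((C.t ^ r : Rˣ) : R) =
      algebraMap k R (binom k ((r : ℤ_[p]) + α) n) * ((C.t ^ r : Rˣ) : R) := by
  have h := (lineAction D α).δ_smul n ((C.t ^ r : Rˣ) : R) 1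
  rw [smul_eq_mul, mul_one] at h
  rw [h, binom_add, map_sum, sum_mul]
  refine sum_congr rfl fun q _ => ?_
  rw [lineAction_one, C.eigen, smul_eq_mul, binom_intCast, map_mul, map_intCast]
  ring

/-- The basis elements `t ^ (-∑_{i < n} a_i p^i)` of `O_R(α)`. -/
theorem Coordinate.hasFrames_line [CharP k p] (C : Coordinate p D) {a : ℕ → ℕ} {α : ℤ_[p]}
    (h : HasSum (fun n => (a n : ℤ_[p]) * (p : ℤ_[p]) ^ n) α) :
    HasFrames (line D α) (powSeq C.t a) := by
  set b : ℕ → ℤ := fun n => (a n : ℤ) * (p : ℤ) ^ n with hb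
  refine ⟨fun n => ((C.t ^ (-∑ i ∈ range n, b i) : Rˣ) : R), fun n j h1 h2 => ?_, fun n => ?_,
    fun n => ?_⟩
  · obtain ⟨β, hβ⟩ := exists_eq_sum_add_pow_mul (b := b) (fun n => Dvd.intro_left _ rfl)
      (by simpa [hb] using h) n
    have e : ((-∑ i ∈ range n, b i : ℤ) : ℤ_[p]) + α = (p : ℤ_[p]) ^ n * β := by
      rw [hβ, Int.cast_neg]; ring
    have := C.lineAction_zpow α j (-∑ i ∈ range n, b i)
    rw [e, binom_pow_mul k β (not_dvd_of_pos_lt h1 h2), map_zero, zero_mul] at this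
    exact this
  · have := (isGen_one (R := R)).units_smul (C.t ^ (-∑ i ∈ range n, b i))
    rw [smul_eq_mul, mul_one] at this
    exact this
  · have : ((C.t ^ (-∑ i ∈ range n, b i) : Rˣ) : R) =
        ((powSeq (p := p) C.t a n : powSubring p R n) : R) *
          ((C.t ^ (-∑ i ∈ range (n + 1), b i) : Rˣ) : R) := by
      rw [powSeq_coe, ← Units.val_pow_eq_pow_val, ← Units.val_mul, ← zpow_natCast, ← zpow_add,
        sum_range_succ]
      congr 2
      simp only [hb]
      push_cast
      ring
    exact this

/-- The class of a bundle of rank one in `R¹lim`. -/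
noncomputable def Coordinate.cls [IsDomain R] [IsPrincipalIdealRing R] (C : Coordinate p D)
    (E : RankOne D) : RlimGm p R :=
  rlimMk (C.exists_hasFrames E.property).choose

theorem Coordinate.hasFrames_iff_cls [IsDomain R] [IsPrincipalIdealRing R] (C : Coordinate p D)
    (E : RankOne D) (u : ∀ n, (powSubring p R n)ˣ) :
    HasFrames E.obj u ↔ C.cls E = rlimMk u :=
  HasFrames.iff_rlimMk_eq C (C.exists_hasFrames E.property).choose_spec u

theorem Coordinate.cls_eq_iff [IsDomain R] [IsPrincipalIdealRing R] (C : Coordinate p D)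
    (E F : RankOne D) : C.cls E = C.cls F ↔ Nonempty (E.obj ≅ F.obj) := by
  obtain ⟨u, hu⟩ := C.exists_hasFrames E.property
  rw [(C.hasFrames_iff_cls E u).mp hu]
  constructor
  · exact fun h => hu.nonempty_iso ((C.hasFrames_iff_cls F u).mpr h.symm)
  · rintro ⟨i⟩
    exact ((C.hasFrames_iff_cls F u).mp (hu.of_iso i)).symm

theorem Coordinate.psi_cls_line [IsDomain R] [IsPrincipalIdealRing R] (C : Coordinate p D)
    [CharP k p] (α : ℤ_[p]) :
    C.psi (C.cls (rankOneLine D α)) = .ofAdd (α : ZpModZ p) := by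
  obtain ⟨a, ha⟩ := exists_digits α
  rw [(C.hasFrames_iff_cls (rankOneLine D α) _).mp (C.hasFrames_line ha), C.psi_apply,
    C.psiHom_powSeq ha]

theorem Coordinate.exists_iso_line [IsDomain R] [IsPrincipalIdealRing R] (C : Coordinate p D)
    [CharP k p] (E : RankOne D) :
    ∃ α : ℤ_[p], Nonempty (E.obj ≅ line D α) := by
  obtain ⟨α, hα⟩ := QuotientAddGroup.mk_surjective (C.psi (C.cls E)).toAdd
  refine ⟨α, (C.cls_eq_iff E (rankOneLine D α)).mp (C.psi.injective ?_)⟩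
  rw [C.psi_cls_line, hα]; rfl

theorem Coordinate.nonempty_line_iso_iff [IsDomain R] [IsPrincipalIdealRing R] (C : Coordinate p D)
    [CharP k p] (α β : ℤ_[p]) :
    Nonempty (line D α ≅ line D β) ↔ ∃ m : ℤ, α - β = m := by
  refine (C.cls_eq_iff (rankOneLine D α) (rankOneLine D β)).symm.trans ?_
  rw [← coe_eq_coe_iff, ← C.psi.injective.eq_iff, C.psi_cls_line, C.psi_cls_line,
    Multiplicative.ofAdd.injective.eq_iff]

theorem Coordinate.cls_trivial [IsDomain R] [IsPrincipalIdealRing R] (C : Coordinate p D) :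
    C.cls ⟨trivial D, trivial_rankOne D⟩ = 1 :=
  (C.hasFrames_iff_cls ⟨trivial D, trivial_rankOne D⟩ 1).mp hasFrames_trivial

theorem Coordinate.nonempty_line_iso_trivial_iff [IsDomain R] [IsPrincipalIdealRing R]
    (C : Coordinate p D) [CharP k p] (α : ℤ_[p]) :
    Nonempty (line D α ≅ trivial D) ↔ ∃ m : ℤ, α = m := by
  refine (C.cls_eq_iff (rankOneLine D α) ⟨trivial D, trivial_rankOne D⟩).symm.trans ?_
  rw [← C.psi.injective.eq_iff, C.psi_cls_line, C.cls_trivial, map_one, ← ofAdd_zero,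
    Multiplicative.ofAdd.injective.eq_iff,
    ← QuotientAddGroup.mk_zero, coe_eq_coe_iff]
  simp

theorem mk_eq_mk_iff (E F : RankOne D) : Pic.mk E = Pic.mk F ↔ Nonempty (E.obj ≅ F.obj) := by
  refine Quotient.eq.trans ⟨?_, ?_⟩
  · rintro ⟨i⟩
    exact ⟨(rankOne D).ι.mapIso i⟩
  · rintro ⟨i⟩
    exact ⟨(rankOne D).isoMk i⟩

/-- The class map on isomorphism classes. -/
noncomputable def Coordinate.picMap [IsDomain R] [IsPrincipalIdealRing R] (C : Coordinate p D) :
    Pic D → RlimGm p R :=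
  Quotient.lift C.cls fun E F h =>
    (C.cls_eq_iff E F).mpr ((mk_eq_mk_iff E F).mp (Quotient.sound h))

theorem Coordinate.picMap_bijective [IsDomain R] [IsPrincipalIdealRing R] (C : Coordinate p D)
    [CharP k p] : Function.Bijective C.picMap := by
  constructor
  · intro x y
    induction x using Quotient.inductionOn with | _ E
    induction y using Quotient.inductionOn with | _ F
    exact fun h => (mk_eq_mk_iff E F).mpr ((C.cls_eq_iff E F).mp h)
  · intro x
    obtain ⟨α, hα⟩ := QuotientAddGroup.mk_surjective (C.psi x).toAdd
    refine ⟨Pic.mk (rankOneLine D α), C.psi.injective ?_⟩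
    exact (C.psi_cls_line α).trans (by rw [hα]; rfl)

/-- The bijection between isomorphism classes of bundles of rank one and `R¹lim`. -/
noncomputable def Coordinate.picEquiv [IsDomain R] [IsPrincipalIdealRing R] (C : Coordinate p D)
    [CharP k p] : Pic D ≃ RlimGm p R :=
  Equiv.ofBijective C.picMap C.picMap_bijective

/-- The group structure on isomorphism classes, transported from `R¹lim`; the product is the tensor
product by `Coordinate.mk_tensor`. -/
@[reducible] noncomputable def Coordinate.picGroup [IsDomain R] [IsPrincipalIdealRing R]
    (C : Coordinate p D) [CharP k p] : CommGroup (Pic D) :=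
  C.picEquiv.commGroup

/-- The class construction as an isomorphism of groups. -/
noncomputable def Coordinate.phi [IsDomain R] [IsPrincipalIdealRing R] (C : Coordinate p D)
    [CharP k p] :
    letI := C.picGroup
    Pic D ≃* RlimGm p R :=
  letI := C.picGroup
  C.picEquiv.mulEquiv

theorem Coordinate.phi_mk [IsDomain R] [IsPrincipalIdealRing R] (C : Coordinate p D)
    [CharP k p] (E : RankOne D) : C.phi (Pic.mk E) = C.cls E := rfl

theorem Coordinate.mk_trivial [IsDomain R] [IsPrincipalIdealRing R] (C : Coordinate p D)
    [CharP k p] :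
    letI := C.picGroup
    Pic.mk ⟨trivial D, trivial_rankOne D⟩ = 1 := by
  let _ := C.picGroup
  refine C.phi.injective ?_
  rw [map_one]
  exact C.cls_trivial

theorem Coordinate.mk_tensor [IsDomain R] [IsPrincipalIdealRing R] (C : Coordinate p D)
    [CharP k p] (E F : RankOne D) :
    letI := C.picGroup
    ∃ h : rankOne D (tensor E.obj F.obj),
      Pic.mk ⟨tensor E.obj F.obj, h⟩ = Pic.mk E * Pic.mk F := by
  let _ := C.picGroup
  obtain ⟨u, hu⟩ := C.exists_hasFrames E.property
  obtain ⟨v, hv⟩ := C.exists_hasFrames F.property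
  have ht := hu.tensor hv
  refine ⟨ht.rankOne, C.phi.injective ?_⟩
  rw [map_mul, C.phi_mk, C.phi_mk, C.phi_mk, (C.hasFrames_iff_cls E u).mp hu,
    (C.hasFrames_iff_cls F v).mp hv, (C.hasFrames_iff_cls ⟨_, ht.rankOne⟩ _).mp ht, rlimMk_mul]

/-! ### Morphisms between bundles of rank one -/

theorem isIso_of_bijective {E F : StratBundle D} (f : E ⟶ F) (h : Function.Bijective f.lin) :
    IsIso f :=
  inferInstanceAs (IsIso (isoOfLinearEquiv (LinearEquiv.ofBijective f.lin h) f.comm).hom)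

/-- The image of a morphism of `O_R(α)` to `O_R(β)` is an ideal stable under the operators. -/
theorem Coordinate.line_hom_eq_zero_or_isIso [IsDomain R] (C : Coordinate p D)
    [CharP k p] {α β : ℤ_[p]} (f : line D α ⟶ line D β) :
    f = 0 ∨ IsIso f := by
  let φ : R →ₗ[R] R := f.lin
  have hcomm : ∀ n x, φ ((lineAction D α).δ n x) = (lineAction D β).δ n (φ x) := f.comm
  set g : R := φ 1 with hg
  have hf : ∀ x : R, φ x = x * g := by
    intro x
    have h := φ.map_smul x (1 : R)
    rwa [smul_eq_mul, mul_one] at h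
  have hδ : ∀ n, D.δ n g ∈ Ideal.span {g} := by
    intro n
    induction n using Nat.strong_induction_on with
    | _ n ih =>
      have h1 : φ (algebraMap k R (binom k α n)) = (lineAction D β).δ n g := by
        rw [← lineAction_one D α n, hcomm]
      have h2 := (lineAction D β).δ_smul n g 1
      rw [smul_eq_mul, mul_one, ← h1, hf, ← add_sum_erase _ _
        (show (n, 0) ∈ HasAntidiagonal.antidiagonal n by simp), HasseAction.δ_zero, smul_eq_mul,
        mul_one] at h2
      rw [show D.δ n g = _ from eq_sub_of_add_eq h2.symm]
      refine sub_mem (Ideal.mul_mem_left _ _ (Ideal.mem_span_singleton_self g))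
        (sum_mem fun q hq => ?_)
      obtain ⟨hne, hq⟩ := mem_erase.mp hq
      rw [HasAntidiagonal.mem_antidiagonal] at hq
      have hlt : q.1 < n := by
        rcases Nat.eq_zero_or_pos q.2 with h0 | h0
        · exact absurd (Prod.ext (by simpa [h0] using hq) h0) hne
        · omega
      exact Ideal.mul_mem_right _ _ (ih q.1 hlt)
  have hst : ∀ n, ∀ x ∈ Ideal.span {g}, D.δ n x ∈ Ideal.span {g} := by
    intro n x hx
    obtain ⟨y, rfl⟩ := Ideal.mem_span_singleton'.mp hx
    rw [D.δ_mul]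
    exact sum_mem fun q _ => Ideal.mul_mem_left _ _ (hδ q.2)
  rcases C.simple _ hst with h | h
  · left
    have h0 : g = 0 := Ideal.span_singleton_eq_bot.mp h
    have hφ : φ = 0 := LinearMap.ext fun x => by rw [hf, h0, mul_zero]; rfl
    exact StratBundle.hom_ext hφ
  · right
    obtain ⟨u, hu⟩ := Ideal.span_singleton_eq_top.mp h
    have hφ : Function.Bijective φ := by
      refine ⟨fun x y hxy => ?_, fun y => ⟨y * (u⁻¹ : Rˣ), ?_⟩⟩
      · rw [hf, hf, ← hu] at hxy
        exact u.mul_left_inj.mp hxy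
      · rw [hf, ← hu, Units.inv_mul_cancel_right]
    exact isIso_of_bijective f hφ

/-- Two morphisms of bundles of rank one differ by a constant if one of them is an isomorphism. -/
theorem Coordinate.exists_eq_smul (C : Coordinate p D)
    {E F : StratBundle D} {e : E} (he : IsGen R e) (f : E ⟶ F)
    [IsIso f] (g : E ⟶ F) : ∃ c : k, g = c • f := by
  have hfe : IsGen R (f.lin e) := he.map (linearEquivOfIso (asIso f))
  obtain ⟨c, hc, -⟩ := hfe (g.lin e)
  have hlin : g.lin = c • f.lin := by
    ext x
    obtain ⟨d, rfl, -⟩ := he x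
    rw [map_smul, hc, LinearMap.smul_apply, map_smul, smul_comm]
  have hδ : ∀ n, 0 < n → D.δ n c = 0 := by
    intro n
    induction n using Nat.strong_induction_on with
    | _ n ih =>
      intro hn
      have h1 := g.comm n e
      rw [hlin, LinearMap.smul_apply, LinearMap.smul_apply, f.comm, F.act.δ_smul,
        ← add_sum_erase _ _ (show (0, n) ∈ HasAntidiagonal.antidiagonal n by simp), D.δ_zero,
        left_eq_add, sum_eq_single_of_mem (n, 0), HasseAction.δ_zero] at h1
      · exact hfe.smul_eq_zero_iff.mp h1
      · exact mem_erase.mpr ⟨fun h => hn.ne' (congrArg Prod.fst h), by simp⟩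
      · intro q hq hne
        obtain ⟨hne', hq⟩ := mem_erase.mp hq
        rw [HasAntidiagonal.mem_antidiagonal] at hq
        rw [ih q.1, zero_smul]
        · rcases Nat.eq_zero_or_pos q.2 with h0 | h0
          · exact absurd (Prod.ext (by simpa [h0] using hq) h0) hne
          · omega
        · rcases Nat.eq_zero_or_pos q.1 with h0 | h0
          · exact absurd (Prod.ext h0 (by simpa [h0] using hq)) hne'
          · exact h0
  obtain ⟨d, hd⟩ := C.const c hδ
  exact ⟨d, StratBundle.hom_ext (by rw [hlin, hd, StratBundle.smul_lin])⟩

theorem Coordinate.nonempty_hom_equiv [IsDomain R] (C : Coordinate p D)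
    {E F : StratBundle D} {e : E} (he : IsGen R e) (i : E ≅ F) :
    Nonempty ((E ⟶ F) ≃ₗ[k] k) := by
  refine ⟨(LinearEquiv.ofBijective (LinearMap.toSpanSingleton k (E ⟶ F) i.hom) ⟨?_, ?_⟩).symm⟩
  · rw [← LinearMap.ker_eq_bot, LinearMap.ker_eq_bot']
    intro c hc
    have h1 : algebraMap k R c • i.hom.lin e = 0 :=
      congrArg (fun f : E ⟶ F => f.lin e) hc
    have hfe : IsGen R (i.hom.lin e) := he.map (linearEquivOfIso i)
    exact (map_eq_zero_iff _ (algebraMap k R).injective).mp (hfe.smul_eq_zero_iff.mp h1)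
  · intro g
    obtain ⟨c, hc⟩ := C.exists_eq_smul he i.hom g
    exact ⟨c, hc.symm⟩

theorem Coordinate.line_homs [IsDomain R] [IsPrincipalIdealRing R] (C : Coordinate p D)
    [CharP k p] (α β : ℤ_[p]) :
    (∀ f : line D α ⟶ line D β, f = 0 ∨ IsIso f) ∧
    ((∃ m : ℤ, α - β = m) → Nonempty ((line D α ⟶ line D β) ≃ₗ[k] k)) ∧
    ((¬ ∃ m : ℤ, α - β = m) → ∀ f : line D α ⟶ line D β, f = 0) := by
  refine ⟨C.line_hom_eq_zero_or_isIso, fun h => ?_, fun h f => ?_⟩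
  · obtain ⟨i⟩ := (C.nonempty_line_iso_iff α β).mpr h
    exact C.nonempty_hom_equiv (e := (1 : R)) isGen_one i
  · refine (C.line_hom_eq_zero_or_isIso f).resolve_right fun hf => h ?_
    exact (C.nonempty_line_iso_iff α β).mp ⟨asIso f⟩

end Pic

/-! ### Regular singularity -/

section Lattice
variable {p : ℕ} [Fact p.Prime] {k R : Type u} [Field k] [CharP k p] [CommRing R] [Algebra k R]

theorem lineAction_apply (D : HasseSystem k R) (α : ℤ_[p]) (n : ℕ) (f : R) :
    (lineAction D α).δ n f =
      ∑ q ∈ antidiagonal n, algebraMap k R (binom k α q.2) * D.δ q.1 f := by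
  simp only [lineAction, AddMonoidHom.finsetSum_apply, AddMonoidHom.comp_apply,
    AddMonoidHom.coe_mulLeft]

/-- The lattice `S · 1` in `O_R(α)`, for a stable subring `S` of `R`. -/
theorem line_hasStableLattice [IsDomain R] (D : HasseSystem k R) (α : ℤ_[p]) (S : Subring R)
    (hk : ∀ c : k, algebraMap k R c ∈ S) (hS : ∀ n, ∀ f ∈ S, D.δ n f ∈ S) :
    ∃ L : Submodule S (line D α), Module.Free S L ∧
      Module.finrank S L = Module.finrank R (line D α) ∧
      ∀ n, ∀ x ∈ L, (line D α).act.δ n x ∈ L := by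
  let L : Submodule S R := LinearMap.range (Algebra.linearMap S R)
  have hL : ∀ x : R, x ∈ L ↔ x ∈ S := fun x =>
    ⟨by rintro ⟨y, rfl⟩; exact y.2, fun h => ⟨⟨x, h⟩, rfl⟩⟩
  let i : S ≃ₗ[S] L := LinearEquiv.ofInjective (Algebra.linearMap S R) Subtype.val_injective
  have hrank : Module.finrank S L = Module.finrank R R :=
    (i.symm.finrank_eq.trans (Module.finrank_self S)).trans (Module.finrank_self R).symm
  have hδ : ∀ n, ∀ x ∈ L, (lineAction D α).δ n x ∈ L := by
    intro n x hx
    rw [hL] at hx ⊢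
    rw [lineAction_apply]
    exact sum_mem fun q _ => mul_mem (hk _) (hS _ _ hx)
  have hfree : Module.Free S L := Module.Free.of_equiv i
  exact ⟨L, hfree, hrank, hδ⟩

end Lattice

/-! ### Flat functions and their exponents -/

section Exponents
variable {p : ℕ} [Fact p.Prime] {k R : Type u} [Field k] [CharP k p] [CommRing R] [Algebra k R]
  {D : HasseSystem k R}

/-- A coefficient functional of exponent `r` vanishes on flat functions unless `p^n ∣ r`. -/
theorem eq_zero_of_mem_flat (c : R →+ k) (r : ℤ) {f : R} {n : ℕ}
    (hc : ∀ j, c (D.δ j f) = Ring.choose r j • c f) (hf : f ∈ D.self.flat (p ^ n))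
    (hr : ¬ (p : ℤ) ^ n ∣ r) : c f = 0 := by
  have hq : 0 < p ^ n := pow_pos (Fact.out : p.Prime).pos n
  have h1 : ∑ j ∈ range (p ^ n), (-1 : k) ^ j * c (D.δ j f) = c f := by
    rw [sum_eq_single 0]
    · rw [D.δ_zero]; simp
    · intro j hj h0
      have : D.δ j f = 0 := hf j (Nat.pos_of_ne_zero h0) (mem_range.mp hj)
      rw [this, map_zero, mul_zero]
    · intro h; exact absurd (mem_range.mpr hq) h
  have h2 : ∀ j, (-1 : k) ^ j * c (D.δ j f) = (-1 : k) ^ j * (Ring.choose r j : ℤ) * c f := by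
    intro j; rw [hc, zsmul_eq_mul, mul_assoc]
  rw [← h1]
  simp only [h2, ← sum_mul, sum_neg_one_pow_choose, if_neg hr, zero_mul]

/-- A coefficient functional of exponent `r ≠ 0` vanishes on constants. -/
theorem eq_zero_of_δ_eq_zero (p : ℕ) [Fact p.Prime] [CharP k p] (c : R →+ k) {r : ℤ} (hr : r ≠ 0)
    {f : R} (hc : ∀ j, c (D.δ j f) = Ring.choose r j • c f) (hf : ∀ j, 0 < j → D.δ j f = 0) :
    c f = 0 := by
  refine eq_zero_of_mem_flat (p := p) (n := r.natAbs) c r hc (fun j h1 _ => hf j h1) fun hd => ?_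
  have h1 := Int.natAbs_dvd_natAbs.mpr hd
  rw [Int.natAbs_pow, Int.natAbs_natCast] at h1
  have h2 := Nat.le_of_dvd (Int.natAbs_pos.mpr hr) h1
  have h3 : r.natAbs < p ^ r.natAbs := Nat.lt_pow_self (Fact.out : p.Prime).one_lt
  omega

end Exponents

section Kill
variable {p : ℕ} [Fact p.Prime] {k R : Type u} [CommRing R] [CharP R p] [Field k] [IsAlgClosed k]

theorem rlimMk_eq_one_of_root {w : ∀ n, (powSubring p R n)ˣ} {v y : ℕ → Rˣ}
    (hv : ∀ n, Units.map (powSubring p R n).subtype.toMonoidHom (w n) = v n ^ p ^ n)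
    (hy : ∀ n, y n = v n * y (n + 1) ^ p) : rlimMk w = 1 := by
  rw [← rlimMk_one, rlimMk_eq_iff]
  refine ⟨fun n => Units.map (iterateFrobenius R p n).rangeRestrict.toMonoidHom (y n)⁻¹,
    fun n => ?_⟩
  have h1 : ∀ n, (((Units.map (iterateFrobenius R p n).rangeRestrict.toMonoidHom (y n)⁻¹ :
      (powSubring p R n)ˣ) : powSubring p R n) : R) = (((y n)⁻¹ ^ p ^ n : Rˣ) : R) := fun n =>
    (iterateFrobenius_def (R := R) p n _).trans (Units.val_pow_eq_pow_val _ _).symm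
  have h2 : ((w n : powSubring p R n) : R) = ((v n ^ p ^ n : Rˣ) : R) := by rw [← hv]; rfl
  have h3 : (((1 : ∀ n, (powSubring p R n)ˣ) n : powSubring p R n) : R) = 1 := rfl
  rw [h1, h1, h2, h3, one_mul, ← Units.val_mul, hy n, mul_inv, mul_pow, ← mul_assoc, ← mul_pow,
    mul_inv_cancel, one_pow, one_mul, inv_pow, inv_pow, ← pow_mul, ← pow_succ']

theorem exists_root_chain (p : ℕ) [Fact p.Prime] (c : ℕ → kˣ) :
    ∃ d : ℕ → kˣ, ∀ n, d n = c n * d (n + 1) ^ p := by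
  have hp := (Fact.out : p.Prime).pos
  have hroot : ∀ a : kˣ, ∃ b : kˣ, b ^ p = a := by
    intro a
    obtain ⟨b, hb⟩ := IsAlgClosed.exists_pow_nat_eq (a : k) hp
    have hb0 : b ≠ 0 := by
      rintro rfl
      rw [zero_pow hp.ne'] at hb
      exact a.ne_zero hb.symm
    exact ⟨Units.mk0 b hb0, Units.ext hb⟩
  choose root hr using hroot
  refine ⟨fun n => Nat.rec 1 (fun n d => root ((c n)⁻¹ * d)) n, fun n => ?_⟩
  change _ = c n * root _ ^ p
  rw [hr, mul_inv_cancel_left]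

end Kill

/-! ### Infinite products of principal units -/

section Products
open PowerSeries
variable {p : ℕ} [Fact p.Prime] {k : Type u} [Field k] [CharP k p]

instance instCharPPowerSeries : CharP k⟦X⟧ p :=
  charP_of_injective_ringHom (C_injective (R := k)) p

/-- The partial products `h_n h_{n+1}^p ⋯ h_{n+N-1}^{p^{N-1}}`. -/
noncomputable def partialProd (p : ℕ) (h : ℕ → k⟦X⟧) : ℕ → ℕ → k⟦X⟧
  | _, 0 => 1
  | n, N + 1 => h n * partialProd p h (n + 1) N ^ p

theorem dvd_partialProd_succ_sub (h : ℕ → k⟦X⟧) (h1 : ∀ n, constantCoeff (h n) = 1) (n N : ℕ) :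
    X ^ p ^ N ∣ partialProd p h n (N + 1) - partialProd p h n N := by
  induction N generalizing n with
  | zero =>
    rw [pow_zero, pow_one, X_dvd_iff]
    simp [partialProd, h1]
  | succ N ih =>
    change _ ∣ h n * partialProd p h (n + 1) (N + 1) ^ p - h n * partialProd p h (n + 1) N ^ p
    rw [← mul_sub, ← sub_pow_char, pow_succ, pow_mul]
    exact Dvd.dvd.mul_left (pow_dvd_pow_of_dvd (ih (n + 1)) p) _

theorem dvd_partialProd_sub (h : ℕ → k⟦X⟧) (h1 : ∀ n, constantCoeff (h n) = 1) (n : ℕ) {N M : ℕ}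
    (hNM : N ≤ M) : X ^ p ^ N ∣ partialProd p h n M - partialProd p h n N := by
  induction M, hNM using Nat.le_induction with
  | base => simp
  | succ M hM ih =>
    rw [← sub_add_sub_cancel _ (partialProd p h n M)]
    exact dvd_add ((pow_dvd_pow _ (Nat.pow_le_pow_right (Fact.out : p.Prime).pos hM)).trans
      (dvd_partialProd_succ_sub h h1 n M)) ih

/-- The infinite products `z_n = h_n h_{n+1}^p h_{n+2}^{p^2} ⋯` of principal units converge, since
`h^{p^i} ≡ 1` modulo `X^{p^i}`. -/
theorem exists_infinite_product (h : ℕ → k⟦X⟧) (h1 : ∀ n, constantCoeff (h n) = 1) :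
    ∃ z : ℕ → k⟦X⟧, (∀ n, constantCoeff (z n) = 1) ∧ ∀ n, z n = h n * z (n + 1) ^ p := by
  have hp := (Fact.out : p.Prime)
  have hlt : ∀ N, N < p ^ N := fun N => Nat.lt_pow_self hp.one_lt
  refine ⟨fun n => PowerSeries.mk fun j => coeff j (partialProd p h n j), fun n => ?_, fun n => ?_⟩
  · rw [← coeff_zero_eq_constantCoeff_apply, coeff_mk]; simp [partialProd]
  have happrox : ∀ n N, X ^ N ∣ (PowerSeries.mk fun j => coeff j (partialProd p h n j)) -
      partialProd p h n N := by
    intro n N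
    rw [X_pow_dvd_iff]
    intro j hj
    have := X_pow_dvd_iff.mp (dvd_partialProd_sub (p := p) h h1 n hj.le) j (hlt j)
    rw [map_sub, sub_eq_zero] at this
    rw [map_sub, coeff_mk, this, sub_self]
  ext N
  rw [← sub_eq_zero, ← map_sub]
  refine X_pow_dvd_iff.mp (?_ : X ^ (N + 1) ∣ _) N (Nat.lt_succ_self N)
  rw [← sub_sub_sub_cancel_right _ _ (partialProd p h n (N + 1 + 1))]
  refine dvd_sub ((pow_dvd_pow _ (Nat.le_succ _)).trans (happrox n (N + 1 + 1))) ?_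
  rw [partialProd, ← mul_sub, ← sub_pow_char]
  exact Dvd.dvd.mul_left ((happrox (n + 1) (N + 1)).trans (dvd_pow_self _ hp.ne_zero)) _

theorem exists_powerSeries_chain [IsAlgClosed k] (h : ℕ → k⟦X⟧) (h0 : ∀ n, constantCoeff (h n) ≠ 0) :
    ∃ y : ℕ → k⟦X⟧, (∀ n, constantCoeff (y n) ≠ 0) ∧ ∀ n, y n = h n * y (n + 1) ^ p := by
  obtain ⟨d, hd⟩ := exists_root_chain p fun n => Units.mk0 _ (h0 n)
  obtain ⟨z, hz1, hz⟩ := exists_infinite_product (p := p)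
    (fun n => PowerSeries.C (constantCoeff (h n))⁻¹ * h n) fun n => by simp [h0 n]
  refine ⟨fun n => PowerSeries.C (d n : k) * z n, fun n => by simp [hz1], fun n => ?_⟩
  have hd' : (d n : k) = constantCoeff (h n) * (d (n + 1) : k) ^ p := by
    rw [hd]; simp
  have hC : PowerSeries.C (constantCoeff (h n)) * PowerSeries.C (constantCoeff (h n))⁻¹ =
      (1 : k⟦X⟧) := by
    rw [← map_mul, mul_inv_cancel₀ (h0 n), map_one]
  dsimp only
  rw [hz n, hd', map_mul, map_pow]
  calc _ = (PowerSeries.C (constantCoeff (h n)) * PowerSeries.C (constantCoeff (h n))⁻¹) *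
        (h n * (PowerSeries.C (d (n + 1) : k) * z (n + 1)) ^ p) := by ring
    _ = _ := by rw [hC, one_mul]

/-- A power series in `X^{p^n}` over a perfect field is a `p^n`-th power. -/
theorem exists_pow_eq_of_coeff [IsAlgClosed k] (n : ℕ) (h : k⟦X⟧)
    (hc : ∀ j, ¬ p ^ n ∣ j → coeff j h = 0) : ∃ g : k⟦X⟧, g ^ p ^ n = h := by
  have hq : 0 < p ^ n := pow_pos (Fact.out : p.Prime).pos n
  choose root hr using fun a : k => IsAlgClosed.exists_pow_nat_eq a hq
  refine ⟨PowerSeries.mk fun j => root (coeff (p ^ n * j) h), ?_⟩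
  ext j
  by_cases hj : p ^ n ∣ j
  · obtain ⟨i, rfl⟩ := hj
    rw [coeff_mul_pow_char_pow, coeff_mk, hr]
  · rw [coeff_pow_char_pow _ hj, hc j hj]

end Products

/-! ### The coordinate of `k((t))` -/

section Series
variable (k : Type u) [Field k]

/-- The order of vanishing on `k((t))ˣ`. -/
noncomputable def seriesOrd : (LaurentSeries k)ˣ →* Multiplicative ℤ where
  toFun u := .ofAdd (u : LaurentSeries k).order
  map_one' := by simp
  map_mul' u v := by rw [Units.val_mul, HahnSeries.order_mul u.ne_zero v.ne_zero, ofAdd_add]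

theorem seriesSystem_coeff (f : LaurentSeries k) (r : ℤ) (j : ℕ) :
    HahnSeries.coeff.addMonoidHom r ((seriesSystem k).δ j f) =
      Ring.choose r j • HahnSeries.coeff.addMonoidHom r f :=
  seriesδ_coeff k j f r

theorem seriesSystem_eigen : IsEigen (seriesSystem k) (seriesT k) := by
  intro n r
  rw [seriesT_zpow, ← zsmul_eq_mul]
  ext s
  change (seriesδ k n _).coeff s = _
  rw [seriesδ_coeff, HahnSeries.coeff_smul]
  by_cases h : s = r
  · rw [h]
  · rw [HahnSeries.coeff_single_of_ne h, smul_zero, smul_zero]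

variable {k}

/-- Units of order zero are units of `k⟦t⟧`. -/
theorem exists_powerSeries_of_ord_eq_one (u : (LaurentSeries k)ˣ) (h : seriesOrd k u = 1) :
    ∃ g : PowerSeries k, PowerSeries.constantCoeff g ≠ 0 ∧
      HahnSeries.ofPowerSeries ℤ k g = (u : LaurentSeries k) := by
  have h0 : (u : LaurentSeries k).order = 0 := Multiplicative.ofAdd.injective h
  refine ⟨(u : LaurentSeries k).powerSeriesPart, ?_, ?_⟩
  · rw [← PowerSeries.coeff_zero_eq_constantCoeff_apply, LaurentSeries.powerSeriesPart_coeff]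
    simp
  · have := LaurentSeries.single_order_mul_powerSeriesPart (u : LaurentSeries k)
    rw [h0] at this
    simpa using this

theorem series_const (p : ℕ) [Fact p.Prime] [CharP k p]
    (f : LaurentSeries k) (hf : ∀ j, 0 < j → (seriesSystem k).δ j f = 0) :
    ∃ c : k, f = algebraMap k (LaurentSeries k) c := by
  refine ⟨f.coeff 0, ?_⟩
  rw [LaurentSeries.algebraMap_apply]
  ext r
  by_cases hr : r = 0
  · simp [hr]
  · rw [HahnSeries.C_apply, HahnSeries.coeff_single_of_ne hr]
    exact eq_zero_of_δ_eq_zero p (HahnSeries.coeff.addMonoidHom r) hr (seriesSystem_coeff k f r) hf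

variable {p : ℕ} [Fact p.Prime] [CharP k p] [IsAlgClosed k]

theorem series_root (n : ℕ) (f : LaurentSeries k) (hf : f ∈ (seriesSystem k).self.flat (p ^ n)) :
    f ∈ powSubring p (LaurentSeries k) n := by
  have hc : ∀ r : ℤ, ¬ (p : ℤ) ^ n ∣ r → f.coeff r = 0 := fun r hr =>
    eq_zero_of_mem_flat (HahnSeries.coeff.addMonoidHom r) r (seriesSystem_coeff k f r) hf hr
  by_cases h0 : f = 0
  · rw [h0]; exact zero_mem _
  obtain ⟨N, hN⟩ : (p : ℤ) ^ n ∣ f.order := by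
    by_contra hd
    exact h0 (HahnSeries.coeff_order_eq_zero.mp (hc _ hd))
  obtain ⟨g, hg⟩ := exists_pow_eq_of_coeff n f.powerSeriesPart fun j hj => by
    rw [LaurentSeries.powerSeriesPart_coeff]
    refine hc _ fun hd => hj ?_
    rw [hN, dvd_add_right (dvd_mul_right _ _)] at hd
    exact_mod_cast hd
  refine ⟨HahnSeries.single N 1 * HahnSeries.ofPowerSeries ℤ k g, ?_⟩
  rw [iterateFrobenius_def, mul_pow, HahnSeries.single_pow, one_pow, ← map_pow, hg]
  have := LaurentSeries.single_order_mul_powerSeriesPart f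
  rw [hN] at this
  simpa using this

theorem series_kill (w : ∀ n, (powSubring p (LaurentSeries k) n)ˣ)
    (hw : ∀ n, seriesOrd k (Units.map (powSubring p (LaurentSeries k) n).subtype.toMonoidHom (w n)) = 1) :
    rlimMk w = 1 := by
  choose v hv using fun n => exists_root_unit n (w n)
  have hv1 : ∀ n, seriesOrd k (v n) = 1 := by
    intro n
    have h := hw n
    rw [hv, map_pow] at h
    exact (pow_eq_one_iff_left (pow_ne_zero n (Fact.out : p.Prime).ne_zero)).mp h
  choose h h0 hh using fun n => exists_powerSeries_of_ord_eq_one (v n) (hv1 n)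
  obtain ⟨y, hy0, hy⟩ := exists_powerSeries_chain (p := p) h h0
  have hne : ∀ n, HahnSeries.ofPowerSeries ℤ k (y n) ≠ 0 := fun n hz => hy0 n (by
    rw [(map_eq_zero_iff _ HahnSeries.ofPowerSeries_injective).mp hz, map_zero])
  refine rlimMk_eq_one_of_root (v := v) (y := fun n => Units.mk0 _ (hne n)) hv fun n => ?_
  apply Units.ext
  rw [Units.val_mul, Units.val_pow_eq_pow_val, Units.val_mk0, Units.val_mk0, hy, map_mul, map_pow,
    hh]

variable (p k) in
/-- The coordinate `t` of `k((t))`. -/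
noncomputable def seriesCoord : Coordinate p (seriesSystem k) where
  t := seriesT k
  ord := seriesOrd k
  ord_t := by
    change Multiplicative.ofAdd (HahnSeries.single (1 : ℤ) (1 : k)).order = _
    rw [HahnSeries.order_single one_ne_zero]
  eigen := seriesSystem_eigen k
  root := series_root
  simple I _ := Ideal.eq_bot_or_top I
  const := series_const p
  kill := series_kill

end Series

/-! ### The coordinate of `𝔾_m` -/

section Gm
variable (k : Type u) [Field k]

instance instIsPrincipalIdealRingLaurent : IsPrincipalIdealRing k[T;T⁻¹] := by
  refine ⟨fun I => ?_⟩
  obtain ⟨g, hg⟩ := IsPrincipalIdealRing.principal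
    (Ideal.under (Polynomial k) I)
  have h := IsLocalization.map_under (Submonoid.powers (Polynomial.X : Polynomial k)) k[T;T⁻¹] I
  rw [hg, Ideal.submodule_span_eq, Ideal.map_span, Set.image_singleton] at h
  exact ⟨_, h.symm⟩

/-- The coefficient of `t ^ r`. -/
def gmCoeff (r : ℤ) : k[T;T⁻¹] →+ k where
  toFun f := f.coeff r
  map_zero' := rfl
  map_add' _ _ := rfl

theorem gmSystem_coeff (f : k[T;T⁻¹]) (r : ℤ) (j : ℕ) :
    gmCoeff k r ((gmSystem k).δ j f) = Ring.choose r j • gmCoeff k r f :=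
  laurentδ_coeff k j f r

theorem gmT_zpow (r : ℤ) : ((gmT k ^ r : (k[T;T⁻¹])ˣ) : k[T;T⁻¹]) = T r := by
  induction r using Int.induction_on with
  | zero => rfl
  | succ n ih => rw [zpow_add, Units.val_mul, ih, zpow_one, T_add]; rfl
  | pred n ih => rw [zpow_sub, Units.val_mul, ih, zpow_one, T_sub]; rfl

theorem gmSystem_eigen : IsEigen (gmSystem k) (gmT k) := by
  intro n r
  rw [gmT_zpow, ← zsmul_eq_mul]
  have := laurentδ_C_mul_T k n 1 r
  rw [map_one, one_mul] at this
  exact this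

/-- The highest coefficient of a polynomial of degree `d` is extracted by `δ⁽ᵈ⁾`, so that a nonzero
stable ideal of `k[t, t⁻¹]` contains a power of `t`. -/
theorem gm_simple (I : Ideal k[T;T⁻¹]) (hI : ∀ n, ∀ x ∈ I, (gmSystem k).δ n x ∈ I) :
    I = ⊥ ∨ I = ⊤ := by
  rw [or_iff_not_imp_left]
  intro hne
  obtain ⟨f, hf, hf0⟩ := Submodule.exists_mem_ne_zero_of_ne_bot hne
  obtain ⟨n, g, hg⟩ := exists_T_pow f
  have hgI : Polynomial.toLaurent g ∈ I := by rw [hg]; exact I.mul_mem_right _ hf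
  have hg0 : g ≠ 0 := by
    rintro rfl
    rw [map_zero] at hg
    exact hf0 ((isUnit_T (n : ℤ)).mul_left_eq_zero.mp hg.symm)
  have key : (gmSystem k).δ g.natDegree (Polynomial.toLaurent g) =
      C g.leadingCoeff * T g.natDegree := by
    conv_lhs => arg 2; rw [g.as_sum_range_C_mul_X_pow]
    rw [map_sum, map_sum, sum_range_succ, sum_eq_zero, zero_add]
    · rw [Polynomial.toLaurent_C_mul_X_pow]
      refine (laurentδ_C_mul_T k _ _ _).trans ?_
      rw [Ring.choose_natCast, Nat.choose_self, Nat.cast_one, one_smul]; rfl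
    · intro i hi
      rw [Polynomial.toLaurent_C_mul_X_pow]
      refine (laurentδ_C_mul_T k _ _ _).trans ?_
      rw [Ring.choose_natCast, Nat.choose_eq_zero_of_lt (mem_range.mp hi), Nat.cast_zero, zero_smul]
  have hu : IsUnit (C g.leadingCoeff * T g.natDegree : k[T;T⁻¹]) :=
    ((isUnit_iff_ne_zero.mpr (Polynomial.leadingCoeff_ne_zero.mpr hg0)).map C).mul (isUnit_T _)
  exact Ideal.eq_top_of_isUnit_mem _ (key ▸ hI _ _ hgI) hu

theorem exists_eq_C_mul_T (u : (k[T;T⁻¹])ˣ) :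
    ∃ (c : kˣ) (n : ℤ), (u : k[T;T⁻¹]) = C (c : k) * T n := by
  obtain ⟨n, f, hf⟩ := exists_T_pow (u : k[T;T⁻¹])
  obtain ⟨m, g, hg⟩ := exists_T_pow ((u⁻¹ : (k[T;T⁻¹])ˣ) : k[T;T⁻¹])
  have hfg : f * g = Polynomial.X ^ (n + m) := by
    apply Polynomial.toLaurent_injective
    rw [map_mul, hf, hg, Polynomial.toLaurent_X_pow, Nat.cast_add, T_add, mul_mul_mul_comm,
      Units.mul_inv, one_mul]
  obtain ⟨i, -, a, ha⟩ := (dvd_prime_pow Polynomial.prime_X (n + m)).mp ⟨g, hfg.symm⟩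
  obtain ⟨c, hc, hca⟩ := Polynomial.isUnit_iff.mp (a⁻¹).isUnit
  have hf' : f = Polynomial.C c * Polynomial.X ^ i := by
    rw [← ha, hca, mul_comm, Units.mul_inv_cancel_right]
  refine ⟨hc.unit, i - n, ?_⟩
  rw [hf', Polynomial.toLaurent_C_mul_X_pow] at hf
  rw [IsUnit.unit_spec, T_sub, ← mul_assoc, hf, mul_T_assoc, add_neg_cancel, T_zero, mul_one]

/-- The order of vanishing at `t = 0`. -/
noncomputable def gmOrd : (k[T;T⁻¹])ˣ →* Multiplicative ℤ :=
  (seriesOrd k).comp (Units.map (inclZero k : k[T;T⁻¹] →+* LaurentSeries k).toMonoidHom)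

theorem gmOrd_of_eq {u : (k[T;T⁻¹])ˣ} {c : kˣ} {n : ℤ} (h : (u : k[T;T⁻¹]) = C (c : k) * T n) :
    gmOrd k u = .ofAdd n := by
  change Multiplicative.ofAdd (inclZero k (u : k[T;T⁻¹])).order = _
  rw [h, inclZero_C_mul_T, HahnSeries.order_single c.ne_zero]

theorem seriesOrd_inclInfty (u : (k[T;T⁻¹])ˣ) :
    (seriesOrd k (Units.map (inclInfty k : k[T;T⁻¹] →+* LaurentSeries k).toMonoidHom u)).toAdd =
      -1 * (gmOrd k u).toAdd := by
  obtain ⟨c, n, h⟩ := exists_eq_C_mul_T k u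
  rw [gmOrd_of_eq k h]
  change (inclZero k (invert (u : k[T;T⁻¹]))).order = _
  rw [h, map_mul, invert_C, invert_T, inclZero_C_mul_T, HahnSeries.order_single c.ne_zero]
  simp

variable {k}

theorem gm_const (p : ℕ) [Fact p.Prime] [CharP k p]
    (f : k[T;T⁻¹]) (hf : ∀ j, 0 < j → (gmSystem k).δ j f = 0) :
    ∃ c : k, f = algebraMap k k[T;T⁻¹] c := by
  refine ⟨f.coeff 0, ?_⟩
  rw [LaurentPolynomial.algebraMap_apply]
  ext r
  rw [C_apply]
  split_ifs with hr
  · simp [hr]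
  · exact eq_zero_of_δ_eq_zero p (gmCoeff k r) hr (gmSystem_coeff k f r) hf

variable {p : ℕ} [Fact p.Prime] [CharP k p] [IsAlgClosed k]

theorem gm_root (n : ℕ) (f : k[T;T⁻¹]) (hf : f ∈ (gmSystem k).self.flat (p ^ n)) :
    f ∈ powSubring p k[T;T⁻¹] n := by
  have hc : ∀ r : ℤ, ¬ (p : ℤ) ^ n ∣ r → f.coeff r = 0 := fun r hr =>
    eq_zero_of_mem_flat (gmCoeff k r) r (gmSystem_coeff k f r) hf hr
  rw [← AddMonoidAlgebra.sum_coeff_single f]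
  refine sum_mem fun r hr => ?_
  obtain ⟨s, hs⟩ : (p : ℤ) ^ n ∣ r := by
    by_contra hd
    exact Finsupp.mem_support_iff.mp hr (hc r hd)
  obtain ⟨b, hb⟩ := IsAlgClosed.exists_pow_nat_eq (f.coeff r)
    (pow_pos (Fact.out : p.Prime).pos n)
  refine ⟨C b * T s, ?_⟩
  rw [iterateFrobenius_def, mul_pow, ← map_pow, hb, T_pow, ← single_eq_C_mul_T, hs]
  push_cast
  rfl

theorem gm_kill (w : ∀ n, (powSubring p k[T;T⁻¹] n)ˣ)
    (hw : ∀ n, gmOrd k (Units.map (powSubring p k[T;T⁻¹] n).subtype.toMonoidHom (w n)) = 1) :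
    rlimMk w = 1 := by
  choose v hv using fun n => exists_root_unit n (w n)
  have hv1 : ∀ n, gmOrd k (v n) = 1 := by
    intro n
    have h := hw n
    rw [hv, map_pow] at h
    exact (pow_eq_one_iff_left (pow_ne_zero n (Fact.out : p.Prime).ne_zero)).mp h
  choose c m hcm using fun n => exists_eq_C_mul_T k (v n)
  have hm : ∀ n, m n = 0 := fun n =>
    Multiplicative.ofAdd.injective ((gmOrd_of_eq k (hcm n)).symm.trans (hv1 n))
  obtain ⟨d, hd⟩ := exists_root_chain p c
  refine rlimMk_eq_one_of_root (v := v)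
    (y := fun n => Units.map (C : k →+* k[T;T⁻¹]).toMonoidHom (d n)) hv fun n => ?_
  have hvn : v n = Units.map (C : k →+* k[T;T⁻¹]).toMonoidHom (c n) :=
    Units.ext (by rw [hcm, hm, T_zero, mul_one]; rfl)
  rw [hvn, ← map_pow, ← map_mul, hd n]

variable (p k) in
/-- The coordinate `t` of `𝔾_m`. -/
noncomputable def gmCoord : Coordinate p (gmSystem k) where
  t := gmT k
  ord := gmOrd k
  ord_t := gmOrd_of_eq k (c := 1) (by simp [gmT])
  eigen := gmSystem_eigen k
  root := gm_root
  simple := gm_simple k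
  const := gm_const p
  kill := gm_kill

end Gm

/-! ### Stable lattices in the bundles `O(α)` -/

section Regular
variable {p : ℕ} [Fact p.Prime] {k : Type u} [Field k] [CharP k p]

theorem seriesδ_ofPowerSeries (n : ℕ) (g : PowerSeries k) :
    seriesδ k n (HahnSeries.ofPowerSeries ℤ k g) = HahnSeries.ofPowerSeries ℤ k
      (PowerSeries.mk fun r => Ring.choose (r : ℤ) n • PowerSeries.coeff r g) := by
  ext r
  rw [seriesδ_coeff, PowerSeries.coeff_coe, PowerSeries.coeff_coe]
  split_ifs with h
  · rw [smul_zero]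
  · rw [PowerSeries.coeff_mk, Int.natAbs_of_nonneg (not_lt.mp h)]

theorem isRegularSingular_line (α : ℤ_[p]) : IsRegularSingular (line (seriesSystem k) α) := by
  refine line_hasStableLattice _ α _ (fun c => ⟨PowerSeries.C c, ?_⟩) ?_
  · rw [HahnSeries.ofPowerSeries_C, LaurentSeries.algebraMap_apply]
  · rintro n _ ⟨g, rfl⟩
    exact ⟨_, (seriesδ_ofPowerSeries n g).symm⟩

theorem isRegularSingularAtZero_line (α : ℤ_[p]) :
    IsRegularSingularAtZero (line (gmSystem k) α) := by
  refine line_hasStableLattice _ α _ (fun c => ⟨Polynomial.C c, ?_⟩) ?_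
  · rw [Polynomial.toLaurent_C, LaurentPolynomial.algebraMap_apply]; rfl
  · rintro n _ ⟨g, rfl⟩
    induction g using Polynomial.induction_on' with
    | add f g hf hg => rw [map_add, map_add]; exact add_mem hf hg
    | monomial i a =>
      rw [← Polynomial.C_mul_X_pow_eq_monomial, Polynomial.toLaurent_C_mul_X_pow]
      change laurentδ k n _ ∈ _
      rw [laurentδ_C_mul_T, ← Polynomial.toLaurent_C_mul_X_pow]
      exact zsmul_mem (RingHom.mem_range_self _ _) _

theorem isRegularSingularAtInfty_line (α : ℤ_[p]) :
    IsRegularSingularAtInfty (line (gmSystem k) α) := by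
  obtain ⟨L, h1, h2, h3⟩ := line_hasStableLattice (gmSystem k) α
    ((invert (R := k) : k[T;T⁻¹] →+* k[T;T⁻¹]).comp
      (Polynomial.toLaurent : Polynomial k →+* k[T;T⁻¹])).range
    (fun c => ⟨Polynomial.C c, by
      change invert (Polynomial.toLaurent (Polynomial.C c)) = _
      rw [Polynomial.toLaurent_C, invert_C, LaurentPolynomial.algebraMap_apply]; rfl⟩) (by
    rintro n _ ⟨g, rfl⟩
    induction g using Polynomial.induction_on' with
    | add f g hf hg => rw [map_add, map_add]; exact add_mem hf hg
    | monomial i a =>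
      have e : ((invert (R := k) : k[T;T⁻¹] →+* k[T;T⁻¹]).comp
          (Polynomial.toLaurent : Polynomial k →+* k[T;T⁻¹])) (Polynomial.monomial i a) =
          C a * T (-(i : ℤ)) := by
        rw [← Polynomial.C_mul_X_pow_eq_monomial]
        change invert (Polynomial.toLaurent _) = _
        rw [Polynomial.toLaurent_C_mul_X_pow, map_mul, invert_C, invert_T]
      rw [e]
      change laurentδ k n _ ∈ _
      rw [laurentδ_C_mul_T, ← e]
      exact zsmul_mem (RingHom.mem_range_self _ _) _)
  -- the operators of `t⁻¹` are integral combinations of those of `t`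
  have key : ∀ n, ∀ x : line (gmSystem k) α, x ∈ L →
      invOp (line (gmSystem k) α).act.δ n x ∈ L := by
    intro n x hx
    rw [invOp_apply]
    exact sum_mem fun j _ => zsmul_mem (h3 j x hx) _
  exact ⟨L, h1, h2, key⟩

end Regular

/-! ### Base change in rank one -/

section BaseChange
variable {k R R' : Type u} [Field k] [CommRing R] [Algebra k R] [CommRing R'] [Algebra k R']
  {D : HasseSystem k R} {D' : HasseSystem k R'} (φ : R →ₐ[k] R')
  (h : ∀ n f, D'.δ n (φ f) = φ (D.δ n f))

theorem baseChange_map_smul {E F : StratBundle D} (c : k) (f : E ⟶ F) :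
    (StratBundle.baseChange φ h).map (c • f) = c • (StratBundle.baseChange φ h).map f := by
  let _ := φ.toRingHom.toAlgebra
  refine StratBundle.hom_ext ?_
  change (algebraMap k R c • f.lin).baseChange R' = algebraMap k R' c • f.lin.baseChange R'
  rw [LinearMap.baseChange_smul]
  refine LinearMap.ext fun x => ?_
  rw [LinearMap.smul_apply, LinearMap.smul_apply, ← algebraMap_smul R' (algebraMap k R c)]
  exact congrArg (· • f.lin.baseChange R' x) (φ.commutes c)

theorem baseChange_map_injective (hφ : Function.Injective φ) {E F : StratBundle D} {e : E} {e' : F}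
    (he : IsGen R e) (he' : IsGen R e') {f g : E ⟶ F}
    (hfg : (StratBundle.baseChange φ h).map f = (StratBundle.baseChange φ h).map g) : f = g := by
  let _ := φ.toRingHom.toAlgebra
  have h1 : f.lin.baseChange R' ((1 : R') ⊗ₜ[R] e) = g.lin.baseChange R' ((1 : R') ⊗ₜ[R] e) :=
    congrArg (fun i => Hom.lin i ((1 : R') ⊗ₜ[R] e : TensorProduct R R' E)) hfg
  obtain ⟨c, hc, -⟩ := he' (f.lin e)
  obtain ⟨d, hd, -⟩ := he' (g.lin e)
  rw [LinearMap.baseChange_tmul, LinearMap.baseChange_tmul, hc, hd, ← TensorProduct.smul_tmul,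
    ← TensorProduct.smul_tmul, Algebra.smul_def, Algebra.smul_def, ← smul_eq_mul, ← smul_eq_mul,
    ← TensorProduct.smul_tmul', ← TensorProduct.smul_tmul'] at h1
  have hcd : c = d := hφ (he'.baseChange.smul_cancel h1)
  refine StratBundle.hom_ext (LinearMap.ext fun x => ?_)
  obtain ⟨b, rfl, -⟩ := he x
  rw [map_smul, map_smul, hc, hd, hcd]

theorem isIso_of_isGen {E F : StratBundle D} {e : E} (he : IsGen R e) (f : E ⟶ F)
    (hf : IsGen R (f.lin e)) : IsIso f := by
  refine isIso_of_bijective f ?_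
  have : ∀ x, f.lin x = (he.equiv.trans hf.equiv.symm) x := by
    intro x
    obtain ⟨c, rfl, -⟩ := he x
    simp
  rw [funext this]
  exact (he.equiv.trans hf.equiv.symm).bijective

end BaseChange

/-! ### Restriction from `𝔾_m` to the punctured formal discs at `0` and `∞` -/

section Restriction
variable {k : Type u} [Field k]

theorem inclZero_injective : Function.Injective (inclZero k) := by
  have hc : ∀ (f : k[T;T⁻¹]) (r : ℤ), (inclZero k f).coeff r = f.coeff r := by
    intro f r
    induction f using LaurentPolynomial.induction_on' with
    | add f g hf hg => rw [map_add, HahnSeries.coeff_add, hf, hg]; rfl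
    | C_mul_T n a =>
      rw [inclZero_C_mul_T, ← single_eq_C_mul_T, HahnSeries.coeff_single,
        AddMonoidAlgebra.coeff_single, Finsupp.single_apply]
      by_cases h : r = n <;> simp [h, eq_comm]
  intro f g hfg
  ext r
  rw [← hc, ← hc, hfg]

variable {p : ℕ} [Fact p.Prime] [CharP k p]

theorem hasFrames_resZero {E : StratBundle (gmSystem k)} {u : ∀ n, (powSubring p k[T;T⁻¹] n)ˣ}
    (h : HasFrames E u) :
    HasFrames ((resZero k).obj E) (unitsPiMap (inclZero k : k[T;T⁻¹] →+* LaurentSeries k) u) :=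
  h.baseChange (inclZero k) (inclZero_δ k)

theorem hasFrames_resInfty {E : StratBundle (gmSystem k)} {u : ∀ n, (powSubring p k[T;T⁻¹] n)ˣ}
    (h : HasFrames E u) :
    HasFrames ((resInfty k).obj E) (unitsPiMap (inclInfty k : k[T;T⁻¹] →+* LaurentSeries k) u) :=
  h.invCoord.baseChange (inclInfty k) (inclInfty_δ k)

variable [IsAlgClosed k]

variable (p) in
theorem psi_rlimMap_inclZero (x : RlimGm p k[T;T⁻¹]) :
    (seriesCoord k p).psi (rlimMap (inclZero k : k[T;T⁻¹] →+* LaurentSeries k) x) =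
      (gmCoord k p).psi x := by
  rw [(gmCoord k p).psi_rlimMap (seriesCoord k p) _ 1 fun u => (one_mul _).symm, zpow_one]

variable (p) in
theorem psi_rlimMap_inclInfty (x : RlimGm p k[T;T⁻¹]) :
    (seriesCoord k p).psi (rlimMap (inclInfty k : k[T;T⁻¹] →+* LaurentSeries k) x) =
      ((gmCoord k p).psi x)⁻¹ := by
  rw [(gmCoord k p).psi_rlimMap (seriesCoord k p) _ (-1) (seriesOrd_inclInfty k), zpow_neg_one]

theorem rankOne_resZero (p : ℕ) [Fact p.Prime] [CharP k p] (E : RankOne (gmSystem k)) :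
    rankOne (seriesSystem k) ((resZero k).obj E.obj) :=
  (hasFrames_resZero ((gmCoord k p).exists_hasFrames E.property).choose_spec).rankOne

theorem psi_cls_resZero (E : RankOne (gmSystem k)) :
    (seriesCoord k p).psi ((seriesCoord k p).cls ⟨_, rankOne_resZero p E⟩) =
      (gmCoord k p).psi ((gmCoord k p).cls E) := by
  obtain ⟨u, hu⟩ := (gmCoord k p).exists_hasFrames E.property
  rw [((seriesCoord k p).hasFrames_iff_cls ⟨_, rankOne_resZero p E⟩ _).mp (hasFrames_resZero hu),
    ((gmCoord k p).hasFrames_iff_cls E u).mp hu, ← psi_rlimMap_inclZero]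
  rfl

theorem psi_cls_resInfty (E : RankOne (gmSystem k)) :
    ∃ h : rankOne (seriesSystem k) ((resInfty k).obj E.obj),
      (seriesCoord k p).psi ((seriesCoord k p).cls ⟨(resInfty k).obj E.obj, h⟩) =
        ((gmCoord k p).psi ((gmCoord k p).cls E))⁻¹ := by
  obtain ⟨u, hu⟩ := (gmCoord k p).exists_hasFrames E.property
  have hr := hasFrames_resInfty hu
  refine ⟨hr.rankOne, ?_⟩
  rw [((seriesCoord k p).hasFrames_iff_cls ⟨_, hr.rankOne⟩ _).mp hr,
    ((gmCoord k p).hasFrames_iff_cls E u).mp hu, ← psi_rlimMap_inclInfty]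
  rfl

/-- Restriction to `k((t))` preserves classes, hence detects isomorphism in rank one. -/
theorem nonempty_iso_of_resZero (p : ℕ) [Fact p.Prime] [CharP k p] (E F : RankOne (gmSystem k))
    (i : (resZero k).obj E.obj ≅ (resZero k).obj F.obj) : Nonempty (E.obj ≅ F.obj) := by
  rw [← (gmCoord k p).cls_eq_iff, ← (gmCoord k p).psi.injective.eq_iff, ← psi_cls_resZero,
    ← psi_cls_resZero]
  exact congrArg _ (((seriesCoord k p).cls_eq_iff ⟨_, rankOne_resZero p E⟩
    ⟨_, rankOne_resZero p F⟩).mpr ⟨i⟩)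

/-- Fullness of the restriction in rank one. A nonzero morphism of the restrictions is an isomorphism,
so the bundles have the same class and are isomorphic over `𝔾_m`; all morphisms of the restrictions
are then constant multiples of the restriction of such an isomorphism. -/
theorem resZero_map_surjective (p : ℕ) [Fact p.Prime] [CharP k p] (E F : RankOne (gmSystem k))
    (g : (resZero k).obj E.obj ⟶ (resZero k).obj F.obj) :
    ∃ f : E.obj ⟶ F.obj, (resZero k).map f = g := by
  obtain ⟨e, he⟩ := (seriesCoord k p).exists_gen (rankOne_resZero p E)
  obtain ⟨e', he'⟩ := (seriesCoord k p).exists_gen (rankOne_resZero p F)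
  obtain ⟨c, hc, -⟩ := he' (g.lin e)
  by_cases hc0 : c = 0
  -- as a scalar multiple, the zero morphism restricts to zero by `k`-linearity
  · refine ⟨(0 : k) • 0, (baseChange_map_smul _ (inclZero_δ k) _ _).trans ?_⟩
    rw [zero_smul]
    have hz : ∀ x, g.lin x = 0 := fun x => by
      obtain ⟨d, rfl, -⟩ := he x
      rw [map_smul, hc, hc0, zero_smul, smul_zero]
    exact StratBundle.hom_ext (LinearMap.ext fun x => (hz x).symm)
  · have hge : IsGen (LaurentSeries k) (g.lin e) := by
      rw [hc]; exact he'.units_smul (Units.mk0 c hc0)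
    have hg := isIso_of_isGen he g hge
    obtain ⟨i⟩ := nonempty_iso_of_resZero p E F (asIso g)
    obtain ⟨d, hd⟩ := (seriesCoord k p).exists_eq_smul he ((resZero k).map i.hom) g
    exact ⟨d • i.hom, (baseChange_map_smul _ (inclZero_δ k) _ _).trans hd.symm⟩

theorem resZero_isEquivalence (p : ℕ) [Fact p.Prime] [CharP k p]
    (h : ∀ E : RankOne (gmSystem k), rankOne (seriesSystem k) ((resZero k).obj E.obj)) :
    ((rankOne (seriesSystem k)).lift ((rankOne (gmSystem k)).ι ⋙ resZero k) h).IsEquivalence := by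
  have hfaith : ((rankOne (gmSystem k)).ι ⋙ resZero k).Faithful :=
    ⟨fun {E F f g} hfg => by
      obtain ⟨e, he⟩ := (gmCoord k p).exists_gen E.property
      obtain ⟨e', he'⟩ := (gmCoord k p).exists_gen F.property
      exact (rankOne (gmSystem k)).ι.map_injective
        (baseChange_map_injective _ (inclZero_δ k) inclZero_injective he he' hfg)⟩
  have hfull : ((rankOne (gmSystem k)).ι ⋙ resZero k).Full :=
    ⟨fun {E F} g => by
      obtain ⟨f, hf⟩ := resZero_map_surjective p E F g
      exact ⟨(rankOne (gmSystem k)).homMk f, hf⟩⟩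
  refine { faithful := inferInstance, full := inferInstance, essSurj := ⟨fun E => ?_⟩ }
  obtain ⟨α, hα⟩ := (seriesCoord k p).exists_iso_line E
  refine ⟨rankOneLine (gmSystem k) α, ?_⟩
  have hcls : (seriesCoord k p).cls ⟨_, rankOne_resZero p (rankOneLine (gmSystem k) α)⟩ =
      (seriesCoord k p).cls E := by
    rw [((seriesCoord k p).cls_eq_iff E (rankOneLine _ α)).mpr hα,
      ← (seriesCoord k p).psi.injective.eq_iff, psi_cls_resZero, Coordinate.psi_cls_line,
      Coordinate.psi_cls_line]
  obtain ⟨i⟩ := ((seriesCoord k p).cls_eq_iff _ E).mp hcls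
  exact ⟨(rankOne (seriesSystem k)).isoMk i⟩

end Restriction

end Stratified

theorem mainTheorem8 {p : ℕ} [Fact p.Prime] {k : Type*} [Field k] [IsAlgClosed k] [CharP k p] :
    -- triviality of `O_R(α)`
    (∀ α : ℤ_[p],
      (Nonempty (line (gmSystem k) α ≅ trivial (gmSystem k)) ↔ ∃ m : ℤ, α = m) ∧
      (Nonempty (line (seriesSystem k) α ≅ trivial (seriesSystem k)) ↔ ∃ m : ℤ, α = m)) ∧
    -- homomorphisms
    (∀ α β : ℤ_[p],
    (∀ f : line (gmSystem k) α ⟶ line (gmSystem k) β, f = 0 ∨ IsIso f) ∧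
    ((∃ m : ℤ, α - β = m) → Nonempty ((line (gmSystem k) α ⟶ line (gmSystem k) β) ≃ₗ[k] k)) ∧
    ((¬ ∃ m : ℤ, α - β = m) → ∀ f : line (gmSystem k) α ⟶ line (gmSystem k) β, f = 0)) ∧
    (∀ α β : ℤ_[p],
    (∀ f : line (seriesSystem k) α ⟶ line (seriesSystem k) β, f = 0 ∨ IsIso f) ∧
    ((∃ m : ℤ, α - β = m) → Nonempty ((line (seriesSystem k) α ⟶ line (seriesSystem k) β) ≃ₗ[k] k)) ∧
    ((¬ ∃ m : ℤ, α - β = m) → ∀ f : line (seriesSystem k) α ⟶ line (seriesSystem k) β, f = 0)) ∧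
    -- regular singularity
    (∀ α : ℤ_[p], IsRegularSingular (line (seriesSystem k) α) ∧
      IsRegularSingularAtZero (line (gmSystem k) α) ∧
      IsRegularSingularAtInfty (line (gmSystem k) α)) ∧
    -- the groups of isomorphism classes
    (∃ (_ : CommGroup (Pic (gmSystem k))) (_ : CommGroup (Pic (seriesSystem k)))
      (Φ : Pic (gmSystem k) ≃* RlimGm p k[T;T⁻¹])
      (Φ' : Pic (seriesSystem k) ≃* RlimGm p (LaurentSeries k))
      (Ψ : RlimGm p k[T;T⁻¹] ≃* Multiplicative (ZpModZ p))
      (Ψ' : RlimGm p (LaurentSeries k) ≃* Multiplicative (ZpModZ p)),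
    -- tensor product and unit, for k[T;T⁻¹]
    (Pic.mk ⟨trivial (gmSystem k), trivial_rankOne (gmSystem k)⟩ = 1) ∧
    (∀ E F : RankOne (gmSystem k), ∃ h : rankOne (gmSystem k) (tensor E.obj F.obj),
      Pic.mk ⟨tensor E.obj F.obj, h⟩ = Pic.mk E * Pic.mk F) ∧
    -- the class in R¹lim is the class of the transition units of the bundle
    (∀ (E : RankOne (gmSystem k)) (v : ∀ n, (powSubring p (k[T;T⁻¹]) n)ˣ),
      E.obj.IsDescribedBy v ↔ Φ (Pic.mk E) = rlimMk v) ∧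
    (∀ (α : ℤ_[p]) (a : ℕ → ℕ), (∀ n, a n < p) →
      HasSum (fun n => (a n : ℤ_[p]) * (p : ℤ_[p]) ^ n) α →
      Φ (Pic.mk (rankOneLine (gmSystem k) α)) = rlimMk (powSeq (gmT k) a)) ∧
    (∀ α : ℤ_[p],
      Ψ (Φ (Pic.mk (rankOneLine (gmSystem k) α))) = .ofAdd (α : ZpModZ p)) ∧
    (∀ E : RankOne (gmSystem k), ∃ α : ℤ_[p], Nonempty (E.obj ≅ line (gmSystem k) α)) ∧
    -- tensor product and unit, for LaurentSeries k
    (Pic.mk ⟨trivial (seriesSystem k), trivial_rankOne (seriesSystem k)⟩ = 1) ∧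
    (∀ E F : RankOne (seriesSystem k), ∃ h : rankOne (seriesSystem k) (tensor E.obj F.obj),
      Pic.mk ⟨tensor E.obj F.obj, h⟩ = Pic.mk E * Pic.mk F) ∧
    -- the class in R¹lim is the class of the transition units of the bundle
    (∀ (E : RankOne (seriesSystem k)) (v : ∀ n, (powSubring p (LaurentSeries k) n)ˣ),
      E.obj.IsDescribedBy v ↔ Φ' (Pic.mk E) = rlimMk v) ∧
    (∀ (α : ℤ_[p]) (a : ℕ → ℕ), (∀ n, a n < p) →
      HasSum (fun n => (a n : ℤ_[p]) * (p : ℤ_[p]) ^ n) α →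
      Φ' (Pic.mk (rankOneLine (seriesSystem k) α)) = rlimMk (powSeq (seriesT k) a)) ∧
    (∀ α : ℤ_[p],
      Ψ' (Φ' (Pic.mk (rankOneLine (seriesSystem k) α))) = .ofAdd (α : ZpModZ p)) ∧
    (∀ E : RankOne (seriesSystem k), ∃ α : ℤ_[p], Nonempty (E.obj ≅ line (seriesSystem k) α)) ∧
    -- the two inclusions on R¹lim
    (∀ x, Ψ' (rlimMap (inclZero k : k[T;T⁻¹] →+* LaurentSeries k) x) = Ψ x) ∧
    (∀ x, Ψ' (rlimMap (inclInfty k : k[T;T⁻¹] →+* LaurentSeries k) x) = (Ψ x)⁻¹) ∧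
    -- the two restrictions on isomorphism classes
    (∀ E : RankOne (gmSystem k), ∃ h : rankOne (seriesSystem k) ((resZero k).obj E.obj),
      Ψ' (Φ' (Pic.mk ⟨(resZero k).obj E.obj, h⟩)) = Ψ (Φ (Pic.mk E))) ∧
    (∀ E : RankOne (gmSystem k), ∃ h : rankOne (seriesSystem k) ((resInfty k).obj E.obj),
      Ψ' (Φ' (Pic.mk ⟨(resInfty k).obj E.obj, h⟩)) = (Ψ (Φ (Pic.mk E)))⁻¹)) ∧
    -- restriction to `k((t))` is an equivalence in rank one
    (∃ h : ∀ E : RankOne (gmSystem k), rankOne (seriesSystem k) ((resZero k).obj E.obj),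
      ((rankOne (seriesSystem k)).lift ((rankOne (gmSystem k)).ι ⋙ resZero k) h).IsEquivalence) := by
  have hdesc : ∀ {R : Type _} [CommRing R] [Algebra k R] [CharP R p] [IsDomain R]
      [IsPrincipalIdealRing R] {D : HasseSystem k R} (C : Coordinate p D) (E : RankOne D)
      (v : ∀ n, (powSubring p R n)ˣ), E.obj.IsDescribedBy v ↔ C.phi (Pic.mk E) = rlimMk v :=
    fun C E v => (C.isDescribedBy_iff E.property v).trans (C.hasFrames_iff_cls E v)
  have hline : ∀ {R : Type _} [CommRing R] [Algebra k R] [CharP R p] [IsDomain R]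
      [IsPrincipalIdealRing R] {D : HasseSystem k R} (C : Coordinate p D) (α : ℤ_[p]) (a : ℕ → ℕ),
      HasSum (fun n => (a n : ℤ_[p]) * (p : ℤ_[p]) ^ n) α →
      C.phi (Pic.mk (rankOneLine D α)) = rlimMk (powSeq C.t a) :=
    fun C α a ha => (C.hasFrames_iff_cls _ _).mp (C.hasFrames_line ha)
  refine ⟨fun α => ⟨(gmCoord k p).nonempty_line_iso_trivial_iff α,
      (seriesCoord k p).nonempty_line_iso_trivial_iff α⟩,
    (gmCoord k p).line_homs, (seriesCoord k p).line_homs,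
    fun α => ⟨isRegularSingular_line α, isRegularSingularAtZero_line α,
      isRegularSingularAtInfty_line α⟩, ?_, ?_⟩
  · exact ⟨(gmCoord k p).picGroup, (seriesCoord k p).picGroup, (gmCoord k p).phi,
      (seriesCoord k p).phi, (gmCoord k p).psi, (seriesCoord k p).psi,
      (gmCoord k p).mk_trivial, (gmCoord k p).mk_tensor, hdesc _,
      fun α a _ ha => hline (gmCoord k p) α a ha, (gmCoord k p).psi_cls_line,
      (gmCoord k p).exists_iso_line,
      (seriesCoord k p).mk_trivial, (seriesCoord k p).mk_tensor, hdesc _,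
      fun α a _ ha => hline (seriesCoord k p) α a ha, (seriesCoord k p).psi_cls_line,
      (seriesCoord k p).exists_iso_line,
      psi_rlimMap_inclZero p, psi_rlimMap_inclInfty p,
      fun E => ⟨rankOne_resZero p E, psi_cls_resZero E⟩, psi_cls_resInfty⟩
  · exact ⟨rankOne_resZero p, resZero_isEquivalence p _⟩
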